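/- Let $X$ be a complex manifold of pure dimension $N$ (Hausdorff and second countable), for instance the complex manifold underlying a smooth complex variety, and let $D=\bigcup_{i\in I}\overline D_i$ be a divisor with simple normal crossings, $I$ finite: around each point of $X$ there are holomorphic coordinates in which those $\overline D_i$ that pass through the point are given by the vanishing of distinct coordinates, and which are defined on an open set that the other $\overline D_i$ do not meet. For $J\subseteq I$ put $\overline D_J=\bigcap_{j\in J}\overline D_j$ (so $\overline D_\emptyset=X$), and let $b_J:\widehat D_J\to\overline D_J$ be the real oriented blow-up of $\overline D_J$ along $\bigcup_{i\notin J}\overline D_{J\cup\{i\}}$. A point of $\widehat D_J$ is thus a point $x\in\overline D_J$ together with, for each $i\in I\setminus J$ with $x\in\overline D_i$, a ray in the fibre at $x$ of the normal bundle of $\overline D_i$ in $X$, that is, a point of the circle $SN(\overline D_i/X)_x$; its topology is the usual one, given by polar coordinates. For a chain $J_0\subsetneq J_1\subsetneq\dots\subsetneq J_k\subseteq I$ put $$\widehat D_{J_0,\dots,J_k}=\widehat D_{J_0}\times_{\overline D_{J_0}}\overline D_{J_k}.$$ Let $X_\bullet$ be the semi-simplicial space (simplicial space without degeneracies) with $X_k=\coprod_{J_0\subsetneq\dots\subsetneq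 J_k}\widehat D_{J_0,\dots,J_k}$ and with the following face maps $f_l:\widehat D_{J_0,\dots,J_k}\to\widehat D_{J_0,\dots,\widehat{J_l},\dots,J_k}$: for $0<l<k$, $f_l$ is the identity; $f_k$ is induced by the inclusion $\overline D_{J_k}\subseteq\overline D_{J_{k-1}}$; and $f_0$ forgets the normal rays of the $\overline D_i$ with $i\in J_1\setminus J_0$. Let $|X_\bullet|$ be the geometric realization of $X_\bullet$, i.e. the quotient of $\coprod_k X_k\times\Delta_k$ by the identifications $$(x,(t_0,\dots,t_{l-1},0,t_{l+1},\dots,t_k))\sim(f_l(x),(t_0,\dots,t_{l-1},t_{l+1},\dots,t_k)),$$ and let $\mathrm{hocolim}\,X_\bullet$ be the (Bousfield–Kan) homotopy colimit of $X_\bullet$, regarded as a diagram of spaces indexed by the opposite of the category of the ordered sets $\{0,\dots,n\}$ and strictly increasing maps. Then: 1. The canonical map $|X_\bullet|\to X$, induced by the blow-down maps $\widehat D_{J_0,\dots,J_k}\to\overline D_{J_k}\subseteq X$, is a homotopy equivalence. 2. The canonical map $\mathrm{hocolim}\,X_\bullet\to X$, induced by the same maps, is a homotopy equivalence. 3. For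 every chain $J_0\subsetneq\dots\subsetneq J_k$ the projection $\widehat D_{J_0,\dots,J_k}\to\widehat D_{J_k}$, which forgets the normal rays of the $\overline D_i$ with $i\in J_k\setminus J_0$, is a locally trivial bundle whose fibre is the torus $(S^1)^{J_k\setminus J_0}$. -/

import Mathlib

open CategoryTheory Topology Manifold
open scoped ContDiff ContinuousMap

universe u v w

noncomputable section

namespace SNC

/-! ### Smooth divisors, simple normal crossings, normal rays -/

section Divisors

variable {N : ℕ} {X : Type u} [TopologicalSpace X] [ChartedSpace (Fin N → ℂ) X]

/-- `f` is a (reduced, holomorphic) local equation on the open set `U` of the smooth divisor `D` of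
the `N`-dimensional complex manifold `X`. On open sets which do not meet `D`, these are the nowhere
vanishing holomorphic functions. -/
structure IsLocalEquation (N : ℕ) {X : Type u} [TopologicalSpace X] [ChartedSpace (Fin N → ℂ) X]
    (D U : Set X) (f : X → ℂ) : Prop where
  isOpen : IsOpen U
  holomorphic : ContMDiffOn 𝓘(ℂ, Fin N → ℂ) 𝓘(ℂ, ℂ) ω f U
  mem_iff : ∀ x ∈ U, x ∈ D ↔ f x = 0
  mfderiv_ne_zero : ∀ x ∈ U, x ∈ D → mfderiv 𝓘(ℂ, Fin N → ℂ) 𝓘(ℂ, ℂ) f x ≠ 0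

/-- The family of subsets `D i` of the `N`-dimensional complex manifold `X` consists of (possibly
empty or disconnected) smooth divisors, whose union is a divisor with simple normal crossings:
around each point `x` of `X` there are holomorphic coordinates `φ` such that the `D i` that meet the
domain of `φ` are those that contain `x`, and these are given by the vanishing of distinct
coordinates. -/
def IsSNC (N : ℕ) {X : Type u} [TopologicalSpace X] [ChartedSpace (Fin N → ℂ) X] {I : Type v}
    (D : I → Set X) : Prop :=
  ∀ x : X, ∃ φ ∈ IsManifold.maximalAtlas 𝓘(ℂ, Fin N → ℂ) ω X, x ∈ φ.source ∧
    ∃ c : {i : I // x ∈ D i} ↪ Fin N,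
      ∀ y ∈ φ.source, ∀ i : I, y ∈ D i ↔ ∃ h : x ∈ D i, φ y (c ⟨i, h⟩) = 0

/-- The tangent space of the smooth divisor `D` at its point `x`, as a subspace of the tangent space
of `X`: the common kernel of the differentials of the local equations of `D` at `x`. -/
def tangentToDivisor (D : Set X) (x : X) : Submodule ℂ (TangentSpace 𝓘(ℂ, Fin N → ℂ) x) :=
  ⨅ (U : Set X) (f : X → ℂ) (_ : IsLocalEquation N D U f) (_ : x ∈ U),
    LinearMap.ker (mfderiv 𝓘(ℂ, Fin N → ℂ) 𝓘(ℂ, ℂ) f x).toLinearMap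

/-- The fibre `T_x X / T_x D` of the normal bundle `N(D/X)`. -/
def NormalSpace (N : ℕ) {X : Type u} [TopologicalSpace X] [ChartedSpace (Fin N → ℂ) X]
    (D : Set X) (x : X) : Type :=
  TangentSpace 𝓘(ℂ, Fin N → ℂ) x ⧸ tangentToDivisor (N := N) D x

instance (D : Set X) (x : X) : AddCommGroup (NormalSpace N D x) :=
  inferInstanceAs (AddCommGroup
    (TangentSpace 𝓘(ℂ, Fin N → ℂ) x ⧸ tangentToDivisor (N := N) D x))

instance (D : Set X) (x : X) : Module ℂ (NormalSpace N D x) :=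
  inferInstanceAs (Module ℂ
    (TangentSpace 𝓘(ℂ, Fin N → ℂ) x ⧸ tangentToDivisor (N := N) D x))

/-- The fibre `SN(D/X)_x = (N_x ∖ 0) / ℝ_{>0}` of the circle bundle associated with the normal
bundle of `D`. -/
abbrev NormalRay (N : ℕ) {X : Type u} [TopologicalSpace X] [ChartedSpace (Fin N → ℂ) X]
    (D : Set X) (x : X) : Type :=
  Module.Ray ℝ (NormalSpace N D x)

/-- The differential at `x` of a local equation of `D`, as a linear form on the normal space. -/
def normalDifferential {D U : Set X} {f : X → ℂ} (hf : IsLocalEquation N D U f) {x : X}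
    (hx : x ∈ U) : NormalSpace N D x →ₗ[ℂ] ℂ :=
  (tangentToDivisor (N := N) D x).liftQ (mfderiv 𝓘(ℂ, Fin N → ℂ) 𝓘(ℂ, ℂ) f x).toLinearMap
    ((iInf_le _ U).trans <| (iInf_le _ f).trans <| (iInf_le _ hf).trans <| iInf_le _ hx)

/-- The phase `L v / |L v|` of the values of a complex linear form `L` on a ray `ℝ_{>0} v`. -/
def rayPhase {M : Type*} [AddCommGroup M] [Module ℂ M] (L : M →ₗ[ℂ] ℂ) :
    Module.Ray ℝ M → ℂ :=
  Quotient.lift (fun v : RayVector ℝ M => L (RayVector.equiv ℝ M v).1 /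
      (‖L (RayVector.equiv ℝ M v).1‖ : ℂ)) (by
    intro v w h
    obtain ⟨a, b, ha, hb, hab⟩ := SameRay.exists_pos (R := ℝ) h
      (RayVector.equiv ℝ M v).2 (RayVector.equiv ℝ M w).2
    have key : ∀ (r : ℝ), 0 < r → ∀ z : M,
        L (r • z) / (‖L (r • z)‖ : ℂ) = L z / (‖L z‖ : ℂ) := by
      intro r hr z
      have h1 : L (r • z) = (r : ℂ) * L z := by
        rw [← Complex.coe_smul r z, map_smul, smul_eq_mul]
      rw [h1, norm_mul, Complex.norm_real, Real.norm_of_nonneg hr.le, Complex.ofReal_mul]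
      exact mul_div_mul_left _ _ (by exact_mod_cast hr.ne')
    show L (RayVector.equiv ℝ M v).1 / (‖L (RayVector.equiv ℝ M v).1‖ : ℂ) =
      L (RayVector.equiv ℝ M w).1 / (‖L (RayVector.equiv ℝ M w).1‖ : ℂ)
    rw [← key a ha (RayVector.equiv ℝ M v).1, ← key b hb (RayVector.equiv ℝ M w).1, hab])

end Divisors

/-! ### Real oriented blow-ups -/

/-- The real oriented blow-up of `X` along the smooth divisor `D`: a point of it is a point `x` of
`X`, together with a normal ray of `D` at `x` if `x` lies on `D`. -/
structure DivisorBlowUp (N : ℕ) {X : Type u} [TopologicalSpace X] [ChartedSpace (Fin N → ℂ) X]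
    (D : Set X) : Type u where
  base : X
  ray : base ∈ D → NormalRay N D base

section BlowUps

variable {N : ℕ} {X : Type u} [TopologicalSpace X] [ChartedSpace (Fin N → ℂ) X]

open Classical in
/-- The phase on the real oriented blow-up of a local equation `f` of `D`: it is `f / |f|` outside
`D`, and `df_x v / |df_x v|` on the ray of the normal vector `v` at the point `x` of `D`. -/
def DivisorBlowUp.phase {D U : Set X} {f : X → ℂ} (hf : IsLocalEquation N D U f)
    (p : DivisorBlowUp N D) (hp : p.base ∈ U) : ℂ :=
  if h : p.base ∈ D then rayPhase (normalDifferential hf hp) (p.ray h)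
  else f p.base / (‖f p.base‖ : ℂ)

/-- The topology of the real oriented blow-up is the coarsest one for which the projection to `X`
is continuous, and so is (on the inverse image of its domain) the phase of each local equation
of `D`. In local coordinates in which `D` is `z₁ = 0`, this is the usual description by polar
coordinates `z₁ = r θ`, with `r ≥ 0` and `|θ| = 1`. -/
instance (D : Set X) : TopologicalSpace (DivisorBlowUp N D) :=
  TopologicalSpace.induced DivisorBlowUp.base inferInstance ⊓
    TopologicalSpace.generateFrom
      {s | ∃ (U : Set X) (f : X → ℂ) (hf : IsLocalEquation N D U f) (V : Set ℂ),
        IsOpen V ∧ s = {p | ∃ hp : p.base ∈ U, p.phase hf hp ∈ V}}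

lemma DivisorBlowUp.continuous_base (D : Set X) :
    Continuous (DivisorBlowUp.base : DivisorBlowUp N D → X) :=
  continuous_iff_le_induced.2 inf_le_left

variable {I : Type v}

/-- The closed stratum `⋂_{j ∈ J} D j` (it is `X` when `J` is empty). -/
def closedStratum (D : I → Set X) (J : Set I) : Set X := {x | ∀ j ∈ J, x ∈ D j}

/-- The real oriented blow-up of the closed stratum of `J` along the simple normal crossings divisor
cut out on it by the `D i`, `i ∉ J`: the fibre product over `X` of the closed stratum and of the
real oriented blow-ups of the `D i`, `i ∉ J`. (By transversality, the normal bundle in the closed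
stratum of its intersection with `D i` is the restriction of the normal bundle of `D i`.) So a point
of it is a point `x` of the closed stratum with a normal ray at `x` of each `D i`, `i ∉ J`, that
contains `x`. -/
def StratumBlowUp (N : ℕ) {X : Type u} [TopologicalSpace X] [ChartedSpace (Fin N → ℂ) X]
    {I : Type v} (D : I → Set X) (J : Set I) : Type (max u v) :=
  {p : X × ((i : {i : I // i ∉ J}) → DivisorBlowUp N (D i)) //
    p.1 ∈ closedStratum D J ∧ ∀ i, (p.2 i).base = p.1}

instance (D : I → Set X) (J : Set I) : TopologicalSpace (StratumBlowUp N D J) :=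
  inferInstanceAs (TopologicalSpace {p : X × ((i : {i : I // i ∉ J}) → DivisorBlowUp N (D i)) //
    p.1 ∈ closedStratum D J ∧ ∀ i, (p.2 i).base = p.1})

/-- The blow-down map to `X` (its image is the closed stratum). -/
def StratumBlowUp.base {D : I → Set X} {J : Set I} (p : StratumBlowUp N D J) : X := p.1.1

lemma StratumBlowUp.continuous_base {D : I → Set X} {J : Set I} :
    Continuous (StratumBlowUp.base : StratumBlowUp N D J → X) :=
  continuous_fst.comp continuous_subtype_val

/-- The piece attached to a chain of subsets of `I` with smallest term `A` and largest term `B`: the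
fibre product, over the closed stratum of `A`, of its real oriented blow-up and of the closed
stratum of `B`. -/
def Piece (N : ℕ) {X : Type u} [TopologicalSpace X] [ChartedSpace (Fin N → ℂ) X]
    {I : Type v} (D : I → Set X) (A B : Set I) : Type (max u v) :=
  {p : StratumBlowUp N D A // p.base ∈ closedStratum D B}

instance (D : I → Set X) (A B : Set I) : TopologicalSpace (Piece N D A B) :=
  inferInstanceAs (TopologicalSpace {p : StratumBlowUp N D A // p.base ∈ closedStratum D B})

/-- The projection of a piece to the blow-up of the closed stratum of `A'`, where `A ⊆ A' ⊆ B`: it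
forgets the normal rays of the `D i` with `i ∈ A' ∖ A`. -/
def Piece.toBlowUp {D : I → Set X} {A A' B : Set I} (hA : A ⊆ A') (hB : A' ⊆ B)
    (p : Piece N D A B) : StratumBlowUp N D A' :=
  ⟨(p.1.1.1, fun i => p.1.1.2 ⟨i, fun h => i.2 (hA h)⟩),
    fun j hj => p.2 j (hB hj), fun i => p.1.2.2 ⟨i, fun h => i.2 (hA h)⟩⟩

lemma Piece.continuous_toBlowUp {D : I → Set X} {A A' B : Set I} (hA : A ⊆ A') (hB : A' ⊆ B) :
    Continuous (Piece.toBlowUp (N := N) (D := D) hA hB) := by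
  have h0 : Continuous fun p : Piece N D A B => p.1.1 :=
    continuous_subtype_val.comp continuous_subtype_val
  refine Continuous.subtype_mk ?_ _
  exact (continuous_fst.comp h0).prodMk
    (continuous_pi fun i => (continuous_apply _).comp (continuous_snd.comp h0))

/-- The map of pieces induced by inclusions `A ⊆ A' ⊆ B' ⊆ B`: it forgets the normal rays of the
`D i` with `i ∈ A' ∖ A`, and includes the closed stratum of `B` into that of `B'`. -/
def Piece.map {D : I → Set X} {A A' B' B : Set I} (hA : A ⊆ A') (hAB : A' ⊆ B') (hB : B' ⊆ B)
    (p : Piece N D A B) : Piece N D A' B' :=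
  ⟨p.toBlowUp hA (hAB.trans hB), fun j hj => p.2 j (hB hj)⟩

lemma Piece.continuous_map {D : I → Set X} {A A' B' B : Set I} (hA : A ⊆ A') (hAB : A' ⊆ B')
    (hB : B' ⊆ B) : Continuous (Piece.map (N := N) (D := D) hA hAB hB) :=
  Continuous.subtype_mk (Piece.continuous_toBlowUp hA (hAB.trans hB)) _

end BlowUps

/-! ### The semi-simplicial space -/

/-- Chains `J₀ ⊊ J₁ ⊊ … ⊊ J_k` of subsets of `I`. -/
abbrev Chain (I : Type v) (k : ℕ) : Type v := {c : Fin (k + 1) → Set I // StrictMono c}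

/-- The space of `k`-simplices: the disjoint union of the pieces of the chains of length `k`. -/
abbrev Simplices (N : ℕ) {X : Type u} [TopologicalSpace X] [ChartedSpace (Fin N → ℂ) X]
    {I : Type v} (D : I → Set X) (k : ℕ) : Type (max u v) :=
  Σ c : Chain I k, Piece N D (c.1 0) (c.1 (Fin.last k))

section SemiSimplicial

variable {N : ℕ} {X : Type u} [TopologicalSpace X] [ChartedSpace (Fin N → ℂ) X] {I : Type v}

/-- The operator of the semi-simplicial space given by an increasing map `φ`: it restricts the
chain along `φ`, with the map of pieces induced by `J₀ ⊆ J_{φ 0}` and `J_{φ m} ⊆ J_n`. For the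
`l`-th face map, `φ` omits `l`: for `0 < l < n` the map of pieces is the identity, for `l = n` it is
the inclusion of the closed stratum of `J_n` in that of `J_{n-1}`, and for `l = 0` it forgets the
normal rays indexed by `J₁ ∖ J₀`. -/
def Simplices.map (D : I → Set X) {m n : ℕ} (φ : Fin (m + 1) ↪o Fin (n + 1))
    (s : Simplices N D n) : Simplices N D m :=
  ⟨⟨s.1.1 ∘ φ, s.1.2.comp φ.strictMono⟩,
    Piece.map (s.1.2.monotone (Fin.zero_le _))
      (s.1.2.monotone (φ.monotone (Fin.zero_le _))) (s.1.2.monotone (Fin.le_last _)) s.2⟩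

lemma Simplices.continuous_map (D : I → Set X) {m n : ℕ} (φ : Fin (m + 1) ↪o Fin (n + 1)) :
    Continuous (Simplices.map (N := N) D φ) := by
  refine continuous_sigma fun c => ?_
  have h := Piece.continuous_map (N := N) (D := D) (c.2.monotone (Fin.zero_le (φ 0)))
    (c.2.monotone (φ.monotone (Fin.zero_le (Fin.last m)))) (c.2.monotone (Fin.le_last (φ (Fin.last m))))
  exact (continuous_sigmaMk (σ := fun c : Chain I m => Piece N D (c.1 0) (c.1 (Fin.last m)))
    (i := ⟨c.1 ∘ φ, c.2.comp φ.strictMono⟩)).comp h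

/-- The operator `Simplices.map`, as a morphism of topological spaces. -/
def Simplices.mapHom (N : ℕ) {X : Type u} [TopologicalSpace X] [ChartedSpace (Fin N → ℂ) X]
    {I : Type v} (D : I → Set X) {m n : ℕ} (φ : Fin (m + 1) ↪o Fin (n + 1)) :
    TopCat.of (Simplices N D n) ⟶ TopCat.of (Simplices N D m) :=
  TopCat.ofHom ⟨Simplices.map D φ, Simplices.continuous_map D φ⟩

lemma Simplices.mapHom_trans (D : I → Set X) {l m n : ℕ} (φ : Fin (m + 1) ↪o Fin (n + 1))
    (ψ : Fin (l + 1) ↪o Fin (m + 1)) :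
    Simplices.mapHom N D (ψ.trans φ) = Simplices.mapHom N D φ ≫ Simplices.mapHom N D ψ := rfl

/-- The semi-simplicial space of the simple normal crossings divisor `⋃ i, D i` in `X`. -/
def semiSimplicialSpace (N : ℕ) {X : Type u} [TopologicalSpace X] [ChartedSpace (Fin N → ℂ) X]
    {I : Type v} (D : I → Set X) : SemiSimplexCategoryᵒᵖ ⥤ TopCat.{max u v} where
  obj n := TopCat.of (Simplices N D n.unop.len)
  map f := Simplices.mapHom N D (SemiSimplexCategory.homEquiv f.unop)
  map_id _ := rfl
  map_comp f g := by
    rw [unop_comp, SemiSimplexCategory.homEquiv_comp]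
    exact Simplices.mapHom_trans D _ _

end SemiSimplicial

/-! ### Augmentations, geometric realization, homotopy colimit -/

/-- A cocone with vertex the space `Y` under a diagram `F` of topological spaces. -/
structure Augmentation {C : Type*} [Category C] (F : C ⥤ TopCat.{v}) (Y : Type w)
    [TopologicalSpace Y] where
  app : ∀ c : C, C(F.obj c, Y)
  naturality : ∀ {c d : C} (f : c ⟶ d) (x : F.obj c), app d (F.map f x) = app c x

/-- The maps of the pieces to `X`, given by blowing down. -/
def semiSimplicialSpaceAugmentation {N : ℕ} {X : Type u} [TopologicalSpace X]
    [ChartedSpace (Fin N → ℂ) X] {I : Type v} (D : I → Set X) :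
    Augmentation (semiSimplicialSpace N D) X where
  app n := ⟨fun s : Simplices N D n.unop.len => s.2.1.base,
    continuous_sigma fun _ => StratumBlowUp.continuous_base.comp continuous_subtype_val⟩
  naturality _ _ := rfl

/-- The `l`-th coface map in the semi-simplex category. -/
def coface (n : ℕ) (l : Fin (n + 2)) : SemiSimplexCategory.mk n ⟶ SemiSimplexCategory.mk (n + 1) :=
  SemiSimplexCategory.homEquiv.symm (Fin.succAboveOrderEmb l)

section Realization

variable (F : SemiSimplexCategoryᵒᵖ ⥤ TopCat.{v})

/-- The relation that identifies `(x, (t₀, …, t_{l-1}, 0, t_l, …, t_n))`, for `x` an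
`(n+1)`-simplex, with `(f_l x, (t₀, …, t_n))`, where `f_l` is the `l`-th face map. -/
inductive RealizationRel :
    (Σ n : ℕ, F.obj (.op (.mk n)) × stdSimplex ℝ (Fin (n + 1))) →
    (Σ n : ℕ, F.obj (.op (.mk n)) × stdSimplex ℝ (Fin (n + 1))) → Prop
  | face (n : ℕ) (l : Fin (n + 2)) (x : F.obj (.op (.mk (n + 1)))) (t : stdSimplex ℝ (Fin (n + 1))) :
      RealizationRel ⟨n + 1, x, stdSimplex.map l.succAbove t⟩ ⟨n, F.map (coface n l).op x, t⟩

/-- The geometric realization of a semi-simplicial space, with the quotient topology. -/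
def Realization : Type v := Quot (RealizationRel F)

instance : TopologicalSpace (Realization F) :=
  inferInstanceAs (TopologicalSpace (Quot (RealizationRel F)))

variable {F} {Y : Type w} [TopologicalSpace Y]

/-- The map from the geometric realization to `Y` induced by an augmentation to `Y`. -/
def Realization.desc (a : Augmentation F Y) : C(Realization F, Y) where
  toFun := Quot.lift (fun p => a.app _ p.2.1) (by
    rintro _ _ ⟨n, l, x, t⟩
    exact (a.naturality (coface n l).op x).symm)
  continuous_toFun := continuous_coinduced_dom.2 <| continuous_sigma fun n =>
    (a.app (.op (.mk n))).continuous.comp continuous_fst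

end Realization

section HomotopyColimit

variable {C : Type} [Category.{0} C] (F : C ⥤ TopCat.{v})

/-- The simplicial identities in the realization of the simplicial replacement of `F`, whose space
of `n`-simplices is the disjoint union, over the strings `σ` of arrows `c₀ → ⋯ → c_n` of `C`, of the
spaces `F c₀`: for a nondecreasing map `θ` from `{0, …, m}` to `{0, …, n}`, the point
`(σ, x, θ_* t)` is identified with `(θ^* σ, F (c₀ → c_{θ 0}) x, t)`. -/
inductive HocolimRel :
    (Σ (n : ℕ) (σ : ComposableArrows C n), F.obj (σ.obj 0) × stdSimplex ℝ (Fin (n + 1))) →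
    (Σ (n : ℕ) (σ : ComposableArrows C n), F.obj (σ.obj 0) × stdSimplex ℝ (Fin (n + 1))) → Prop
  | op {m n : ℕ} (θ : Fin (m + 1) →o Fin (n + 1)) (σ : ComposableArrows C n) (x : F.obj (σ.obj 0))
      (t : stdSimplex ℝ (Fin (m + 1))) :
      HocolimRel ⟨n, σ, x, stdSimplex.map θ t⟩
        ⟨m, σ.whiskerLeft θ.monotone.functor,
          F.map (σ.map (homOfLE (Fin.zero_le (θ 0)))) x, t⟩

/-- The (Bousfield-Kan) homotopy colimit of a diagram of topological spaces. -/
def Hocolim : Type v := Quot (HocolimRel F)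

instance : TopologicalSpace (Hocolim F) :=
  inferInstanceAs (TopologicalSpace (Quot (HocolimRel F)))

variable {F} {Y : Type w} [TopologicalSpace Y]

/-- The map from the homotopy colimit to `Y` induced by an augmentation to `Y`. -/
def Hocolim.desc (a : Augmentation F Y) : C(Hocolim F, Y) where
  toFun := Quot.lift (fun p => a.app _ p.2.2.1) (by
    rintro _ _ ⟨θ, σ, x, t⟩
    exact (a.naturality (σ.map (homOfLE (Fin.zero_le (θ 0)))) x).symm)
  continuous_toFun := continuous_coinduced_dom.2 <| continuous_sigma fun n =>
    continuous_sigma fun σ => (a.app (σ.obj 0)).continuous.comp continuous_fst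

end HomotopyColimit

/-- A continuous map is a homotopy equivalence. -/
def IsHomotopyEquivalence {Y : Type v} {Z : Type w} [TopologicalSpace Y] [TopologicalSpace Z]
    (f : C(Y, Z)) : Prop :=
  ∃ e : Y ≃ₕ Z, e.toFun = f

/-- A map `π : E → B` is a locally trivial bundle with fibre the torus `(S¹)^S`. -/
def IsTorusBundle (S : Type u) {E : Type v} {B : Type w} [TopologicalSpace E] [TopologicalSpace B]
    (π : E → B) : Prop :=
  ∀ b : B, ∃ e : Bundle.Trivialization (S → Circle) π, b ∈ e.baseSet

end SNC

end

noncomputable section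

set_option linter.unusedSectionVars false

namespace SNC

/-! ### Homotopy equivalences -/

section HomotopyEquivalences

/-! Let B_i → X be the real oriented blow-up along D_i, and let C_i be B_i with the mapping cylinder
of its restriction to D_i attached over D_i. The geometric realization and the homotopy colimit are
both homeomorphic, over X, to the fibre product C of all the C_i, and C → X is a homotopy
equivalence.

A point of C over x consists, for each i, of a point of B_i over x and a height s_i in [0, 1],
positive only if x ∈ D_i; the point of B_i is forgotten when s_i = 1. A point of the piece of J_0 ⊊
… ⊊ J_k with barycentric coordinates t is sent to the heights s_i = ∑ t_l over the l with i ∈ J_l.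
The i ∈ J_0 get height 1, and they are exactly those whose rays the piece does not record. A
function with finitely many values is in a unique way a positive combination of indicator functions
of a chain of superlevel sets (`exists_chain`, `chain_unique`), so the open simplices fill C
bijectively (`Simplices.eq_of_vec_eq`, `Simplices.exists_vec_eq`). The bijection is a homeomorphism
because chains have bounded length and the pieces are proper over X. In order to have C as a
Hausdorff space, the fibres of all B_i are embedded in one vector space V with distinct points on
distinct rays (`IsSNC.exists_isRayFamily`), and C becomes the set of vectors (1 - s_i) w_i in X × (I
→ V).

A string of arrows that starts at {0, …, m} is a flag of faces of the m-simplex, so the homotopy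
colimit is the barycentric subdivision of the realization. Combinations of barycenters of a flag are
again positive combinations of indicator functions of a chain, and the same two lemmas identify the
homotopy colimit with C.

To compare C with X, the cylinders are collapsed one index k at a time. For the fibre product C_S of
the C_i with i ∈ S, let Z be its fibre product with B_k and A the part of Z over D_k. Then C_S is Z
with A collapsed to its image, while the next stage is Z with the mapping cylinder of that collapse
attached. The two agree up to homotopy as soon as A ⊆ Z has the homotopy extension property
(`isHomotopyEquivalence_of_retraction`). Near a point of D_k a retraction comes from shrinking the
absolute value of the coordinate which defines D_k while all phases are kept, which lifts to every
B_i (`IsSNC.exists_isLocalShrinking`); local retractions are glued by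
`exists_retraction_of_locally`.

All this rests on one fact about the topology of the blow-ups: a coordinate that defines D_i divides
every other local equation, with continuous nowhere vanishing quotient (`isGenerator_coordinate`),
so its phase alone controls convergence (`IsGenerator.tendsto_nhds`). The same phases trivialize the
torus bundles. -/

theorem IsHomotopyEquivalence.comp {X Y Z : Type*} [TopologicalSpace X] [TopologicalSpace Y]
    [TopologicalSpace Z] {g : C(Y, Z)} {f : C(X, Y)} (hg : IsHomotopyEquivalence g)
    (hf : IsHomotopyEquivalence f) : IsHomotopyEquivalence (g.comp f) := by
  obtain ⟨a, rfl⟩ := hf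
  obtain ⟨b, rfl⟩ := hg
  exact ⟨a.trans b, rfl⟩

theorem IsHomotopyEquivalence.of_isHomeomorph {X Y : Type*} [TopologicalSpace X]
    [TopologicalSpace Y] (f : C(X, Y)) (hf : IsHomeomorph f) : IsHomotopyEquivalence f :=
  ⟨(hf.homeomorph f).toHomotopyEquiv, rfl⟩

end HomotopyEquivalences

/-! ### The homotopy extension property is local -/

section HomotopyExtension

variable {Y : Type*}

/-- Successive modifications of the constant homotopy by homotopies `S n` damped by the functions
`lam n`; the second component is the time that remains when `S n` has reached its target. -/
def iteratedRetraction (lam : ℕ → Y → ℝ) (S : ℕ → Y × ℝ → Y) (ρ : ℕ → Y → ℝ) :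
    ℕ → Y → ℝ → Y × ℝ
  | 0, y, _ => (y, 0)
  | n + 1, y, t =>
    ((iteratedRetraction lam S ρ n (S n (y, lam n y * t)) t).1,
      (iteratedRetraction lam S ρ n (S n (y, lam n y * t)) t).2 + max (lam n y * t - ρ n y) 0)

/-- The time t is split into shares `lam n y * t`. Each share is spent on `S n`, and the part left
after the time `ρ n` accumulates in the second coordinate. The weights are evaluated at the moving
point, so they need not add up to 1 along an orbit; this matters only on A, where nothing moves and
all of t is kept. Positive accumulated time means that some `S n` has reached A, and the remaining
steps fix A. -/
theorem exists_retraction_of_locally [TopologicalSpace Y] (A : Set Y) (lam : ℕ → Y → ℝ)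
    (U : ℕ → Set Y) (S : ℕ → Y × ℝ → Y) (ρ : ℕ → Y → ℝ)
    (hc : ∀ n, Continuous (lam n)) (h0 : ∀ n y, 0 ≤ lam n y)
    (hl1 : ∀ n y, lam n y ≤ 1) (h1 : ∀ y, ∑ᶠ n, lam n y = 1)
    (hlf : LocallyFinite fun n => Function.support (lam n)) (hU : ∀ n, IsOpen (U n))
    (hsub : ∀ n, tsupport (lam n) ⊆ U n)
    (hS : ∀ n, ContinuousOn (S n) (U n ×ˢ Set.univ)) (hρ : ∀ n, ContinuousOn (ρ n) (U n))
    (hρ0 : ∀ n y, 0 ≤ ρ n y) (hS0 : ∀ n y, S n (y, 0) = y)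
    (hSA : ∀ n, ∀ y ∈ A, y ∈ U n → ∀ t, S n (y, t) = y)
    (hρA : ∀ n, ∀ y ∈ A, y ∈ U n → ρ n y = 0)
    (hhit : ∀ n, ∀ y ∈ U n, ∀ t ≤ 1, ρ n y < t → S n (y, t) ∈ A) :
    ∃ r : Y × ℝ → Y × ℝ, Continuous r ∧ (∀ y, r (y, 0) = (y, 0)) ∧
      (∀ a ∈ A, ∀ t, 0 ≤ t → r (a, t) = (a, t)) ∧ (∀ p, 0 ≤ (r p).2) ∧
      ∀ p, p.2 ≤ 1 → 0 < (r p).2 → (r p).1 ∈ A := by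
  classical
  set F := iteratedRetraction lam S ρ with hF
  have hmem : ∀ n y, lam n y ≠ 0 → y ∈ U n := fun n y h => hsub n (subset_tsupport _ h)
  have hz : ∀ n y, lam n y = 0 → F (n + 1) y = F n y := by
    intro n y h
    funext t
    simp only [hF, iteratedRetraction, h, zero_mul, hS0, zero_sub]
    rw [max_eq_right (by linarith [hρ0 n y]), add_zero]
  have hT0 : ∀ n y, F n y 0 = (y, 0) := by
    intro n
    induction n with
    | zero => intro y; rfl
    | succ n ih =>
      intro y
      have := ih y
      simp only [hF] at this
      simp only [hF, iteratedRetraction, mul_zero, hS0, zero_sub, this, zero_add]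
      rw [max_eq_right (by linarith [hρ0 n y])]
  have hA : ∀ n, ∀ a ∈ A, ∀ t, 0 ≤ t → F n a t = (a, (∑ m ∈ Finset.range n, lam m a) * t) := by
    intro n
    induction n with
    | zero => intro a _ t _; simp [hF, iteratedRetraction]
    | succ n ih =>
      intro a ha t ht
      by_cases h : lam n a = 0
      · rw [hz n a h, ih a ha t ht, Finset.sum_range_succ, h, add_zero]
      · have hm := hmem n a h
        have := ih a ha t ht
        simp only [hF] at this
        simp only [hF, iteratedRetraction, hSA n a ha hm, hρA n a ha hm, sub_zero, this,
          Finset.sum_range_succ]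
        rw [max_eq_left (mul_nonneg (h0 n a) ht), add_mul]
  have hnn : ∀ n y t, 0 ≤ (F n y t).2 := by
    intro n
    induction n with
    | zero => intro y t; exact le_rfl
    | succ n ih => intro y t; exact add_nonneg (ih _ _) (le_max_right _ _)
  have hpos : ∀ n y t, t ≤ 1 → 0 < (F n y t).2 → (F n y t).1 ∈ A := by
    intro n
    induction n with
    | zero => intro y t _ h; exact absurd h (lt_irrefl _)
    | succ n ih =>
      intro y t ht1 h
      by_cases hl : lam n y = 0
      · rw [hz n y hl] at h ⊢; exact ih y t ht1 h
      by_cases h' : 0 < (F n (S n (y, lam n y * t)) t).2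
      · exact ih _ _ ht1 h'
      -- The accumulated time must come from this very step, so `S n` has reached A.
      have h2 : 0 < max (lam n y * t - ρ n y) 0 := by
        have := hnn n (S n (y, lam n y * t)) t
        have e : (F (n + 1) y t).2 = (F n (S n (y, lam n y * t)) t).2 +
          max (lam n y * t - ρ n y) 0 := rfl
        rw [e] at h
        linarith
      have h3 : ρ n y < lam n y * t := by
        rcases lt_max_iff.1 h2 with h | h
        · linarith
        · exact absurd h (lt_irrefl _)
      have ht : 0 ≤ t := by
        by_contra hneg
        have := mul_nonpos_of_nonneg_of_nonpos (h0 n y) (not_le.1 hneg).le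
        linarith [hρ0 n y]
      have h4 := hhit n y (hmem n y hl) _ (by nlinarith [hl1 n y, h0 n y]) h3
      change (F n (S n (y, lam n y * t)) t).1 ∈ A
      rw [hA n _ h4 t ht]
      exact h4
  have hcont : ∀ n, Continuous fun p : Y × ℝ => F n p.1 p.2 := by
    intro n
    induction n with
    | zero => exact continuous_fst.prodMk continuous_const
    | succ n ih =>
      -- `S n` and `ρ n` are continuous only over `U n`. Off the closed support of `lam n` the time
      -- spent is 0, and the maps are the projection and 0.
      have k1 : Continuous fun p : Y × ℝ => S n (p.1, lam n p.1 * p.2) := by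
        rw [continuous_iff_continuousAt]
        intro p
        by_cases h : p.1 ∈ tsupport (lam n)
        · refine ContinuousAt.comp (f := fun p : Y × ℝ => (p.1, lam n p.1 * p.2)) (g := S n)
            ((hS n).continuousAt ?_) ?_
          · exact ((hU n).prod isOpen_univ).mem_nhds ⟨hsub n h, trivial⟩
          · have := hc n; fun_prop
        · refine continuousAt_fst.congr ?_
          have : {p : Y × ℝ | p.1 ∉ tsupport (lam n)} ∈ 𝓝 p :=
            ((isClosed_tsupport _).isOpen_compl.preimage continuous_fst).mem_nhds h
          filter_upwards [this] with q hq
          rw [image_eq_zero_of_notMem_tsupport hq, zero_mul, hS0]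
      have k2 : Continuous fun p : Y × ℝ => max (lam n p.1 * p.2 - ρ n p.1) 0 := by
        rw [continuous_iff_continuousAt]
        intro p
        by_cases h : p.1 ∈ tsupport (lam n)
        · have h5 : ContinuousAt (fun p : Y × ℝ => ρ n p.1) p :=
            ContinuousAt.comp (f := Prod.fst) (g := ρ n)
              ((hρ n).continuousAt ((hU n).mem_nhds (hsub n h))) continuousAt_fst
          have := hc n
          exact ContinuousAt.sup (ContinuousAt.sub (by fun_prop) h5) continuousAt_const
        · refine (continuousAt_const (y := (0 : ℝ))).congr ?_
          have : {p : Y × ℝ | p.1 ∉ tsupport (lam n)} ∈ 𝓝 p :=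
            ((isClosed_tsupport _).isOpen_compl.preimage continuous_fst).mem_nhds h
          filter_upwards [this] with q hq
          rw [image_eq_zero_of_notMem_tsupport hq, zero_mul,
            max_eq_right (by linarith [hρ0 n q.1])]
      have k3 := ih.comp (k1.prodMk continuous_snd)
      exact (continuous_fst.comp k3).prodMk ((continuous_snd.comp k3).add k2)
  -- Consecutive stages differ only on the support of `lam n`, so near each point the sequence is
  -- eventually constant; `G` is its limit.
  have hlf' : LocallyFinite fun n => {y | F (n + 1) y ≠ F n y} :=
    hlf.subset fun n y hy h => hy (hz n y h)
  obtain ⟨G, hG⟩ := hlf'.exists_forall_eventually_eq_prod (π := fun _ => ℝ → Y × ℝ)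
  have hGe : ∀ y, ∃ n, ∀ m ≥ n, ∀ᶠ y' in 𝓝 y, G y' = F m y' := by
    intro y
    obtain ⟨P, hP, Q, hQ, h⟩ := Filter.eventually_prod_iff.1 (hG y)
    obtain ⟨n, hn⟩ := Filter.eventually_atTop.1 hP
    refine ⟨n, fun m hm => ?_⟩
    filter_upwards [hQ] with y' hy'
    exact (h (hn m hm) hy').symm
  have hGp : ∀ y, ∃ n, ∀ m ≥ n, G y = F m y := fun y =>
    (hGe y).imp fun n h m hm => (h m hm).self_of_nhds
  refine ⟨fun p => G p.1 p.2, ?_, ?_, ?_, ?_, ?_⟩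
  · rw [continuous_iff_continuousAt]
    intro p
    obtain ⟨n, hn⟩ := hGe p.1
    refine (hcont n).continuousAt.congr ?_
    filter_upwards [continuousAt_fst.eventually (hn n le_rfl)] with q hq
    rw [hq]
  · intro y
    obtain ⟨n, hn⟩ := hGp y
    change G y 0 = _
    rw [hn n le_rfl, hT0]
  · intro a ha t ht
    obtain ⟨n, hn⟩ := hGp a
    have hfin : (Function.support fun m => lam m a).Finite := hlf.point_finite a
    obtain ⟨k, hk⟩ := hfin.bddAbove
    change G a t = _
    -- The stage must lie beyond the stabilization at `a` and beyond the last index with nonzero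
    -- weight at `a`, so that the weights used add up to 1.
    rw [hn (max n (k + 1)) (le_max_left _ _), hA _ a ha t ht]
    have : ∑ m ∈ Finset.range (max n (k + 1)), lam m a = 1 := by
      rw [← h1 a, finsum_eq_sum_of_support_subset]
      intro m hm
      have := hk hm
      simp only [Finset.coe_range, Set.mem_Iio]
      omega
    rw [this, one_mul]
  · intro p
    obtain ⟨n, hn⟩ := hGp p.1
    simp only [hn n le_rfl]
    exact hnn _ _ _
  · intro p
    obtain ⟨n, hn⟩ := hGp p.1
    simp only [hn n le_rfl]
    exact hpos _ _ _

end HomotopyExtension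

/-! ### Collapsing the mapping cylinder of a closed part of a proper map -/

section Cone

variable {Y Z E : Type*} [TopologicalSpace Y] [TopologicalSpace Z] [TopologicalSpace E]

/-- The union of the bottom of the cylinder on `Z` and of the cylinder on its subset `A`. -/
abbrev PartialCylinder (A : Set Z) : Type _ := {c : Z × unitInterval // 0 < c.2 → c.1 ∈ A}

/-- Y is the pushout of Z ← A → p(A), and E the corresponding double mapping cylinder with the
cylinder on Z removed. The map `r` expresses the homotopy extension property of A in Z, under which
pushout and homotopy pushout agree. The inverse sends `p z` to the image in E of the end of the path
of z under the retraction; over A this end is at height 1, where it depends on `p z` only. -/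
theorem isHomotopyEquivalence_of_retraction (A : Set Z) (p : C(Z, Y)) (q : C(E, Y))
    (κ : C(PartialCylinder A, E)) (hp : IsProperMap p) (hps : Function.Surjective p)
    (hκ : IsProperMap κ) (hκs : Function.Surjective κ) (hq : ∀ c, q (κ c) = p c.1.1)
    (hpp : ∀ z z', p z = p z' → z = z' ∨ z ∈ A ∧ z' ∈ A)
    (hend : ∀ c c' : PartialCylinder A, c.1.2 = 1 → c'.1.2 = 1 → p c.1.1 = p c'.1.1 → κ c = κ c')
    (hinj : ∀ c c' : PartialCylinder A, κ c = κ c' → c = c' ∨ c.1.2 = 1 ∧ c'.1.2 = 1)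
    (r : Z × ℝ → Z × ℝ) (hr : Continuous r) (hr0 : ∀ z, r (z, 0) = (z, 0))
    (hrA : ∀ a ∈ A, ∀ t, 0 ≤ t → r (a, t) = (a, t))  (hrp : ∀ c, c.2 ≤ 1 → 0 < (r c).2 → (r c).1 ∈ A) : IsHomotopyEquivalence q := by
  have hR : ∀ c : Z × unitInterval, 0 < Set.projIcc (0 : ℝ) 1 zero_le_one (r (c.1, c.2)).2 →
      (r (c.1, c.2)).1 ∈ A := by
    intro c hc
    apply hrp _ c.2.2.2
    by_contra h
    rw [Set.projIcc_of_le_left _ (not_lt.1 h)] at hc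
    exact lt_irrefl _ hc
  let R : C(Z × unitInterval, PartialCylinder A) :=
    ⟨fun c => ⟨((r (c.1, c.2)).1, Set.projIcc 0 1 zero_le_one (r (c.1, c.2)).2), hR c⟩, by
      refine Continuous.subtype_mk ?_ _
      have h : Continuous fun c : Z × unitInterval => r (c.1, c.2) := hr.comp (by fun_prop)
      exact (continuous_fst.comp h).prodMk (continuous_projIcc.comp (continuous_snd.comp h))⟩
  have hR0 : ∀ z, R (z, 0) = ⟨(z, 0), fun h => absurd h (lt_irrefl _)⟩ := by
    intro z
    apply Subtype.ext
    change ((r (z, ((0 : unitInterval) : ℝ))).1, Set.projIcc (0 : ℝ) 1 zero_le_one _) = _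
    rw [Set.Icc.coe_zero, hr0]
    simp
  have hRA : ∀ a (ha : a ∈ A) t, R (a, t) = ⟨(a, t), fun _ => ha⟩ := by
    intro a ha t
    apply Subtype.ext
    change ((r (a, (t : ℝ))).1, Set.projIcc (0 : ℝ) 1 zero_le_one _) = _
    rw [hrA a ha t t.2.1]
    simp
  have hRc : ∀ c : PartialCylinder A, R c.1 = c := by
    rintro ⟨⟨z, s⟩, h⟩
    rcases eq_or_lt_of_le s.2.1 with hs | hs
    · obtain rfl : s = 0 := Subtype.ext hs.symm
      exact hR0 z
    · exact hRA z (h hs) s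
  have hqp : IsQuotientMap (p : Z → Y) := hp.isClosedMap.isQuotientMap p.continuous hps
  -- A proper map remains closed after taking the product with the interval, so homotopies of Y and
  -- E may be defined upstairs.
  have hqp' : IsQuotientMap (Prod.map p id : Z × unitInterval → Y × unitInterval) :=
    (hp.prodMap isProperMap_id).isClosedMap.isQuotientMap (hp.prodMap isProperMap_id).continuous
      (hps.prodMap Function.surjective_id)
  have hqκ' : IsQuotientMap
      (Prod.map κ id : PartialCylinder A × unitInterval → E × unitInterval) :=
    (hκ.prodMap isProperMap_id).isClosedMap.isQuotientMap (hκ.prodMap isProperMap_id).continuous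
      (hκs.prodMap Function.surjective_id)
  have hg : ∀ z z', p z = p z' → κ (R (z, 1)) = κ (R (z', 1)) := by
    intro z z' h
    rcases hpp z z' h with rfl | ⟨hz, hz'⟩
    · rfl
    · rw [hRA z hz, hRA z' hz']
      exact hend _ _ rfl rfl h
  let g : C(Y, E) := hqp.lift (κ.comp (R.comp ⟨fun z => (z, 1), by fun_prop⟩)) hg
  have hgp : ∀ z, g (p z) = κ (R (z, 1)) := fun z =>
    DFunLike.congr_fun (hqp.lift_comp (κ.comp (R.comp ⟨fun z => (z, 1), by fun_prop⟩)) hg) z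
  have hH : ∀ c c' : Z × unitInterval, Prod.map p id c = Prod.map p id c' →
      q (κ (R c)) = q (κ (R c')) := by
    rintro ⟨z, t⟩ ⟨z', t'⟩ h
    obtain ⟨h1, rfl⟩ := Prod.ext_iff.1 h
    rcases hpp z z' h1 with rfl | ⟨hz, hz'⟩
    · rfl
    · change q (κ (R (z, t))) = q (κ (R (z', t)))
      rw [hRA z hz, hRA z' hz', hq, hq]
      exact h1
  let H : C(Y × unitInterval, Y) := hqp'.lift (f := ⟨_, hqp'.continuous⟩) (q.comp (κ.comp R)) hH
  have hHp : ∀ z t, H (p z, t) = q (κ (R (z, t))) := fun z t =>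
    DFunLike.congr_fun (hqp'.lift_comp (f := ⟨_, hqp'.continuous⟩) (q.comp (κ.comp R)) hH) (z, t)
  -- The height s is raised to `max s t` before retracting: t = 0 gives the identity, because `R`
  -- fixes the partial cylinder, and t = 1 gives the composite of `q` and `g`. Height 1 stays at
  -- height 1, which makes this compatible with the identifications in E.
  let M : C(PartialCylinder A × unitInterval, E) :=
    κ.comp (R.comp ⟨fun c => (c.1.1.1, max c.1.1.2 c.2), by fun_prop⟩)
  have hM : ∀ c c' : PartialCylinder A × unitInterval, Prod.map κ id c = Prod.map κ id c' →
      M c = M c' := by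
    rintro ⟨c, t⟩ ⟨c', t'⟩ h
    obtain ⟨h1, rfl⟩ := Prod.ext_iff.1 h
    rcases hinj c c' h1 with rfl | ⟨hc, hc'⟩
    · rfl
    · change κ (R (c.1.1, max c.1.2 t)) = κ (R (c'.1.1, max c'.1.2 t))
      have e : max c.1.2 t = 1 := by rw [hc]; exact max_eq_left t.2.2
      have e' : max c'.1.2 t = 1 := by rw [hc']; exact max_eq_left t.2.2
      rw [e, e']
      apply hg
      rw [← hq, ← hq, show κ c = κ c' from h1]
  let K : C(E × unitInterval, E) := hqκ'.lift (f := ⟨_, hqκ'.continuous⟩) M hM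
  have hK : ∀ c t, K (κ c, t) = κ (R (c.1.1, max c.1.2 t)) := fun c t =>
    DFunLike.congr_fun (hqκ'.lift_comp (f := ⟨_, hqκ'.continuous⟩) M hM) (c, t)
  refine ⟨⟨q, g, ?_, ?_⟩, rfl⟩
  · refine ContinuousMap.Homotopic.symm ⟨⟨⟨fun c => K (c.2, c.1), by fun_prop⟩, ?_, ?_⟩⟩
    · intro e
      obtain ⟨c, rfl⟩ := hκs e
      change K (κ c, 0) = κ c
      rw [hK, show max c.1.2 0 = c.1.2 from max_eq_left c.1.2.2.1, Prod.mk.eta, hRc]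
    · intro e
      obtain ⟨c, rfl⟩ := hκs e
      change K (κ c, 1) = g (q (κ c))
      rw [hK, hq, hgp, show max c.1.2 1 = 1 from max_eq_right c.1.2.2.2]
  · refine ContinuousMap.Homotopic.symm ⟨⟨⟨fun c => H (c.2, c.1), by fun_prop⟩, ?_, ?_⟩⟩
    · intro y
      obtain ⟨z, rfl⟩ := hps y
      change H (p z, 0) = p z
      rw [hHp, hR0, hq]
    · intro y
      obtain ⟨z, rfl⟩ := hps y
      change H (p z, 1) = q (g (p z))
      rw [hHp, hgp]

end Cone

/-! ### Families of circle bundles collapsed over closed subsets -/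

section Families

variable {X : Type*} [TopologicalSpace X] {I : Type*} {B : I → Type*} [∀ i, TopologicalSpace (B i)]
  {V : Type*} [AddCommGroup V] [Module ℝ V] [TopologicalSpace V]

/-- Proper surjections `β i : B i → X`, injective outside closed subsets `D i`, with fibrewise
embeddings `w i` of the `B i` in a vector space, such that distinct points of a fibre generate
distinct rays. -/
structure IsRayFamily (D : I → Set X) (β : ∀ i, B i → X) (w : ∀ i, B i → V) : Prop where
  isClosed : ∀ i, IsClosed (D i)
  isProperMap : ∀ i, IsProperMap (β i)
  surjective : ∀ i, Function.Surjective (β i)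
  injective : ∀ i p p', β i p = β i p' → β i p ∉ D i → p = p'
  continuous : ∀ i, Continuous (w i)
  ray : ∀ i p p' (a b : ℝ), 0 ≤ a → 0 ≤ b → β i p = β i p' → a • w i p = b • w i p' →
    a = b ∧ (a = 0 ∨ p = p')

/-- A homotopy of `X` relative to `D k`, which preserves the other `D i`, is covered by homotopies
of the `B i`, is continuous over `U`, and pushes the points `x` of `U` into `D k` in time `ρ x`. -/
structure IsLocalShrinking (D : I → Set X) (β : ∀ i, B i → X) (k : I) (U : Set X)
    (sh : X × ℝ → X) (L : ∀ i, B i × ℝ → B i) (ρ : X → ℝ) : Prop where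
  isOpen : IsOpen U
  base : ∀ i p t, β i (L i (p, t)) = sh (β i p, t)
  zero : ∀ x, sh (x, 0) = x
  lift_zero : ∀ i p, L i (p, 0) = p
  fix : ∀ x ∈ D k, ∀ t, sh (x, t) = x
  lift_fix : ∀ i p, β i p ∈ D k → ∀ t, L i (p, t) = p
  mem : ∀ i, ∀ x ∈ D i, ∀ t, sh (x, t) ∈ D i
  continuousOn : ContinuousOn sh (U ×ˢ Set.univ)
  lift_continuousOn : ∀ i, ContinuousOn (L i) ((β i ⁻¹' U) ×ˢ Set.univ)
  time_continuousOn : ContinuousOn ρ U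
  time_nonneg : ∀ x, 0 ≤ ρ x
  time_eq_zero : ∀ x ∈ D k, x ∈ U → ρ x = 0
  hit : ∀ x ∈ U, ∀ t ≤ 1, ρ x < t → sh (x, t) ∈ D k

/-- The fibre product of the `B i`, with for each `i` a number in `[0, 1]`, which vanishes outside
`D i`. -/
abbrev RayCube (D : I → Set X) (β : ∀ i, B i → X) : Type _ :=
  {τ : X × (∀ i, B i) × (I → ℝ) // (∀ i, β i (τ.2.1 i) = τ.1) ∧
    ∀ i, (0 ≤ τ.2.2 i ∧ τ.2.2 i ≤ 1) ∧ (0 < τ.2.2 i → τ.1 ∈ D i)}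

variable {D : I → Set X} {β : ∀ i, B i → X} {w : ∀ i, B i → V}

/-- If the base points converge along an ultrafilter, so do the points of each B i by properness and
the heights by compactness. The conditions pass to the limit since the D i are closed. -/
theorem IsRayFamily.isProperMap_rayCube [T2Space X] (h : IsRayFamily D β w) :
    IsProperMap fun τ : RayCube D β => τ.1.1 := by
  rw [isProperMap_iff_ultrafilter_of_t2]
  refine ⟨by fun_prop, fun 𝒰 y hy => ?_⟩
  have h1 : ∀ i, ∃ b : B i, Filter.Tendsto (fun τ : RayCube D β => τ.1.2.1 i) 𝒰 (𝓝 b) := by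
    intro i
    have := (isProperMap_iff_ultrafilter_of_t2.1 (h.isProperMap i)).2
      (𝒰 := 𝒰.map fun τ : RayCube D β => τ.1.2.1 i) (y := y) ?_
    · exact this
    · rw [Ultrafilter.coe_map, Filter.tendsto_map'_iff]
      exact hy.congr fun τ => (τ.2.1 i).symm
  have h2 : ∀ i, ∃ s : ℝ, Filter.Tendsto (fun τ : RayCube D β => τ.1.2.2 i) 𝒰 (𝓝 s) := by
    intro i
    obtain ⟨s, -, hs⟩ := (isCompact_Icc (a := (0 : ℝ)) (b := 1)).ultrafilter_le_nhds
      (𝒰.map fun τ : RayCube D β => τ.1.2.2 i) (by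
        rw [Filter.le_principal_iff, Ultrafilter.mem_coe, Ultrafilter.mem_map]
        exact Filter.univ_mem' fun τ => (τ.2.2 i).1)
    exact ⟨s, hs⟩
  choose b hb using h1
  choose s hs using h2
  have hlim : Filter.Tendsto (Subtype.val : RayCube D β → _) 𝒰 (𝓝 (y, b, s)) :=
    hy.prodMk_nhds ((tendsto_pi_nhds.2 hb).prodMk_nhds (tendsto_pi_nhds.2 hs))
  have hcl : IsClosed {τ : X × (∀ i, B i) × (I → ℝ) | (∀ i, β i (τ.2.1 i) = τ.1) ∧
      ∀ i, (0 ≤ τ.2.2 i ∧ τ.2.2 i ≤ 1) ∧ (0 < τ.2.2 i → τ.1 ∈ D i)} := by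
    have e1 : ∀ i, IsClosed {τ : X × (∀ i, B i) × (I → ℝ) | β i (τ.2.1 i) = τ.1} := fun i =>
      isClosed_eq ((h.isProperMap i).continuous.comp (by fun_prop)) continuous_fst
    have e2 : ∀ i, IsClosed {τ : X × (∀ i, B i) × (I → ℝ) | 0 ≤ τ.2.2 i} := fun i =>
      isClosed_le continuous_const (by fun_prop)
    have e3 : ∀ i, IsClosed {τ : X × (∀ i, B i) × (I → ℝ) | τ.2.2 i ≤ 1} := fun i =>
      isClosed_le (by fun_prop) continuous_const
    have e4 : ∀ i, IsClosed {τ : X × (∀ i, B i) × (I → ℝ) | 0 < τ.2.2 i → τ.1 ∈ D i} := by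
      intro i
      have : {τ : X × (∀ i, B i) × (I → ℝ) | 0 < τ.2.2 i → τ.1 ∈ D i} =
          {τ | τ.2.2 i ≤ 0} ∪ {τ | τ.1 ∈ D i} := by
        ext τ
        simp only [Set.mem_ofPred_eq, Set.mem_union]
        rw [← not_lt]
        tauto
      rw [this]
      exact (isClosed_le (by fun_prop) continuous_const).union
        ((h.isClosed i).preimage continuous_fst)
    simp only [Set.ofPred_and, Set.ofPred_forall]
    exact (isClosed_iInter e1).inter
      (isClosed_iInter fun i => ((e2 i).inter (e3 i)).inter (e4 i))
  have hmem := hcl.mem_of_tendsto hlim (Filter.Eventually.of_forall fun τ : RayCube D β => τ.2)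
  refine ⟨⟨_, hmem⟩, ?_⟩
  rw [nhds_subtype_eq_comap]
  exact Filter.map_le_iff_le_comap.1 hlim

open Classical in
/-- The vector `(1 - s i) • w i (p i)` for `i ∈ S`, and `0` otherwise. -/
def RayCube.vec (w : ∀ i, B i → V) (S : Set I) (τ : RayCube D β) : I → V :=
  fun i => if i ∈ S then (1 - τ.1.2.2 i) • w i (τ.1.2.1 i) else 0

/-- The image of the fibre product of the `B i`, `i ∈ S`, and of the intervals: the fibre product
over `X` of the spaces obtained by attaching to each `B i`, `i ∈ S`, the mapping cylinder of its
projection over `D i`. -/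
def coneSpace (D : I → Set X) (β : ∀ i, B i → X) (w : ∀ i, B i → V) (S : Set I) :
    Set (X × (I → V)) :=
  Set.range fun τ : RayCube D β => (τ.1.1, τ.vec w S)

/-- The fibre product of `coneSpace D β w S` and of `B k`. -/
def coneSpaceBlowUp (D : I → Set X) (β : ∀ i, B i → X) (w : ∀ i, B i → V) (S : Set I) (k : I) :
    Set ((X × (I → V)) × B k) :=
  Set.range fun τ : RayCube D β => ((τ.1.1, τ.vec w S), τ.1.2.1 k)

/-- The projection of `coneSpace` to `X`. -/
def coneSpace.base (S : Set I) : C(coneSpace D β w S, X) :=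
  ⟨fun y => y.1.1, by fun_prop⟩

variable [ContinuousSMul ℝ V]

theorem IsRayFamily.continuous_vec (h : IsRayFamily D β w) (S : Set I) :
    Continuous (RayCube.vec (D := D) (β := β) w S) := by
  refine continuous_pi fun i => ?_
  unfold RayCube.vec
  split_ifs
  · exact Continuous.smul (by fun_prop) ((h.continuous i).comp (by fun_prop))
  · exact continuous_const

/-- The factor 1 - s vanishes exactly at the end s = 1 of the mapping cylinder. There the point of B
i is forgotten; before it, the ray recovers both the point and the height. -/
theorem IsRayFamily.eq_of_vec_eq (h : IsRayFamily D β w) {S : Set I} {τ τ' : RayCube D β}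
    (hx : τ.1.1 = τ'.1.1) (hv : τ.vec w S = τ'.vec w S) {i : I} (hi : i ∈ S) :
    τ.1.2.2 i = τ'.1.2.2 i ∧ (τ.1.2.2 i = 1 ∨ τ.1.2.1 i = τ'.1.2.1 i) := by
  have e := congrFun hv i
  simp only [RayCube.vec, if_pos hi] at e
  have := h.ray i _ _ _ _ (by linarith [(τ.2.2 i).1.2]) (by linarith [(τ'.2.2 i).1.2])
    (by rw [τ.2.1, τ'.2.1, hx]) e
  refine ⟨by linarith [this.1], this.2.imp (fun h => by linarith) id⟩

variable {S : Set I} {k : I}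

/-- The quotient map from the fibre product of all `B i` and of the intervals. -/
def RayCube.toBlowUp (w : ∀ i, B i → V) (S : Set I) (k : I) (τ : RayCube D β) :
    coneSpaceBlowUp D β w S k := ⟨((τ.1.1, τ.vec w S), τ.1.2.1 k), ⟨τ, rfl⟩⟩

theorem RayCube.surjective_toBlowUp :
    Function.Surjective (RayCube.toBlowUp (D := D) (β := β) w S k) := by
  rintro ⟨_, τ, rfl⟩
  exact ⟨τ, rfl⟩

variable [T2Space V] [T2Space X]

theorem IsRayFamily.t2Space (h : IsRayFamily D β w) (i : I) : T2Space (B i) := by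
  refine T2Space.of_injective_continuous (f := fun b => (β i b, w i b)) ?_
    ((h.isProperMap i).continuous.prodMk (h.continuous i))
  intro b b' e
  obtain ⟨e1, e2⟩ := Prod.ext_iff.1 e
  refine ((h.ray i b b' 1 1 zero_le_one zero_le_one e1 ?_).2).resolve_left one_ne_zero
  simpa using e2

theorem IsRayFamily.continuous_toBlowUp (h : IsRayFamily D β w) :
    Continuous (RayCube.toBlowUp (D := D) (β := β) w S k) := by
  refine Continuous.subtype_mk ?_ _
  have := h.continuous_vec S
  fun_prop

/-- The composite with the projection to X is proper, and the intermediate space is Hausdorff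
because B k is. -/
theorem IsRayFamily.isProperMap_toBlowUp (h : IsRayFamily D β w) :
    IsProperMap (RayCube.toBlowUp (D := D) (β := β) w S k) := by
  have := h.t2Space k
  exact isProperMap_of_comp_of_t2 h.continuous_toBlowUp
    (show Continuous fun z : coneSpaceBlowUp D β w S k => z.1.1.1 by fun_prop)
    h.isProperMap_rayCube

theorem IsRayFamily.isProperMap_blowUpBase (h : IsRayFamily D β w) :
    IsProperMap fun z : coneSpaceBlowUp D β w S k => z.1.1.1 :=
  isProperMap_of_comp_of_surj h.continuous_toBlowUp (by fun_prop) h.isProperMap_rayCube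
    RayCube.surjective_toBlowUp

/-- The homotopy of the fibre product of all `B i` and of the intervals induced by a shrinking. -/
def IsLocalShrinking.lift {U : Set X} {sh : X × ℝ → X} {L : ∀ i, B i × ℝ → B i} {ρ : X → ℝ}
    (hs : IsLocalShrinking D β k U sh L ρ) (c : RayCube D β × ℝ) : RayCube D β :=
  ⟨(sh (c.1.1.1, c.2), fun i => L i (c.1.1.2.1 i, c.2), c.1.1.2.2),
    fun i => by rw [hs.base, c.1.2.1], fun i => ⟨(c.1.2.2 i).1, fun h =>
      hs.mem i _ ((c.1.2.2 i).2 h) _⟩⟩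

theorem IsLocalShrinking.continuousOn_lift {U : Set X} {sh : X × ℝ → X} {L : ∀ i, B i × ℝ → B i}
    {ρ : X → ℝ} (hs : IsLocalShrinking D β k U sh L ρ) :
    ContinuousOn hs.lift ({τ | τ.1.1 ∈ U} ×ˢ Set.univ) := by
  have hv : IsInducing (Subtype.val : RayCube D β → X × (∀ i, B i) × (I → ℝ)) := ⟨rfl⟩
  rw [hv.continuousOn_iff]
  refine ContinuousOn.prodMk ?_ (ContinuousOn.prodMk (continuousOn_pi.2 fun i => ?_) ?_)
  · exact hs.continuousOn.comp (f := fun c : RayCube D β × ℝ => (c.1.1.1, c.2)) (by fun_prop)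
      fun c hc => ⟨hc.1, trivial⟩
  · refine (hs.lift_continuousOn i).comp (f := fun c : RayCube D β × ℝ => (c.1.1.2.1 i, c.2))
      (by fun_prop) fun c hc => ⟨?_, trivial⟩
    change β i _ ∈ U
    rw [c.1.2.1]
    exact hc.1
  · fun_prop

/-- The homotopy does not change heights: at height 1 the vector stays 0 whatever the forgotten
point does, and below height 1 the two points of B i coincide. -/
theorem IsRayFamily.toBlowUp_lift (h : IsRayFamily D β w) {U : Set X} {sh : X × ℝ → X}
    {L : ∀ i, B i × ℝ → B i} {ρ : X → ℝ} (hs : IsLocalShrinking D β k U sh L ρ)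
    {τ τ' : RayCube D β} (e : τ.toBlowUp w S k = τ'.toBlowUp w S k) (t : ℝ) :
    (hs.lift (τ, t)).toBlowUp w S k = (hs.lift (τ', t)).toBlowUp w S k := by
  obtain ⟨e1, e2⟩ := Prod.ext_iff.1 (congrArg Subtype.val e)
  obtain ⟨e3, e4⟩ := Prod.ext_iff.1 e1
  have e3' : τ.1.1 = τ'.1.1 := e3
  have e2' : τ.1.2.1 k = τ'.1.2.1 k := e2
  refine Subtype.ext (Prod.ext (Prod.ext ?_ ?_) ?_)
  · change sh (τ.1.1, t) = sh (τ'.1.1, t)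
    rw [e3']
  · funext i
    simp only [RayCube.toBlowUp, RayCube.vec]
    split_ifs with hi
    · obtain ⟨h1, h2⟩ := h.eq_of_vec_eq e3 e4 hi
      change (1 - τ.1.2.2 i) • w i (L i (τ.1.2.1 i, t)) =
        (1 - τ'.1.2.2 i) • w i (L i (τ'.1.2.1 i, t))
      rw [← h1]
      rcases h2 with h2 | h2
      · rw [h2, sub_self, zero_smul, zero_smul]
      · rw [h2]
    · rfl
  · change L k (τ.1.2.1 k, t) = L k (τ'.1.2.1 k, t)
    rw [e2']

theorem IsRayFamily.exists_blowUp_homotopy (h : IsRayFamily D β w) (S : Set I) {U : Set X}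
    {sh : X × ℝ → X} {L : ∀ i, B i × ℝ → B i} {ρ : X → ℝ}
    (hs : IsLocalShrinking D β k U sh L ρ) :
    ∃ F : coneSpaceBlowUp D β w S k × ℝ → coneSpaceBlowUp D β w S k,
      ContinuousOn F ({z | z.1.1.1 ∈ U} ×ˢ Set.univ) ∧ (∀ z, F (z, 0) = z) ∧
      (∀ z, z.1.1.1 ∈ D k → ∀ t, F (z, t) = z) ∧
      ∀ z t, (F (z, t)).1.1.1 = sh (z.1.1.1, t) := by
  let Q := RayCube.toBlowUp (D := D) (β := β) w S k
  have hQs : Function.Surjective Q := RayCube.surjective_toBlowUp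
  -- A section without any continuity suffices: by `toBlowUp_lift` the result does not depend on it,
  -- and continuity is tested on the proper cover.
  let σ := Function.surjInv hQs
  have hσ : ∀ z, Q (σ z) = z := Function.surjInv_eq hQs
  let F := fun c : coneSpaceBlowUp D β w S k × ℝ => Q (hs.lift (σ c.1, c.2))
  have hF : ∀ τ t, F (Q τ, t) = Q (hs.lift (τ, t)) := fun τ t =>
    h.toBlowUp_lift hs (hσ (Q τ)) t
  have hQq : IsQuotientMap (Prod.map Q id : RayCube D β × ℝ → _ × ℝ) :=
    have hp := (h.isProperMap_toBlowUp (S := S) (k := k)).prodMap (isProperMap_id (X := ℝ))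
    hp.isClosedMap.isQuotientMap hp.continuous (hQs.prodMap Function.surjective_id)
  refine ⟨F, ?_, ?_, ?_, ?_⟩
  · rw [hQq.continuousOn_isOpen_iff]
    · have : F ∘ Prod.map Q id = Q ∘ hs.lift := by
        funext c
        exact hF c.1 c.2
      rw [this]
      exact h.continuous_toBlowUp.comp_continuousOn hs.continuousOn_lift
    · exact (hs.isOpen.preimage (by fun_prop)).prod isOpen_univ
  · intro z
    obtain ⟨τ, rfl⟩ := hQs z
    rw [hF]
    congr 1
    refine Subtype.ext (Prod.ext (hs.zero _) (Prod.ext ?_ rfl))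
    exact funext fun i => hs.lift_zero i _
  · intro z hz t
    obtain ⟨τ, rfl⟩ := hQs z
    rw [hF]
    congr 1
    refine Subtype.ext (Prod.ext (hs.fix _ hz t) (Prod.ext ?_ rfl))
    refine funext fun i => hs.lift_fix i _ ?_ t
    rw [τ.2.1]
    exact hz
  · intro z t
    obtain ⟨τ, rfl⟩ := hQs z
    rw [hF]
    rfl

end Families

/-! ### Collapsing the mapping cylinders one at a time -/

section Families

variable {X : Type*} [TopologicalSpace X] {I : Type*} {B : I → Type*} [∀ i, TopologicalSpace (B i)]
  {V : Type*} [AddCommGroup V] [Module ℝ V] [TopologicalSpace V] [ContinuousSMul ℝ V] [T2Space V]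
  [T2Space X] {D : I → Set X} {β : ∀ i, B i → X} {w : ∀ i, B i → V} {S : Set I} {k : I}

/-- The local shrinkings are glued along a partition of unity pulled back from X. Countably many of
them are needed, because the gluing composes them in the order of ℕ; hence the Lindelöf hypothesis.
-/
theorem IsRayFamily.exists_blowUp_retraction [LindelofSpace X] [ParacompactSpace X]
    (h : IsRayFamily D β w) (S : Set I) (k : I)
    (hs : ∀ x, ∃ U sh L ρ, x ∈ U ∧ IsLocalShrinking D β k U sh L ρ) :
    ∃ r : coneSpaceBlowUp D β w S k × ℝ → coneSpaceBlowUp D β w S k × ℝ,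
      Continuous r ∧ (∀ z, r (z, 0) = (z, 0)) ∧
      (∀ z : coneSpaceBlowUp D β w S k, z.1.1.1 ∈ D k → ∀ t, 0 ≤ t → r (z, t) = (z, t)) ∧
      ∀ c, c.2 ≤ 1 → 0 < (r c).2 → (r c).1.1.1.1 ∈ D k := by
  rcases isEmpty_or_nonempty X with hX | hX
  · exact ⟨id, continuous_id, fun z => hX.elim z.1.1.1, fun z => hX.elim z.1.1.1,
      fun c => hX.elim c.1.1.1.1⟩
  choose U sh L ρ hxU hs using hs
  obtain ⟨s, hsc, hsU⟩ := LindelofSpace.elim_nhds_subcover U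
    fun x => (hs x).isOpen.mem_nhds (hxU x)
  have hsne : s.Nonempty := by
    obtain ⟨x⟩ := hX
    have hx : x ∈ ⋃ y ∈ s, U y := hsU ▸ Set.mem_univ x
    obtain ⟨y, hy, -⟩ := Set.mem_iUnion₂.1 hx
    exact ⟨y, hy⟩
  obtain ⟨e, rfl⟩ := hsc.exists_eq_range hsne
  have hcov : Set.univ ⊆ ⋃ n, U (e n) := by
    rw [← hsU, Set.biUnion_range]
  obtain ⟨P, hP⟩ := PartitionOfUnity.exists_isSubordinate isClosed_univ (fun n => U (e n))
    (fun n => (hs _).isOpen) hcov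
  choose F hFc hF0 hFA hFb using fun n => h.exists_blowUp_homotopy S (hs (e n))
  have hb : Continuous fun z : coneSpaceBlowUp D β w S k => z.1.1.1 := by fun_prop
  obtain ⟨r, h1, h2, h3, -, h5⟩ := exists_retraction_of_locally
    {z : coneSpaceBlowUp D β w S k | z.1.1.1 ∈ D k} (fun n z => P n z.1.1.1)
    (fun n => {z | z.1.1.1 ∈ U (e n)}) F (fun n z => ρ (e n) z.1.1.1)
    (fun n => (P n).continuous.comp hb) (fun n z => P.nonneg n _) (fun n z => P.le_one n _)
    (fun z => P.sum_eq_one (Set.mem_univ _))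
    (P.locallyFinite.preimage_continuous hb) (fun n => (hs _).isOpen.preimage hb)
    (fun n => (tsupport_comp_subset_preimage _ hb).trans (Set.preimage_mono (hP n)))
    hFc (fun n => (hs _).time_continuousOn.comp hb.continuousOn fun z hz => hz)
    (fun n z => (hs _).time_nonneg _) hF0 (fun n z hz _ t => hFA n z hz t)
    (fun n z hz hzU => (hs _).time_eq_zero _ hz hzU)
    (fun n z hz t ht1 ht => by
      change (F n (z, t)).1.1.1 ∈ D k
      rw [hFb]
      exact (hs _).hit _ hz t ht1 ht)
  exact ⟨r, h1, h2, h3, h5⟩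

theorem coneSpaceBlowUp.base_eq (z : coneSpaceBlowUp D β w S k) : β k z.1.2 = z.1.1.1 := by
  obtain ⟨τ, rfl⟩ := RayCube.surjective_toBlowUp z
  exact τ.2.1 k

theorem IsRayFamily.isClosed_attach (h : IsRayFamily D β w) (S : Set I) (k : I) :
    IsClosed {c : coneSpaceBlowUp D β w S k × unitInterval | 0 < c.2 → c.1.1.1.1 ∈ D k} := by
  have : {c : coneSpaceBlowUp D β w S k × unitInterval | 0 < c.2 → c.1.1.1.1 ∈ D k} =
      {c | c.2 ≤ 0} ∪ {c | c.1.1.1.1 ∈ D k} := by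
    ext c
    simp only [Set.mem_ofPred_eq, Set.mem_union]
    rw [← not_lt]
    tauto
  rw [this]
  exact (isClosed_le (by fun_prop) continuous_const).union
    ((h.isClosed k).preimage (by fun_prop))

theorem coneSpace.exists_insert (hk : k ∉ S) (z : coneSpaceBlowUp D β w S k) (s : ℝ) (h0 : 0 ≤ s)
    (h1 : s ≤ 1) (hs : 0 < s → z.1.1.1 ∈ D k) :
    open Classical in
    (z.1.1.1, Function.update z.1.1.2 k ((1 - s) • w k z.1.2)) ∈
      coneSpace D β w (insert k S) := by
  classical
  obtain ⟨τ, rfl⟩ := RayCube.surjective_toBlowUp z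
  refine ⟨⟨(τ.1.1, τ.1.2.1, Function.update τ.1.2.2 k s), τ.2.1, fun i => ?_⟩, ?_⟩
  · rcases eq_or_ne i k with rfl | hi
    · simp only [Function.update_self]
      exact ⟨⟨h0, h1⟩, hs⟩
    · simp only [Function.update_of_ne hi]
      exact τ.2.2 i
  · refine Prod.ext rfl (funext fun i => ?_)
    rcases eq_or_ne i k with rfl | hi
    · simp [RayCube.vec, RayCube.toBlowUp]
    · simp [RayCube.vec, RayCube.toBlowUp, hi]

open Classical in
/-- The attaching map of the mapping cylinder over `D k`. -/
def coneSpace.attach (h : IsRayFamily D β w) (hk : k ∉ S) :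
    C(PartialCylinder {z : coneSpaceBlowUp D β w S k | z.1.1.1 ∈ D k},
      coneSpace D β w (insert k S)) :=
  ⟨fun c => ⟨(c.1.1.1.1.1, Function.update c.1.1.1.1.2 k ((1 - (c.1.2 : ℝ)) • w k c.1.1.1.2)),
    coneSpace.exists_insert hk c.1.1 c.1.2 c.1.2.2.1 c.1.2.2.2 c.2⟩, by
      have := h.continuous k
      refine Continuous.subtype_mk (Continuous.prodMk (by fun_prop) ?_) _
      exact Continuous.update (by fun_prop) k (by fun_prop)⟩

theorem coneSpace.mem_of_insert (hk : k ∉ S) (y : coneSpace D β w (insert k S)) :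
    open Classical in (y.1.1, Function.update y.1.2 k 0) ∈ coneSpace D β w S := by
  classical
  obtain ⟨_, τ, rfl⟩ := y
  refine ⟨τ, Prod.ext rfl (funext fun i => ?_)⟩
  rcases eq_or_ne i k with rfl | hi
  · simp [RayCube.vec, hk]
  · simp [RayCube.vec, hi]

open Classical in
/-- The projection which collapses the mapping cylinder over `D k`. -/
def coneSpace.collapse (hk : k ∉ S) : C(coneSpace D β w (insert k S), coneSpace D β w S) :=
  ⟨fun y => ⟨(y.1.1, Function.update y.1.2 k 0), coneSpace.mem_of_insert hk y⟩,
    Continuous.subtype_mk (Continuous.prodMk (by fun_prop)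
      (Continuous.update (by fun_prop) k continuous_const)) _⟩

/-- This is `isHomotopyEquivalence_of_retraction` with Z the fibre product of `coneSpace D β w S`
and B k, and A its part over D k. Off D k the projection of B k is injective, so Z maps to
`coneSpace D β w S` with identifications inside A only. -/
theorem IsRayFamily.isHomotopyEquivalence_collapse [LindelofSpace X] [ParacompactSpace X]
    (h : IsRayFamily D β w) (hk : k ∉ S)
    (hs : ∀ x, ∃ U sh L ρ, x ∈ U ∧ IsLocalShrinking D β k U sh L ρ) :
    IsHomotopyEquivalence (coneSpace.collapse (D := D) (β := β) (w := w) hk) := by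
  classical
  obtain ⟨r, hr, hr0, hrA, hrp⟩ := h.exists_blowUp_retraction S k hs
  have hvk : ∀ z : coneSpaceBlowUp D β w S k, z.1.1.2 k = 0 := by
    intro z
    obtain ⟨τ, rfl⟩ := RayCube.surjective_toBlowUp z
    simp [RayCube.toBlowUp, RayCube.vec, hk]
  have hup : ∀ z : coneSpaceBlowUp D β w S k, Function.update z.1.1.2 k 0 = z.1.1.2 := by
    intro z
    rw [← hvk z, Function.update_eq_self]
  let p : C(coneSpaceBlowUp D β w S k, coneSpace D β w S) :=
    ⟨fun z => ⟨z.1.1, by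
      obtain ⟨τ, rfl⟩ := RayCube.surjective_toBlowUp z
      exact ⟨τ, rfl⟩⟩, by fun_prop⟩
  have hp : IsProperMap p :=
    isProperMap_of_comp_of_t2 p.continuous (coneSpace.base S).continuous h.isProperMap_blowUpBase
  have hκ : IsProperMap (coneSpace.attach h hk) := by
    refine isProperMap_of_comp_of_t2 (ContinuousMap.continuous _)
      (coneSpace.base (insert k S)).continuous ?_
    have h1 : IsProperMap fun c : coneSpaceBlowUp D β w S k × unitInterval => c.1.1.1.1 :=
      h.isProperMap_blowUpBase.comp isProperMap_fst_of_compactSpace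
    exact h1.comp (h.isClosed_attach S k).isClosedEmbedding_subtypeVal.isProperMap
  refine isHomotopyEquivalence_of_retraction {z : coneSpaceBlowUp D β w S k | z.1.1.1 ∈ D k} p _
    (coneSpace.attach h hk) hp ?_ hκ ?_ ?_ ?_ ?_ ?_ r hr hr0 hrA hrp
  · rintro ⟨_, τ, rfl⟩
    exact ⟨τ.toBlowUp w S k, rfl⟩
  · rintro ⟨_, τ, rfl⟩
    refine ⟨⟨(τ.toBlowUp w S k, ⟨τ.1.2.2 k, (τ.2.2 k).1⟩), (τ.2.2 k).2⟩, ?_⟩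
    refine Subtype.ext (Prod.ext rfl (funext fun i => ?_))
    rcases eq_or_ne i k with rfl | hi
    · simp [coneSpace.attach, RayCube.vec, RayCube.toBlowUp]
    · simp [coneSpace.attach, RayCube.vec, RayCube.toBlowUp, hi]
  · intro c
    refine Subtype.ext (Prod.ext rfl ?_)
    change Function.update (Function.update c.1.1.1.1.2 k _) k 0 = c.1.1.1.1.2
    rw [Function.update_idem, hup]
  · intro z z' e
    have e1 : z.1.1 = z'.1.1 := congrArg Subtype.val e
    by_cases hz : z.1.1.1 ∈ D k
    · refine Or.inr ⟨hz, ?_⟩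
      change z'.1.1.1 ∈ D k
      rwa [← e1]
    · refine Or.inl (Subtype.ext (Prod.ext e1 (h.injective k _ _ ?_ ?_)))
      · rw [coneSpaceBlowUp.base_eq z, coneSpaceBlowUp.base_eq z', e1]
      · rwa [coneSpaceBlowUp.base_eq z]
  · intro c c' hc hc' e
    have e1 : c.1.1.1.1 = c'.1.1.1.1 := congrArg Subtype.val e
    apply Subtype.ext
    change (c.1.1.1.1.1, Function.update c.1.1.1.1.2 k ((1 - (c.1.2 : ℝ)) • w k c.1.1.1.2)) =
      (c'.1.1.1.1.1, Function.update c'.1.1.1.1.2 k ((1 - (c'.1.2 : ℝ)) • w k c'.1.1.1.2))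
    rw [hc, hc', e1]
    simp
  · intro c c' e
    have e0 := congrArg Subtype.val e
    change (c.1.1.1.1.1, Function.update c.1.1.1.1.2 k ((1 - (c.1.2 : ℝ)) • w k c.1.1.1.2)) =
      (c'.1.1.1.1.1, Function.update c'.1.1.1.1.2 k ((1 - (c'.1.2 : ℝ)) • w k c'.1.1.1.2)) at e0
    obtain ⟨e1, e2⟩ := Prod.ext_iff.1 e0
    have e3 := congrFun e2 k
    simp only [Function.update_self] at e3
    have e4 := h.ray k _ _ _ _ (by linarith [c.1.2.2.2]) (by linarith [c'.1.2.2.2])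
      (by rw [coneSpaceBlowUp.base_eq c.1.1, coneSpaceBlowUp.base_eq c'.1.1]; exact e1) e3
    have e5 : (c.1.2 : ℝ) = c'.1.2 := by linarith [e4.1]
    rcases e4.2 with e6 | e6
    · right
      constructor
      · exact Subtype.ext (by change (c.1.2 : ℝ) = 1; linarith)
      · exact Subtype.ext (by change (c'.1.2 : ℝ) = 1; linarith)
    · left
      refine Subtype.ext (Prod.ext (Subtype.ext (Prod.ext (Prod.ext e1 ?_) e6)) (Subtype.ext e5))
      rw [← hup c.1.1, ← hup c'.1.1]
      have := congrArg (fun v => Function.update v k 0) e2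
      simpa [Function.update_idem] using this

theorem IsRayFamily.isHomotopyEquivalence_base [LindelofSpace X] [ParacompactSpace X] [Finite I]
    (h : IsRayFamily D β w)
    (hs : ∀ k x, ∃ U sh L ρ, x ∈ U ∧ IsLocalShrinking D β k U sh L ρ) (S : Set I) :
    IsHomotopyEquivalence (coneSpace.base (D := D) (β := β) (w := w) S) := by
  induction S, S.toFinite using Set.Finite.induction_on with
  | empty =>
    have hv : ∀ τ : RayCube D β, τ.vec w ∅ = 0 := fun τ => by
      funext i
      simp [RayCube.vec]
    have hps : Function.Surjective fun τ : RayCube D β => τ.1.1 := fun x =>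
      ⟨⟨(x, fun i => (h.surjective i x).choose, 0), fun i => (h.surjective i x).choose_spec,
        fun i => ⟨⟨le_rfl, zero_le_one⟩, fun h => absurd h (lt_irrefl _)⟩⟩, rfl⟩
    refine IsHomotopyEquivalence.of_isHomeomorph _
      ((isHomeomorph_iff_exists_inverse).2 ⟨ContinuousMap.continuous _, fun x => ⟨(x, 0), ?_⟩,
        ?_, ?_, ?_⟩)
    · obtain ⟨τ, rfl⟩ := hps x
      exact ⟨τ, Prod.ext rfl (hv τ)⟩
    · rintro ⟨_, τ, rfl⟩
      exact Subtype.ext (Prod.ext rfl (hv τ).symm)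
    · intro x
      rfl
    · fun_prop
  | @insert k S hk _ ih =>
    exact ih.comp (h.isHomotopyEquivalence_collapse hk (hs k))

end Families

/-! ### Functions which vanish on a coordinate hyperplane -/

section Division

variable {N : ℕ} {G : (Fin N → ℂ) → ℂ} {Ω : Set (Fin N → ℂ)} {c : Fin N}

open Classical in
/-- The quotient of a function by a coordinate, extended to the coordinate hyperplane by the
partial derivative. -/
def quotientByCoordinate (G : (Fin N → ℂ) → ℂ) (c : Fin N) (z : Fin N → ℂ) : ℂ :=
  if z c = 0 then fderiv ℂ G z (Pi.single c 1) else G z / z c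

/-- G is zero along the hyperplane, so its differential kills the directions with `v c = 0` and is a
multiple of the c-th coordinate form. -/
theorem fderiv_eq_quotientByCoordinate_mul (hΩ : IsOpen Ω) (hG : ContDiffOn ℂ ω G Ω)
    (h0 : ∀ z ∈ Ω, z c = 0 → G z = 0) {z : Fin N → ℂ} (hz : z ∈ Ω) (hzc : z c = 0)
    (v : Fin N → ℂ) : fderiv ℂ G z v = quotientByCoordinate G c z * v c := by
  have hd : HasFDerivAt G (fderiv ℂ G z) z :=
    ((hG.contDiffAt (hΩ.mem_nhds hz)).differentiableAt (by simp)).hasFDerivAt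
  have key : ∀ v : Fin N → ℂ, v c = 0 → fderiv ℂ G z v = 0 := by
    intro v hv
    have h1 : HasDerivAt (fun t : ℂ => z + t • v) v 0 := by
      simpa using ((hasDerivAt_id (0 : ℂ)).smul_const v).const_add z
    have h2 : HasDerivAt (fun t : ℂ => G (z + t • v)) (fderiv ℂ G z v) 0 := by
      refine HasFDerivAt.comp_hasDerivAt (f := fun t : ℂ => z + t • v) 0 ?_ h1
      simpa using hd
    have h3 : (fun t : ℂ => G (z + t • v)) =ᶠ[𝓝 0] fun _ => 0 := by
      have : {t : ℂ | z + t • v ∈ Ω} ∈ 𝓝 (0 : ℂ) :=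
        (hΩ.preimage (by fun_prop : Continuous fun t : ℂ => z + t • v)).mem_nhds (by simpa using hz)
      filter_upwards [this] with t ht
      exact h0 _ ht (by simp [hzc, hv])
    exact h2.unique ((hasDerivAt_const (0 : ℂ) (0 : ℂ)).congr_of_eventuallyEq h3)
  have h4 := key (v - v c • Pi.single c 1) (by simp)
  rw [map_sub, map_smul, sub_eq_zero] at h4
  rw [h4, quotientByCoordinate, if_pos hzc, smul_eq_mul, mul_comm]

theorem quotientByCoordinate_mul (h0 : ∀ z ∈ Ω, z c = 0 → G z = 0) {z : Fin N → ℂ} (hz : z ∈ Ω) :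
    G z = quotientByCoordinate G c z * z c := by
  unfold quotientByCoordinate
  split_ifs with h
  · rw [h0 z hz h, h, mul_zero]
  · rw [div_mul_cancel₀ _ h]

/-- At a point z of the hyperplane, strict differentiability is applied to the pair of a nearby
point z' and its projection to the hyperplane. G vanishes at the projection, so `G z' / z' c` is
close to the partial derivative at z, uniformly in z'. -/
theorem continuousOn_quotientByCoordinate (hΩ : IsOpen Ω) (hG : ContDiffOn ℂ ω G Ω)
    (h0 : ∀ z ∈ Ω, z c = 0 → G z = 0) : ContinuousOn (quotientByCoordinate G c) Ω := by
  intro z hz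
  refine ContinuousAt.continuousWithinAt ?_
  have hz' : Ω ∈ 𝓝 z := hΩ.mem_nhds hz
  have hGc : ContinuousAt G z := hG.continuousOn.continuousAt hz'
  by_cases hzc : z c = 0
  · have hs : HasStrictFDerivAt G (fderiv ℂ G z) z :=
      (hG.contDiffAt hz').hasStrictFDerivAt (by simp)
    have hf : ContinuousAt (fun z' => fderiv ℂ G z' (Pi.single c 1)) z :=
      ((hG.continuousOn_fderiv_of_isOpen hΩ (by simp)).continuousAt hz').clm_apply
        continuousAt_const
    rw [Metric.continuousAt_iff'] at hf ⊢
    intro ε hε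
    have hupd : Filter.Tendsto (fun z' : Fin N → ℂ => (z', Function.update z' c 0)) (𝓝 z)
        (𝓝 (z, z)) := by
      have : Continuous fun z' : Fin N → ℂ => (z', Function.update z' c 0) :=
        continuous_id.prodMk (continuous_id.update c continuous_const)
      have h := this.tendsto z
      rwa [show Function.update z c 0 = z by rw [← hzc, Function.update_eq_self]] at h
    have h1 := hupd.eventually (hs.isLittleO.def (half_pos hε))
    have h2 := hupd.eventually (prod_mem_nhds hz' hz')
    filter_upwards [h1, h2, hf ε hε] with z' h1 h2 h3
    have e : quotientByCoordinate G c z = fderiv ℂ G z (Pi.single c 1) := if_pos hzc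
    rw [e]
    by_cases hc : z' c = 0
    · rwa [quotientByCoordinate, if_pos hc]
    · rw [quotientByCoordinate, if_neg hc]
      have e1 : z' - Function.update z' c 0 = z' c • Pi.single c 1 := by
        funext i
        rcases eq_or_ne i c with rfl | hi
        · simp
        · simp [hi]
      have e2 : G (Function.update z' c 0) = 0 := h0 _ h2.2 (by simp)
      simp only [e1, e2, sub_zero, map_smul, smul_eq_mul, norm_smul, Pi.norm_single, norm_one,
        mul_one] at h1
      have hp : 0 < ‖z' c‖ := norm_pos_iff.2 hc
      rw [dist_eq_norm]
      have e3 : G z' / z' c - fderiv ℂ G z (Pi.single c 1) =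
          (G z' - z' c * fderiv ℂ G z (Pi.single c 1)) / z' c := by
        field_simp
      rw [e3, norm_div, div_lt_iff₀ hp]
      calc _ ≤ ε / 2 * ‖z' c‖ := h1
        _ < ε * ‖z' c‖ := by nlinarith
  · have h1 : ∀ᶠ z' : Fin N → ℂ in 𝓝 z, z' c ≠ 0 :=
      (continuous_apply c).continuousAt.eventually_ne hzc
    refine (hGc.div (continuous_apply c).continuousAt hzc).congr ?_
    filter_upwards [h1] with z' h
    rw [quotientByCoordinate, if_neg h]
    rfl

end Division

/-! ### Local equations which divide all others -/

section Equations

variable {N : ℕ} {X : Type u} [TopologicalSpace X] [ChartedSpace (Fin N → ℂ) X]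

/-- The differential of a function, as a linear form on the tangent space. -/
def differential (N : ℕ) {X : Type u} [TopologicalSpace X] [ChartedSpace (Fin N → ℂ) X]
    (f : X → ℂ) (y : X) : TangentSpace 𝓘(ℂ, Fin N → ℂ) y →ₗ[ℂ] ℂ :=
  (mfderiv 𝓘(ℂ, Fin N → ℂ) 𝓘(ℂ, ℂ) f y).toLinearMap

/-- A local equation `f` of `D` on `U` such that all other local equations of `D` are products
of `f` and of nowhere vanishing continuous functions. -/
structure IsGenerator (N : ℕ) {X : Type u} [TopologicalSpace X] [ChartedSpace (Fin N → ℂ) X]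
    (D U : Set X) (f : X → ℂ) : Prop extends IsLocalEquation N D U f where
  exists_factor : ∀ V g, IsLocalEquation N D V g → ∃ u : X → ℂ, ContinuousOn u (U ∩ V) ∧
    ∀ y ∈ U ∩ V, u y ≠ 0 ∧ g y = u y * f y ∧ (y ∈ D → differential N g y = u y • differential N f y)

theorem isGenerator_one {D U : Set X} (hU : IsOpen U) (hD : ∀ y ∈ U, y ∉ D) :
    IsGenerator N D U fun _ => 1 where
  isOpen := hU
  holomorphic := contMDiffOn_const
  mem_iff y hy := by simp [hD y hy]
  mfderiv_ne_zero y hy h := absurd h (hD y hy)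
  exists_factor V g hg := ⟨g, hg.holomorphic.continuousOn.mono Set.inter_subset_right,
    fun y hy => ⟨fun h => hD y hy.1 ((hg.mem_iff y hy.2).2 h), (mul_one _).symm,
      fun h => absurd h (hD y hy.1)⟩⟩

variable [IsManifold 𝓘(ℂ, Fin N → ℂ) ω X]

theorem mdifferentiable_of_mem_maximalAtlas {φ : OpenPartialHomeomorph X (Fin N → ℂ)}
    (hφ : φ ∈ IsManifold.maximalAtlas 𝓘(ℂ, Fin N → ℂ) ω X) :
    φ.MDifferentiable 𝓘(ℂ, Fin N → ℂ) 𝓘(ℂ, Fin N → ℂ) :=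
  ⟨(contMDiffOn_of_mem_maximalAtlas hφ).mdifferentiableOn (by simp),
    (contMDiffOn_symm_of_mem_maximalAtlas hφ).mdifferentiableOn (by simp)⟩

theorem mfderiv_coordinate {φ : OpenPartialHomeomorph X (Fin N → ℂ)}
    (hφ : φ ∈ IsManifold.maximalAtlas 𝓘(ℂ, Fin N → ℂ) ω X) (c : Fin N) {y : X}
    (hy : y ∈ φ.source) (v : TangentSpace 𝓘(ℂ, Fin N → ℂ) y) :
    differential N (fun x => φ x c) y v =
      (mfderiv 𝓘(ℂ, Fin N → ℂ) 𝓘(ℂ, Fin N → ℂ) φ y v : Fin N → ℂ) c := by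
  have h1 := ((mdifferentiable_of_mem_maximalAtlas hφ).mdifferentiableAt hy).hasMFDerivAt
  have h2 : HasMFDerivAt 𝓘(ℂ, Fin N → ℂ) 𝓘(ℂ, ℂ) (fun z : Fin N → ℂ => z c) (φ y)
      (ContinuousLinearMap.proj (R := ℂ) (φ := fun _ : Fin N => ℂ) c) :=
    (ContinuousLinearMap.proj (R := ℂ) (φ := fun _ : Fin N => ℂ) c).hasMFDerivAt
  have h3 := (h2.comp y h1).mfderiv
  exact DFunLike.congr_fun h3 v

/-- The factor of another equation g is its quotient by the coordinate, read in the chart. It does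
not vanish: off D because g does not, on D because the differential of g does not. -/
theorem isGenerator_coordinate {φ : OpenPartialHomeomorph X (Fin N → ℂ)}
    (hφ : φ ∈ IsManifold.maximalAtlas 𝓘(ℂ, Fin N → ℂ) ω X) (c : Fin N) {D : Set X}
    (hD : ∀ y ∈ φ.source, y ∈ D ↔ φ y c = 0) :
    IsGenerator N D φ.source fun y => φ y c where
  isOpen := φ.open_source
  holomorphic := (ContinuousLinearMap.proj (R := ℂ) (φ := fun _ : Fin N => ℂ) c).contMDiff.comp_contMDiffOn
    (contMDiffOn_of_mem_maximalAtlas hφ)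
  mem_iff := hD
  mfderiv_ne_zero y hy _ h := by
    obtain ⟨v, hv⟩ := (mdifferentiable_of_mem_maximalAtlas hφ).mfderiv_surjective hy
      (Pi.single c 1 : Fin N → ℂ)
    have h1 := mfderiv_coordinate hφ c hy v
    have h2 : (0 : ℂ) = (Pi.single c 1 : Fin N → ℂ) c := by
      rw [← hv, ← h1, differential, h]
      rfl
    simp at h2
  exists_factor V g hg := by
    set G : (Fin N → ℂ) → ℂ := g ∘ φ.symm with hG
    set Ω : Set (Fin N → ℂ) := φ.target ∩ φ.symm ⁻¹' V with hΩ
    have hΩo : IsOpen Ω := φ.symm.isOpen_inter_preimage hg.isOpen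
    have hGs : ContDiffOn ℂ ω G Ω := by
      rw [← contMDiffOn_iff_contDiffOn]
      exact hg.holomorphic.comp ((contMDiffOn_symm_of_mem_maximalAtlas hφ).mono
        Set.inter_subset_left) fun z hz => hz.2
    have h0 : ∀ z ∈ Ω, z c = 0 → G z = 0 := by
      intro z hz hzc
      refine (hg.mem_iff _ hz.2).1 ((hD _ (φ.map_target hz.1)).2 ?_)
      rw [φ.right_inv hz.1, hzc]
    have hmem : ∀ y ∈ φ.source ∩ V, φ y ∈ Ω := fun y hy =>
      ⟨φ.map_source hy.1, by rw [Set.mem_preimage, φ.left_inv hy.1]; exact hy.2⟩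
    have hGφ : ∀ y ∈ φ.source, G (φ y) = g y := fun y hy => by
      rw [hG, Function.comp_apply, φ.left_inv hy]
    have hder : ∀ y ∈ φ.source ∩ V, y ∈ D → differential N g y =
        quotientByCoordinate G c (φ y) • differential N (fun x => φ x c) y := by
      intro y hy hyD
      ext v
      have h1 := ((mdifferentiable_of_mem_maximalAtlas hφ).mdifferentiableAt hy.1).hasMFDerivAt
      have h2 : HasMFDerivAt 𝓘(ℂ, Fin N → ℂ) 𝓘(ℂ, ℂ) G (φ y) (fderiv ℂ G (φ y)) :=
        ((hGs.contDiffAt (hΩo.mem_nhds (hmem y hy))).differentiableAt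
          (by simp)).hasFDerivAt.hasMFDerivAt
      have h3 : g =ᶠ[𝓝 y] G ∘ φ := by
        filter_upwards [φ.open_source.mem_nhds hy.1] with x hx
        exact (hGφ x hx).symm
      have h4 := ((h2.comp y h1).congr_of_eventuallyEq h3).mfderiv
      rw [LinearMap.smul_apply, mfderiv_coordinate hφ c hy.1 v]
      refine Eq.trans (DFunLike.congr_fun h4 v) ?_
      exact fderiv_eq_quotientByCoordinate_mul hΩo hGs h0 (hmem y hy)
        ((hD y hy.1).1 hyD) _
    refine ⟨fun y => quotientByCoordinate G c (φ y), ?_, fun y hy => ⟨fun hu => ?_, ?_, ?_⟩⟩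
    · exact (continuousOn_quotientByCoordinate hΩo hGs h0).comp
        (φ.continuousOn.mono Set.inter_subset_left) hmem
    · by_cases hyD : y ∈ D
      · refine hg.mfderiv_ne_zero y hy.2 hyD (ContinuousLinearMap.ext fun v => ?_)
        refine Eq.trans (DFunLike.congr_fun (hder y hy hyD) v) ?_
        simp only at hu
        rw [hu, zero_smul]
        rfl
      · refine hyD ((hg.mem_iff y hy.2).2 ?_)
        simp only at hu
        rw [← hGφ y hy.1, quotientByCoordinate_mul h0 (hmem y hy), hu, zero_mul]
    · rw [← hGφ y hy.1]
      exact quotientByCoordinate_mul h0 (hmem y hy)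
    · exact hder y hy

end Equations

/-! ### Phases -/

section Phases

variable {M : Type*} [AddCommGroup M] [Module ℂ M] {L : M →ₗ[ℂ] ℂ}

theorem rayPhase_rayOfNeZero (L : M →ₗ[ℂ] ℂ) {v : M} (hv : v ≠ 0) :
    rayPhase L (rayOfNeZero ℝ v hv) = L v / (‖L v‖ : ℂ) := rfl

theorem norm_div_norm {z : ℂ} (hz : z ≠ 0) : ‖z / (‖z‖ : ℂ)‖ = 1 := by
  rw [norm_div, Complex.norm_real, norm_norm, div_self (norm_ne_zero_iff.2 hz)]

theorem norm_mul_div_norm (z : ℂ) : (‖z‖ : ℂ) * (z / (‖z‖ : ℂ)) = z := by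
  rcases eq_or_ne z 0 with rfl | hz
  · simp
  · exact mul_div_cancel₀ _ (by exact_mod_cast norm_ne_zero_iff.2 hz)

theorem norm_rayPhase (hL : Function.Injective L) (r : Module.Ray ℝ M) : ‖rayPhase L r‖ = 1 := by
  induction r using Module.Ray.ind with
  | h v hv => exact norm_div_norm ((map_ne_zero_iff L hL).2 hv)

/-- An injective L embeds M in ℂ, where a ray is determined by its argument. Rescaling v and v' by
each other's absolute values under L makes them equal. -/
theorem rayPhase_injective (hL : Function.Injective L) : Function.Injective (rayPhase L) := by
  intro r r' h
  induction r using Module.Ray.ind with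
  | h v hv =>
    induction r' using Module.Ray.ind with
    | h v' hv' =>
      rw [rayPhase_rayOfNeZero, rayPhase_rayOfNeZero] at h
      have h1 : 0 < ‖L v‖ := norm_pos_iff.2 ((map_ne_zero_iff L hL).2 hv)
      have h2 : 0 < ‖L v'‖ := norm_pos_iff.2 ((map_ne_zero_iff L hL).2 hv')
      refine (ray_eq_iff hv hv').2 (Or.inr (Or.inr ⟨‖L v'‖, ‖L v‖, h2, h1, hL ?_⟩))
      have h3 : (‖L v'‖ : ℂ) ≠ 0 := by exact_mod_cast h2.ne'
      have h4 : L v = (‖L v‖ : ℂ) * (L v' / (‖L v'‖ : ℂ)) := by rw [← h, norm_mul_div_norm]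
      rw [← Complex.coe_smul, ← Complex.coe_smul, map_smul, map_smul, smul_eq_mul, smul_eq_mul]
      calc (‖L v'‖ : ℂ) * L v = (‖L v'‖ : ℂ) * ((‖L v‖ : ℂ) * (L v' / (‖L v'‖ : ℂ))) := by rw [← h4]
        _ = (‖L v‖ : ℂ) * L v' := by field_simp

theorem exists_rayPhase_eq (hL : Function.Surjective L) {θ : ℂ} (hθ : ‖θ‖ = 1) :
    ∃ r, rayPhase L r = θ := by
  obtain ⟨v, rfl⟩ := hL θ
  have hv : v ≠ 0 := by
    rintro rfl
    simp at hθ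
  exact ⟨rayOfNeZero ℝ v hv, by rw [rayPhase_rayOfNeZero, hθ]; simp⟩

theorem rayPhase_smul (u : ℂ) (L : M →ₗ[ℂ] ℂ) (r : Module.Ray ℝ M) :
    rayPhase (u • L) r = u / (‖u‖ : ℂ) * rayPhase L r := by
  induction r using Module.Ray.ind with
  | h v hv =>
    rw [rayPhase_rayOfNeZero, rayPhase_rayOfNeZero, LinearMap.smul_apply, smul_eq_mul, norm_mul,
      Complex.ofReal_mul, mul_div_mul_comm]

end Phases

/-! ### The topology of the real oriented blow-up -/

section BlowUps

variable {N : ℕ} {X : Type u} [TopologicalSpace X] [ChartedSpace (Fin N → ℂ) X]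
  {D U V : Set X} {f g : X → ℂ}

theorem normalDifferential_eq_smul (hf : IsLocalEquation N D U f) (hg : IsLocalEquation N D V g)
    {y : X} (hy : y ∈ U) (hy' : y ∈ V) {u : ℂ}
    (h : differential N g y = u • differential N f y) :
    normalDifferential hg hy' = u • normalDifferential hf hy := by
  apply LinearMap.ext
  intro n
  obtain ⟨v, rfl⟩ := Submodule.mkQ_surjective (tangentToDivisor (N := N) D y) n
  exact DFunLike.congr_fun h v

/-- The tangent space of D is the common kernel of the differentials of all local equations. On D
these are multiples of the differential of f, so the kernel of the latter is already the whole
intersection. -/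
theorem IsGenerator.injective_normalDifferential (hf : IsGenerator N D U f) {y : X} (hy : y ∈ U)
    (hyD : y ∈ D) : Function.Injective (normalDifferential hf.toIsLocalEquation hy) := by
  rw [injective_iff_map_eq_zero]
  intro n hn
  obtain ⟨v, rfl⟩ := Submodule.mkQ_surjective (tangentToDivisor (N := N) D y) n
  have hv : differential N f y v = 0 := hn
  refine (Submodule.Quotient.mk_eq_zero _).2 ?_
  simp only [tangentToDivisor, Submodule.mem_iInf]
  intro V g hg hyV
  obtain ⟨u, -, hu⟩ := hf.exists_factor V g hg
  have := DFunLike.congr_fun ((hu y ⟨hy, hyV⟩).2.2 hyD) v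
  refine this.trans ?_
  rw [LinearMap.smul_apply, hv, smul_zero]
  rfl

theorem IsLocalEquation.surjective_normalDifferential (hf : IsLocalEquation N D U f) {y : X}
    (hy : y ∈ U) (hyD : y ∈ D) : Function.Surjective (normalDifferential hf hy) := by
  refine LinearMap.surjective (f := normalDifferential hf hy) fun h => ?_
  refine hf.mfderiv_ne_zero y hy hyD (ContinuousLinearMap.ext fun v => ?_)
  exact DFunLike.congr_fun h (Submodule.Quotient.mk (p := tangentToDivisor (N := N) D y) v)

open Classical in
/-- The phase of a local equation, extended by zero. -/
def DivisorBlowUp.extendedPhase (hf : IsLocalEquation N D U f) (p : DivisorBlowUp N D) : ℂ :=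
  if hp : p.base ∈ U then p.phase hf hp else 0

theorem DivisorBlowUp.extendedPhase_of_mem (hf : IsLocalEquation N D U f)
    {p : DivisorBlowUp N D} (hp : p.base ∈ U) : p.extendedPhase hf = p.phase hf hp :=
  dif_pos hp

theorem DivisorBlowUp.continuousOn_extendedPhase (hf : IsLocalEquation N D U f) :
    ContinuousOn (DivisorBlowUp.extendedPhase hf) (DivisorBlowUp.base ⁻¹' U) := by
  have hU : IsOpen (DivisorBlowUp.base ⁻¹' U : Set (DivisorBlowUp N D)) :=
    hf.isOpen.preimage (DivisorBlowUp.continuous_base D)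
  rw [continuousOn_open_iff hU]
  intro W hW
  have : IsOpen {p : DivisorBlowUp N D | ∃ hp : p.base ∈ U, p.phase hf hp ∈ W} := by
    have h : (instTopologicalSpaceDivisorBlowUp (N := N) D) ≤ TopologicalSpace.generateFrom _ :=
      inf_le_right
    exact h _ (TopologicalSpace.isOpen_generateFrom_of_mem ⟨U, f, hf, W, hW, rfl⟩)
  convert this using 1
  ext p
  constructor
  · rintro ⟨hp, h⟩
    refine ⟨hp, ?_⟩
    rwa [Set.mem_preimage, extendedPhase_of_mem hf hp] at h
  · rintro ⟨hp, h⟩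
    refine ⟨hp, ?_⟩
    rwa [Set.mem_preimage, extendedPhase_of_mem hf hp]

variable (hf : IsGenerator N D U f)

/-- The factor between the two equations also relates their differentials on D, so its own phase
relates their phases both on D and off D. -/
theorem IsGenerator.phase_eq_mul (hg : IsLocalEquation N D V g) : ∃ u : X → ℂ,
    ContinuousOn u (U ∩ V) ∧ ∀ p : DivisorBlowUp N D, ∀ (hp : p.base ∈ U) (hp' : p.base ∈ V),
      p.phase hg hp' = u p.base * p.phase hf.toIsLocalEquation hp := by
  obtain ⟨u, hu, hfac⟩ := hf.exists_factor V g hg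
  refine ⟨fun y => u y / (‖u y‖ : ℂ), hu.div (by fun_prop) fun y hy => ?_, fun p hp hp' => ?_⟩
  · exact_mod_cast norm_ne_zero_iff.2 (hfac y hy).1
  · obtain ⟨-, h1, h2⟩ := hfac _ ⟨hp, hp'⟩
    unfold DivisorBlowUp.phase
    split_ifs with hD
    · rw [normalDifferential_eq_smul hf.toIsLocalEquation hg hp hp' (h2 hD), rayPhase_smul]
    · rw [h1, norm_mul, Complex.ofReal_mul, mul_div_mul_comm]

theorem IsGenerator.norm_phase (p : DivisorBlowUp N D) (hp : p.base ∈ U) :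
    ‖p.phase hf.toIsLocalEquation hp‖ = 1 := by
  unfold DivisorBlowUp.phase
  split_ifs with hD
  · exact norm_rayPhase (hf.injective_normalDifferential hp hD) _
  · exact norm_div_norm fun h => hD ((hf.mem_iff _ hp).2 h)

theorem IsGenerator.norm_mul_phase (p : DivisorBlowUp N D) (hp : p.base ∈ U) :
    (‖f p.base‖ : ℂ) * p.phase hf.toIsLocalEquation hp = f p.base := by
  unfold DivisorBlowUp.phase
  split_ifs with hD
  · rw [(hf.mem_iff _ hp).1 hD]
    simp
  · exact norm_mul_div_norm _

theorem IsGenerator.ext {p p' : DivisorBlowUp N D} (hp : p.base ∈ U) (hp' : p'.base ∈ U)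
    (h : p.base = p'.base)
    (h' : p.phase hf.toIsLocalEquation hp = p'.phase hf.toIsLocalEquation hp') : p = p' := by
  obtain ⟨x, r⟩ := p
  obtain ⟨x', r'⟩ := p'
  obtain rfl : x = x' := h
  congr 1
  funext hD
  have hD' : x ∈ D := hD
  simp only [DivisorBlowUp.phase, dif_pos hD'] at h'
  exact rayPhase_injective (hf.injective_normalDifferential hp hD) h'

/-- With `IsGenerator.ext` this describes the blow-up by polar coordinates f = |f| θ: over D the
phase θ is free, elsewhere it is f / |f|. -/
theorem IsGenerator.exists_phase_eq {x : X} (hx : x ∈ U) {θ : ℂ} (hθ : ‖θ‖ = 1)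
    (h : (‖f x‖ : ℂ) * θ = f x) : ∃ (p : DivisorBlowUp N D) (hp : p.base ∈ U),
      p.base = x ∧ p.phase hf.toIsLocalEquation hp = θ := by
  by_cases hD : x ∈ D
  · obtain ⟨r, hr⟩ := exists_rayPhase_eq (hf.surjective_normalDifferential hx hD) hθ
    refine ⟨⟨x, fun _ => r⟩, hx, rfl, ?_⟩
    simp only [DivisorBlowUp.phase, dif_pos hD]
    exact hr
  · refine ⟨⟨x, fun h => absurd h hD⟩, hx, rfl, ?_⟩
    simp only [DivisorBlowUp.phase, dif_neg hD]
    have hfx : f x ≠ 0 := fun h => hD ((hf.mem_iff _ hx).2 h)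
    have hn : (‖f x‖ : ℂ) ≠ 0 := by exact_mod_cast norm_ne_zero_iff.2 hfx
    rw [div_eq_iff hn, mul_comm]
    exact h.symm

/-- The topology involves the phases of all local equations, but near p each of them is the phase of
the generator times a continuous function of the base point. One generator therefore decides
convergence. -/
theorem IsGenerator.tendsto_nhds {Z : Type*} {l : Filter Z} {F : Z → DivisorBlowUp N D}
    {p : DivisorBlowUp N D} (hp : p.base ∈ U)
    (h1 : Filter.Tendsto (fun z => (F z).base) l (𝓝 p.base))
    (h2 : Filter.Tendsto (fun z => (F z).extendedPhase hf.toIsLocalEquation) l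
      (𝓝 (p.phase hf.toIsLocalEquation hp))) : Filter.Tendsto F l (𝓝 p) := by
  have e : 𝓝 p = _ := nhds_inf
    (t₁ := TopologicalSpace.induced (DivisorBlowUp.base : DivisorBlowUp N D → X) inferInstance)
    (t₂ := TopologicalSpace.generateFrom
      {s | ∃ (U : Set X) (f : X → ℂ) (hf : IsLocalEquation N D U f) (V : Set ℂ),
        IsOpen V ∧ s = {p | ∃ hp : p.base ∈ U, p.phase hf hp ∈ V}}) (a := p)
  rw [e, Filter.tendsto_inf, nhds_induced, Filter.tendsto_comap_iff]
  refine ⟨h1, ?_⟩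
  rw [TopologicalSpace.tendsto_nhds_generateFrom_iff]
  rintro s ⟨V, g, hg, W, hW, rfl⟩ ⟨hpV, hpW⟩
  obtain ⟨u, hu, hfac⟩ := hf.phase_eq_mul hg
  have hUV : U ∩ V ∈ 𝓝 p.base := (hf.isOpen.inter hg.isOpen).mem_nhds ⟨hp, hpV⟩
  have h3 := ((hu.continuousAt hUV).tendsto.comp h1).mul h2
  rw [← hfac p hp hpV] at h3
  filter_upwards [h1 hUV, h3 (hW.mem_nhds hpW)] with z hz hzW
  refine ⟨hz.2, ?_⟩
  rw [hfac _ hz.1 hz.2]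
  have hzW' : u (F z).base * (F z).extendedPhase hf.toIsLocalEquation ∈ W := hzW
  rwa [DivisorBlowUp.extendedPhase_of_mem _ hz.1] at hzW'

end BlowUps

/-! ### Shrinking a coordinate -/

section Shrinking

/-- The complex number with the same phase as `z` and with absolute value `|z| - |t|`, or `0`. -/
def softThreshold (z : ℂ) (t : ℝ) : ℂ := ((max (‖z‖ - |t|) 0 / ‖z‖ : ℝ) : ℂ) * z

theorem softThreshold_factor_nonneg (z : ℂ) (t : ℝ) : 0 ≤ max (‖z‖ - |t|) 0 / ‖z‖ :=
  div_nonneg (le_max_right _ _) (norm_nonneg _)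

theorem norm_softThreshold_le (z : ℂ) (t : ℝ) : ‖softThreshold z t‖ ≤ ‖z‖ := by
  rw [softThreshold, norm_mul, Complex.norm_real,
    Real.norm_of_nonneg (softThreshold_factor_nonneg z t)]
  refine mul_le_of_le_one_left (norm_nonneg _) (div_le_one_of_le₀ ?_ (norm_nonneg _))
  exact max_le (by linarith [abs_nonneg t]) (norm_nonneg _)

@[simp] theorem softThreshold_zero_left (t : ℝ) : softThreshold 0 t = 0 := by
  simp [softThreshold]

@[simp] theorem softThreshold_zero_right (z : ℂ) : softThreshold z 0 = z := by
  rcases eq_or_ne z 0 with rfl | hz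
  · simp
  · simp [softThreshold, hz]

theorem softThreshold_eq_zero {z : ℂ} {t : ℝ} (h : ‖z‖ ≤ t) : softThreshold z t = 0 := by
  rw [softThreshold, max_eq_right (by linarith [le_abs_self t]), zero_div, Complex.ofReal_zero,
    zero_mul]

theorem continuous_softThreshold : Continuous fun c : ℂ × ℝ => softThreshold c.1 c.2 := by
  rw [continuous_iff_continuousAt]
  rintro ⟨z, t⟩
  rcases eq_or_ne z 0 with rfl | hz
  · unfold ContinuousAt
    simp only [softThreshold_zero_left]
    have : Filter.Tendsto (fun c : ℂ × ℝ => ‖c.1‖) (𝓝 ((0 : ℂ), t)) (𝓝 0) := by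
      have h : Continuous fun c : ℂ × ℝ => ‖c.1‖ := by fun_prop
      simpa using h.tendsto ((0 : ℂ), t)
    exact squeeze_zero_norm (fun c => norm_softThreshold_le c.1 c.2) this
  · have h1 : ContinuousAt (fun c : ℂ × ℝ => max (‖c.1‖ - |c.2|) 0 / ‖c.1‖) (z, t) :=
      ContinuousAt.div (by fun_prop) (by fun_prop) (norm_ne_zero_iff.2 hz)
    exact (Complex.continuous_ofReal.continuousAt.comp h1).mul continuousAt_fst

end Shrinking

/-! ### Holomorphic coordinates adapted to the divisor -/

section Charts

variable {N : ℕ} {X : Type u} [TopologicalSpace X] [ChartedSpace (Fin N → ℂ) X]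
  {I : Type v} {D : I → Set X}

/-- A homotopy `sh` of `X` supported in `W` which, in terms of the local equations `f i`,
shrinks the absolute value of `f k` and does not change the other `f i`. -/
structure IsEquationShrinking (f : I → X → ℂ) (k : I) (W : Set X) (sh : X × ℝ → X) : Prop where
  isOpen : IsOpen W
  continuousOn : ContinuousOn sh (W ×ˢ Set.univ)
  mem : ∀ y ∈ W, ∀ t, sh (y, t) ∈ W
  eq_self : ∀ y, y ∉ W → ∀ t, sh (y, t) = y
  zero : ∀ y, sh (y, 0) = y
  apply_self : ∀ y ∈ W, ∀ t, f k (sh (y, t)) = softThreshold (f k y) t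
  apply_other : ∀ i, i ≠ k → ∀ y ∈ W, ∀ t, f i (sh (y, t)) = f i y
  fix : ∀ y ∈ W, f k y = 0 → ∀ t, sh (y, t) = y

/-- A ball for the sup norm, centred at a point whose c-th coordinate is 0, is stable under
shrinking that coordinate. -/
theorem exists_coordinate_shrinking {φ : OpenPartialHomeomorph X (Fin N → ℂ)} {x : X}
    (hx : x ∈ φ.source) {c : Fin N} (hc : φ x c = 0) : ∃ W sh, x ∈ W ∧ W ⊆ φ.source ∧
      IsOpen W ∧ ContinuousOn sh (W ×ˢ Set.univ) ∧ (∀ y ∈ W, ∀ t : ℝ, sh (y, t) ∈ W) ∧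
      (∀ y, y ∉ W → ∀ t, sh (y, t) = y) ∧
      ∀ y ∈ W, ∀ t, φ (sh (y, t)) = Function.update (φ y) c (softThreshold (φ y c) t) := by
  classical
  obtain ⟨ε, hε, hball⟩ := Metric.isOpen_iff.1 φ.open_target _ (φ.map_source hx)
  let W : Set X := φ.source ∩ φ ⁻¹' Metric.ball (φ x) ε
  have hupd : ∀ y ∈ W, ∀ t : ℝ,
      Function.update (φ y) c (softThreshold (φ y c) t) ∈ Metric.ball (φ x) ε := by
    intro y hy t
    have h := (dist_pi_lt_iff hε).1 (Metric.mem_ball.1 hy.2)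
    refine Metric.mem_ball.2 ((dist_pi_lt_iff hε).2 fun i => ?_)
    rcases eq_or_ne i c with rfl | hi
    · rw [Function.update_self, hc, dist_zero_right]
      refine (norm_softThreshold_le _ _).trans_lt ?_
      simpa [hc] using h i
    · rw [Function.update_of_ne hi]
      exact h i
  let sh : X × ℝ → X := fun q =>
    if q.1 ∈ W then φ.symm (Function.update (φ q.1) c (softThreshold (φ q.1 c) q.2)) else q.1
  have hsh : ∀ y ∈ W, ∀ t,
      sh (y, t) = φ.symm (Function.update (φ y) c (softThreshold (φ y c) t)) := fun y hy t =>
    if_pos hy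
  have hφ : ∀ y ∈ W, ∀ t, φ (sh (y, t)) = Function.update (φ y) c (softThreshold (φ y c) t) := by
    intro y hy t
    rw [hsh y hy, φ.right_inv (hball (hupd y hy t))]
  refine ⟨W, sh, ⟨hx, Metric.mem_ball_self hε⟩, Set.inter_subset_left,
    φ.isOpen_inter_preimage Metric.isOpen_ball, ?_, ?_, fun y hy t => if_neg hy, hφ⟩
  · have h1 : ContinuousOn (fun q : X × ℝ => φ q.1) (W ×ˢ Set.univ) :=
      φ.continuousOn.comp continuousOn_fst fun q hq => hq.1.1
    have h2 : ContinuousOn (fun q : X × ℝ =>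
        Function.update (φ q.1) c (softThreshold (φ q.1 c) q.2)) (W ×ˢ Set.univ) := by
      have h4 : Continuous fun r : (Fin N → ℂ) × ℝ => (r.1 c, r.2) := by fun_prop
      have h5 : Continuous fun r : (Fin N → ℂ) × ℝ => softThreshold (r.1 c) r.2 :=
        continuous_softThreshold.comp h4
      have h3 : Continuous fun r : (Fin N → ℂ) × ℝ =>
          Function.update r.1 c (softThreshold (r.1 c) r.2) :=
        Continuous.update continuous_fst c h5
      have h6 : ContinuousOn (fun q : X × ℝ => (φ q.1, q.2)) (W ×ˢ Set.univ) :=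
        h1.prodMk continuousOn_snd
      have h7 := h3.comp_continuousOn h6
      exact h7
    exact (φ.continuousOn_symm.comp h2 fun q hq => hball (hupd q.1 hq.1 q.2)).congr
      fun q hq => hsh q.1 hq.1 q.2
  · intro y hy t
    refine ⟨?_, ?_⟩
    · rw [hsh y hy]
      exact φ.map_target (hball (hupd y hy t))
    · rw [Set.mem_preimage, hφ y hy]
      exact hupd y hy t

variable [IsManifold 𝓘(ℂ, Fin N → ℂ) ω X]

/-- The D i through x have coordinates as equations. The others do not meet the chart, and the
constant 1 serves for them. -/
theorem IsSNC.exists_generators (hD : IsSNC N D) (x : X) : ∃ (U : Set X) (f : I → X → ℂ), IsOpen U ∧ x ∈ U ∧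
    (∀ i, IsGenerator N (D i) U (f i)) ∧
    ∀ k, x ∈ D k → ∃ W sh, x ∈ W ∧ W ⊆ U ∧ IsEquationShrinking f k W sh := by
  classical
  obtain ⟨φ, hφ, hx, c, hc⟩ := hD x
  refine ⟨φ.source, fun i => if h : x ∈ D i then fun y => φ y (c ⟨i, h⟩) else fun _ => 1, φ.open_source,
    hx,
    fun i => ?_, fun k hk => ?_⟩
  · dsimp only
    split_ifs with h
    · refine isGenerator_coordinate hφ _ fun y hy => ?_
      rw [hc y hy i]
      exact ⟨fun ⟨_, h⟩ => h, fun h' => ⟨h, h'⟩⟩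
    · refine isGenerator_one φ.open_source fun y hy hyD => ?_
      exact h ((hc y hy i).1 hyD).1
  · have hck : φ x (c ⟨k, hk⟩) = 0 := ((hc x hx k).1 hk).2
    obtain ⟨W, sh, hxW, hWU, hWo, hcont, hmem, hself, hsh⟩ :=
      exists_coordinate_shrinking hx hck
    refine ⟨W, sh, hxW, hWU, hWo, hcont, hmem, hself, ?_, ?_, ?_, ?_⟩
    · intro y
      by_cases hy : y ∈ W
      · refine φ.injOn (hWU (hmem y hy 0)) (hWU hy) ?_
        rw [hsh y hy, softThreshold_zero_right, Function.update_eq_self]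
      · exact hself y hy 0
    · intro y hy t
      simp only [dif_pos hk, hsh y hy, Function.update_self]
    · intro i hi y hy t
      by_cases h : x ∈ D i
      -- Distinct components correspond to distinct coordinates, so shrinking the one of D k leaves
      -- the others alone.
      · have hne : c ⟨i, h⟩ ≠ c ⟨k, hk⟩ := fun e => hi (congrArg Subtype.val (c.injective e))
        simp only [dif_pos h, hsh y hy, Function.update_of_ne hne]
      · simp only [dif_neg h]
    · intro y hy h0 t
      simp only [dif_pos hk] at h0
      refine φ.injOn (hWU (hmem y hy t)) (hWU hy) ?_
      rw [hsh y hy, h0, softThreshold_zero_left, ← h0, Function.update_eq_self]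

theorem IsSNC.isClosed (hD : IsSNC N D) (i : I) : IsClosed (D i) := by
  rw [← isOpen_compl_iff, isOpen_iff_mem_nhds]
  intro x hx
  obtain ⟨φ, -, hxφ, c, hc⟩ := hD x
  filter_upwards [φ.open_source.mem_nhds hxφ] with y hy hyD
  exact hx ((hc y hy i).1 hyD).1

end Charts

/-! ### The real oriented blow-ups as a family of rays -/

section RayFamily

variable {N : ℕ} {X : Type u} [TopologicalSpace X] [ChartedSpace (Fin N → ℂ) X]
  {I : Type v} {D : I → Set X}

theorem DivisorBlowUp.eq_of_base_notMem {E : Set X} {p p' : DivisorBlowUp N E}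
    (h : p.base = p'.base) (hp : p.base ∉ E) : p = p' := by
  obtain ⟨x, r⟩ := p
  obtain ⟨x', r'⟩ := p'
  obtain rfl : x = x' := h
  congr 1
  funext hx
  exact absurd hx hp

/-- Phases lie on the compact circle. A limit θ of them along an ultrafilter still satisfies |f| θ =
f at the limit y of the base points, hence is the phase of a point over y. -/
theorem isProperMap_divisorBlowUp_base [T2Space X] {E : Set X}
    (h : ∀ x : X, ∃ U f, x ∈ U ∧ IsGenerator N E U f) :
    IsProperMap (DivisorBlowUp.base : DivisorBlowUp N E → X) := by
  rw [isProperMap_iff_ultrafilter_of_t2]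
  refine ⟨DivisorBlowUp.continuous_base E, fun 𝒰 y hy => ?_⟩
  obtain ⟨U, f, hyU, hf⟩ := h y
  have hU : ∀ᶠ p in (𝒰 : Filter (DivisorBlowUp N E)), p.base ∈ U :=
    hy.eventually (hf.isOpen.mem_nhds hyU)
  obtain ⟨θ, hθ, hlim⟩ := (isCompact_sphere (0 : ℂ) 1).ultrafilter_le_nhds
    (𝒰.map fun p => p.extendedPhase hf.toIsLocalEquation) (by
      rw [Filter.le_principal_iff, Ultrafilter.mem_coe, Ultrafilter.mem_map]
      filter_upwards [hU] with p hp
      rw [Set.mem_preimage, DivisorBlowUp.extendedPhase_of_mem _ hp, mem_sphere_zero_iff_norm]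
      exact hf.norm_phase p hp)
  have hfc : Filter.Tendsto (fun p : DivisorBlowUp N E => f p.base) 𝒰 (𝓝 (f y)) :=
    (hf.holomorphic.continuousOn.continuousAt (hf.isOpen.mem_nhds hyU)).tendsto.comp hy
  have h1 : Filter.Tendsto (fun p : DivisorBlowUp N E => (‖f p.base‖ : ℂ) *
      p.extendedPhase hf.toIsLocalEquation) 𝒰 (𝓝 ((‖f y‖ : ℂ) * θ)) :=
    ((Complex.continuous_ofReal.tendsto _).comp hfc.norm).mul hlim
  have h2 : (‖f y‖ : ℂ) * θ = f y := by
    refine tendsto_nhds_unique (h1.congr' ?_) hfc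
    filter_upwards [hU] with p hp
    rw [DivisorBlowUp.extendedPhase_of_mem _ hp, hf.norm_mul_phase]
  obtain ⟨p, hp, rfl, rfl⟩ := hf.exists_phase_eq hyU (mem_sphere_zero_iff_norm.1 hθ) h2
  exact ⟨p, hf.tendsto_nhds (F := id) hp hy hlim⟩

theorem surjective_divisorBlowUp_base {E : Set X}
    (h : ∀ x : X, ∃ U f, x ∈ U ∧ IsGenerator N E U f) :
    Function.Surjective (DivisorBlowUp.base : DivisorBlowUp N E → X) := by
  intro x
  obtain ⟨U, f, hxU, hf⟩ := h x
  rcases eq_or_ne (f x) 0 with h0 | h0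
  · obtain ⟨p, -, hp, -⟩ := hf.exists_phase_eq hxU (θ := 1) (by simp) (by simp [h0])
    exact ⟨p, hp⟩
  · obtain ⟨p, -, hp, -⟩ := hf.exists_phase_eq hxU (norm_div_norm h0) (norm_mul_div_norm _)
    exact ⟨p, hp⟩

theorem IsGenerator.norm_extendedPhase_le {E U : Set X} {f : X → ℂ} (hf : IsGenerator N E U f)
    (p : DivisorBlowUp N E) : ‖p.extendedPhase hf.toIsLocalEquation‖ ≤ 1 := by
  unfold DivisorBlowUp.extendedPhase
  split_ifs with hp
  · exact (hf.norm_phase p hp).le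
  · simp

/-- The extended phase is bounded by 1 and can be discontinuous only outside U, where the cutoff
vanishes. -/
theorem IsGenerator.continuous_mul_extendedPhase {E U : Set X} {f : X → ℂ}
    (hf : IsGenerator N E U f) (χ : C(X, ℝ)) (hχ : ∀ x ∉ U, χ x = 0) :
    Continuous fun p : DivisorBlowUp N E =>
      (χ p.base : ℂ) * p.extendedPhase hf.toIsLocalEquation := by
  have hb := DivisorBlowUp.continuous_base (N := N) E
  rw [continuous_iff_continuousAt]
  intro p
  by_cases hp : p.base ∈ U
  · refine ContinuousAt.mul (by fun_prop) ?_
    exact (DivisorBlowUp.continuousOn_extendedPhase hf.toIsLocalEquation).continuousAt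
      ((hf.isOpen.preimage hb).mem_nhds hp)
  · unfold ContinuousAt
    simp only [hχ _ hp, Complex.ofReal_zero, zero_mul]
    have h1 : Filter.Tendsto (fun q : DivisorBlowUp N E => ‖χ q.base‖) (𝓝 p) (𝓝 0) := by
      have h : Continuous fun q : DivisorBlowUp N E => ‖χ q.base‖ := by fun_prop
      simpa [hχ _ hp] using h.tendsto p
    refine squeeze_zero_norm (fun q => ?_) h1
    rw [norm_mul, Complex.norm_real]
    exact mul_le_of_le_one_right (norm_nonneg _) (hf.norm_extendedPhase_le q)

variable [IsManifold 𝓘(ℂ, Fin N → ℂ) ω X]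

/-- The vector space is the product of one copy of ℂ for each point a of X, and the a-th coordinate
is the phase of the equation near a, cut off away from a. The product topology requires no local
finiteness. -/
theorem IsSNC.exists_isRayFamily [T2Space X] [_root_.NormalSpace X] (hD : IsSNC N D) :
    ∃ w : ∀ i, DivisorBlowUp N (D i) → X → ℂ,
      IsRayFamily D (fun _ => DivisorBlowUp.base) w := by
  choose U f hUo hxU hf _ using hD.exists_generators
  have hχ : ∀ x, ∃ χ : C(X, ℝ), (∀ y ∉ U x, χ y = 0) ∧ χ x = 1 := by
    intro x
    obtain ⟨χ, h0, h1, -⟩ := exists_continuous_zero_one_of_isClosed (hUo x).isClosed_compl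
      (isClosed_singleton (x := x)) (Set.disjoint_singleton_right.2 fun h => h (hxU x))
    exact ⟨χ, fun y hy => h0 hy, h1 rfl⟩
  choose χ hχ0 hχ1 using hχ
  have hgen : ∀ i, ∀ x : X, ∃ U f, x ∈ U ∧ IsGenerator N (D i) U f := fun i x =>
    ⟨_, _, hxU x, hf x i⟩
  refine ⟨fun i p a => (χ a p.base : ℂ) * p.extendedPhase (hf a i).toIsLocalEquation,
    hD.isClosed, fun i => isProperMap_divisorBlowUp_base (hgen i),
    fun i => surjective_divisorBlowUp_base (hgen i),
    fun i p p' h hp => DivisorBlowUp.eq_of_base_notMem h hp, fun i => ?_, ?_⟩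
  · exact continuous_pi fun a => (hf a i).continuous_mul_extendedPhase (χ a) (hχ0 a)
  · intro i p p' a b ha hb h e
    have hp : p.base ∈ U p.base := hxU _
    have hp' : p'.base ∈ U p.base := by rw [← h]; exact hp
    -- At the coordinate indexed by the base point itself the cutoff is 1, so the equation compares
    -- multiples of two unit phases: norms give a = b, and then the phases agree unless a = 0.
    have e1 := congrFun e p.base
    simp only [Pi.smul_apply, ← h, hχ1, Complex.ofReal_one, one_mul,
      DivisorBlowUp.extendedPhase_of_mem _ hp, DivisorBlowUp.extendedPhase_of_mem _ hp',
      Complex.real_smul] at e1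
    have e2 := congrArg norm e1
    rw [norm_mul, norm_mul, (hf _ i).norm_phase, (hf _ i).norm_phase, mul_one, mul_one,
      Complex.norm_real, Complex.norm_real, Real.norm_of_nonneg ha, Real.norm_of_nonneg hb] at e2
    subst e2
    refine ⟨rfl, or_iff_not_imp_left.2 fun ha0 => (hf _ i).ext hp hp' h ?_⟩
    exact mul_left_cancel₀ (by exact_mod_cast ha0) e1

open Classical in
/-- The point of the blow-up over `x` with the same phase as `p`, if there is one. -/
def DivisorBlowUp.transport {E U : Set X} {f : X → ℂ} (hf : IsLocalEquation N E U f) (x : X)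
    (p : DivisorBlowUp N E) : DivisorBlowUp N E :=
  if h : ∃ (q : DivisorBlowUp N E) (_ : q.base ∈ U), q.base = x ∧
      q.extendedPhase hf = p.extendedPhase hf then h.choose else p

/-- Shrinking |f k| multiplies every f i by a nonnegative real number, so a point of a blow-up can
follow the homotopy with unchanged phase. The hitting time is ρ = |f k|. -/
theorem IsSNC.exists_isLocalShrinking (hD : IsSNC N D) (k : I) (x : X) :
    ∃ U sh L ρ, x ∈ U ∧ IsLocalShrinking D
      (fun i => (DivisorBlowUp.base : DivisorBlowUp N (D i) → X)) k U sh L ρ := by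
  classical
  by_cases hx : x ∈ D k
  · obtain ⟨U, f, -, hxU, hf, hs⟩ := hD.exists_generators x
    obtain ⟨W, sh, hxW, hWU, h⟩ := hs k hx
    have hscale : ∀ i, ∀ y ∈ W, ∀ t, ∃ a : ℝ, 0 ≤ a ∧ f i (sh (y, t)) = a * f i y := by
      intro i y hy t
      rcases eq_or_ne i k with rfl | hi
      · exact ⟨_, softThreshold_factor_nonneg (f i y) t, h.apply_self y hy t⟩
      · exact ⟨1, zero_le_one, by rw [h.apply_other i hi y hy, Complex.ofReal_one, one_mul]⟩
    have htr : ∀ i (p : DivisorBlowUp N (D i)), p.base ∈ W → ∀ t,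
        (p.transport (hf i).toIsLocalEquation (sh (p.base, t))).base = sh (p.base, t) ∧
        (p.transport (hf i).toIsLocalEquation (sh (p.base, t))).extendedPhase
          (hf i).toIsLocalEquation = p.extendedPhase (hf i).toIsLocalEquation := by
      intro i p hp t
      have hpU := hWU hp
      obtain ⟨a, ha, hfa⟩ := hscale i p.base hp t
      obtain ⟨q, hq, hqb, hqp⟩ := (hf i).exists_phase_eq (hWU (h.mem _ hp t))
        ((hf i).norm_phase p hpU) (by
          rw [hfa, norm_mul, Complex.norm_real, Real.norm_of_nonneg ha, Complex.ofReal_mul,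
            mul_assoc, (hf i).norm_mul_phase])
      have hex : ∃ (q : DivisorBlowUp N (D i)) (_ : q.base ∈ U), q.base = sh (p.base, t) ∧
          q.extendedPhase (hf i).toIsLocalEquation =
            p.extendedPhase (hf i).toIsLocalEquation :=
        ⟨q, hq, hqb, by rw [DivisorBlowUp.extendedPhase_of_mem _ hq,
          DivisorBlowUp.extendedPhase_of_mem _ hpU, hqp]⟩
      rw [DivisorBlowUp.transport, dif_pos hex]
      exact hex.choose_spec.2
    let L : ∀ i, DivisorBlowUp N (D i) × ℝ → DivisorBlowUp N (D i) := fun i c =>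
      if c.1.base ∈ W then c.1.transport (hf i).toIsLocalEquation (sh (c.1.base, c.2)) else c.1
    have hLb : ∀ i p t, (L i (p, t)).base = sh (p.base, t) := by
      intro i p t
      by_cases hp : p.base ∈ W
      · simp only [L, if_pos hp]
        exact (htr i p hp t).1
      · simp only [L, if_neg hp]
        exact (h.eq_self _ hp t).symm
    have hLp : ∀ i p t, p.base ∈ W → (L i (p, t)).extendedPhase (hf i).toIsLocalEquation =
        p.extendedPhase (hf i).toIsLocalEquation := by
      intro i p t hp
      simp only [L, if_pos hp]
      exact (htr i p hp t).2
    have hLfix : ∀ i p t, sh (p.base, t) = p.base → L i (p, t) = p := by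
      intro i p t hp
      by_cases hpW : p.base ∈ W
      · have hb := hLb i p t
        rw [hp] at hb
        have hpU := hWU hpW
        have hLU : (L i (p, t)).base ∈ U := by rw [hb]; exact hpU
        refine (hf i).ext hLU hpU hb ?_
        rw [← DivisorBlowUp.extendedPhase_of_mem _ hLU, ← DivisorBlowUp.extendedPhase_of_mem _ hpU]
        exact hLp i p t hpW
      · exact if_neg hpW
    have hfix : ∀ y ∈ D k, ∀ t, sh (y, t) = y := by
      intro y hy t
      by_cases hyW : y ∈ W
      · exact h.fix y hyW (((hf k).mem_iff y (hWU hyW)).1 hy) t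
      · exact h.eq_self y hyW t
    refine ⟨W, sh, L, fun y => ‖f k y‖, hxW, h.isOpen, hLb, h.zero,
      fun i p => hLfix i p 0 (h.zero _), hfix, fun i p hp t => hLfix i p t (hfix _ hp t), ?_,
      h.continuousOn, ?_, ?_, fun y => norm_nonneg _, ?_, ?_⟩
    · intro i y hy t
      by_cases hyW : y ∈ W
      · obtain ⟨a, -, ha⟩ := hscale i y hyW t
        refine ((hf i).mem_iff _ (hWU (h.mem y hyW t))).2 ?_
        rw [ha, ((hf i).mem_iff _ (hWU hyW)).1 hy, mul_zero]
      · rwa [h.eq_self y hyW]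
    · rintro i ⟨p, t⟩ ⟨hp, -⟩
      refine ContinuousAt.continuousWithinAt ?_
      have hLU : (L i (p, t)).base ∈ U := by rw [hLb]; exact hWU (h.mem _ hp t)
      have hb := DivisorBlowUp.continuous_base (N := N) (D i)
      have hW : ∀ᶠ q : DivisorBlowUp N (D i) × ℝ in 𝓝 (p, t), q.1.base ∈ W :=
        (h.isOpen.preimage (hb.comp continuous_fst)).mem_nhds hp
      refine (hf i).tendsto_nhds hLU ?_ ?_
      · simp only [hLb]
        have h1 : ContinuousAt sh (p.base, t) :=
          h.continuousOn.continuousAt ((h.isOpen.prod isOpen_univ).mem_nhds ⟨hp, trivial⟩)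
        have h2 : Continuous fun q : DivisorBlowUp N (D i) × ℝ => (q.1.base, q.2) := by fun_prop
        exact h1.tendsto.comp (h2.tendsto (p, t))
      · rw [← DivisorBlowUp.extendedPhase_of_mem _ hLU, hLp i p t hp]
        have h1 : ContinuousAt (DivisorBlowUp.extendedPhase (hf i).toIsLocalEquation) p :=
          (DivisorBlowUp.continuousOn_extendedPhase _).continuousAt
            (((hf i).isOpen.preimage hb).mem_nhds (hWU hp))
        have h2 := h1.tendsto.comp
          ((continuous_fst (X := DivisorBlowUp N (D i)) (Y := ℝ)).tendsto (p, t))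
        refine h2.congr' ?_
        filter_upwards [hW] with q hq
        exact (hLp i q.1 q.2 hq).symm
    · exact ((hf k).holomorphic.continuousOn.mono hWU).norm
    · intro y hy hyW
      rw [((hf k).mem_iff y (hWU hyW)).1 hy, norm_zero]
    · intro y hy t _ ht
      refine ((hf k).mem_iff _ (hWU (h.mem y hy t))).2 ?_
      rw [h.apply_self y hy, softThreshold_eq_zero ht.le]
  -- Away from D k nothing moves. With ρ = 1 no time t ≤ 1 exceeds ρ, so the requirement to reach D
  -- k is void.
  · refine ⟨(D k)ᶜ, Prod.fst, fun i => Prod.fst, fun _ => 1, hx, (hD.isClosed k).isOpen_compl,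
      fun _ _ _ => rfl, fun _ => rfl, fun _ _ => rfl, fun _ _ _ => rfl, fun _ _ _ _ => rfl,
      fun _ _ h _ => h, continuousOn_fst, fun _ => continuousOn_fst, continuousOn_const,
      fun _ => zero_le_one, fun y hy h => absurd hy h, fun y _ t h1 h2 => absurd h2 (not_lt.2 h1)⟩

end RayFamily

/-! ### The torus bundles -/

section TorusBundles

variable {N : ℕ} {X : Type u} [TopologicalSpace X] [ChartedSpace (Fin N → ℂ) X]

open Classical in
/-- The phase of a local equation, as an element of the circle. -/
def IsGenerator.circlePhase {E U : Set X} {f : X → ℂ} (hf : IsGenerator N E U f)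
    (p : DivisorBlowUp N E) : Circle :=
  if hp : p.base ∈ U then
    (⟨p.phase hf.toIsLocalEquation hp, show _ ∈ Submonoid.unitSphere ℂ from
      mem_sphere_zero_iff_norm.2 (hf.norm_phase p hp)⟩ : Submonoid.unitSphere ℂ)
  else 1

theorem IsGenerator.coe_circlePhase {E U : Set X} {f : X → ℂ} (hf : IsGenerator N E U f)
    {p : DivisorBlowUp N E} (hp : p.base ∈ U) :
    (hf.circlePhase p : ℂ) = p.extendedPhase hf.toIsLocalEquation := by
  rw [DivisorBlowUp.extendedPhase_of_mem _ hp]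
  exact congrArg (fun z : Circle => (z : ℂ)) (dif_pos hp)

theorem IsGenerator.continuousOn_circlePhase {E U : Set X} {f : X → ℂ}
    (hf : IsGenerator N E U f) : ContinuousOn hf.circlePhase (DivisorBlowUp.base ⁻¹' U) := by
  have hv : IsInducing fun z : Circle => (z : ℂ) := ⟨rfl⟩
  rw [hv.continuousOn_iff]
  exact (DivisorBlowUp.continuousOn_extendedPhase hf.toIsLocalEquation).congr
    fun p hp => hf.coe_circlePhase hp

/-- Over U ∩ E the phase is free, so the point is unique there. Elsewhere any point over x is
allowed, which makes the inverse trivialization below a total function. -/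
theorem IsGenerator.exists_circlePhase_eq {E U : Set X} {f : X → ℂ} (hf : IsGenerator N E U f)
    (hs : Function.Surjective (DivisorBlowUp.base : DivisorBlowUp N E → X)) (x : X) (θ : Circle) :
    ∃ p : DivisorBlowUp N E, p.base = x ∧ (x ∈ U → x ∈ E → hf.circlePhase p = θ) := by
  by_cases hx : x ∈ U ∧ x ∈ E
  · obtain ⟨p, hp, rfl, hpθ⟩ := hf.exists_phase_eq hx.1 (θ := θ) (Circle.norm_coe θ)
      (by simp [(hf.mem_iff x hx.1).1 hx.2])
    refine ⟨p, rfl, fun _ _ => Circle.ext ?_⟩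
    rw [hf.coe_circlePhase hp, DivisorBlowUp.extendedPhase_of_mem _ hp, hpθ]
  · obtain ⟨p, hp⟩ := hs x
    exact ⟨p, hp, fun h1 h2 => absurd ⟨h1, h2⟩ hx⟩

variable {I : Type v} {D : I → Set X} [IsManifold 𝓘(ℂ, Fin N → ℂ) ω X]

/-- Over the domain of the generators f i, the phases of the f i with i ∈ B \ A give the
trivialization: base points lie in the stratum of B, hence in these D i, where the phases are
unconstrained. -/
theorem IsSNC.isTorusBundle (hD : IsSNC N D) {A B : Set I} (hA : A ⊆ B) :
    IsTorusBundle (B \ A : Set I) (Piece.toBlowUp (N := N) (D := D) hA subset_rfl) := by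
  classical
  intro b
  obtain ⟨U, f, hUo, hxU, hf, -⟩ := hD.exists_generators b.base
  have hs : ∀ i, Function.Surjective (DivisorBlowUp.base : DivisorBlowUp N (D i) → X) := fun i =>
    surjective_divisorBlowUp_base fun x => by
      obtain ⟨U, f, -, hxU, hf, -⟩ := hD.exists_generators x
      exact ⟨U, f i, hxU, hf i⟩
  choose ray hray1 hray2 using fun i => (hf i).exists_circlePhase_eq (hs i)
  let pt : StratumBlowUp N D B × ((B \ A : Set I) → Circle) →
      (i : {i // i ∉ A}) → DivisorBlowUp N (D i) := fun q i =>
    if h : i.1 ∈ B then ray i q.1.base (q.2 ⟨i, Set.mem_sdiff_of_mem h i.2⟩) else q.1.1.2 ⟨i, h⟩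
  have hpt : ∀ q i, (pt q i).base = q.1.base := by
    intro q i
    by_cases h : i.1 ∈ B
    · simp only [pt, dif_pos h, hray1]
    · simp only [pt, dif_neg h]
      exact q.1.2.2 _
  let inv : StratumBlowUp N D B × ((B \ A : Set I) → Circle) → Piece N D A B := fun q =>
    ⟨⟨(q.1.base, pt q), fun j hj => q.1.2.1 j (hA hj), hpt q⟩, q.1.2.1⟩
  let proj : Piece N D A B → StratumBlowUp N D B := Piece.toBlowUp hA subset_rfl
  have hproj : Continuous proj := Piece.continuous_toBlowUp hA subset_rfl
  have hbase : ∀ p, (proj p).base = p.1.base := fun _ => rfl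
  let src : Set (StratumBlowUp N D B) := {q | q.base ∈ U}
  have hsrc : IsOpen src := hUo.preimage StratumBlowUp.continuous_base
  have hiv : IsInducing fun p : Piece N D A B => p.1.1 :=
    (⟨rfl⟩ : IsInducing (Subtype.val : StratumBlowUp N D A → _)).comp
      (⟨rfl⟩ : IsInducing (Subtype.val : Piece N D A B → _))
  let e : OpenPartialHomeomorph (Piece N D A B)
      (StratumBlowUp N D B × ((B \ A : Set I) → Circle)) :=
    { toFun := fun p => (proj p, fun i => (hf i).circlePhase (p.1.1.2 ⟨i, i.2.2⟩))
      invFun := inv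
      source := {p | p.1.base ∈ U}
      target := src ×ˢ Set.univ
      map_source' := fun p hp => ⟨hp, trivial⟩
      map_target' := fun q hq => hq.1
      left_inv' := by
        intro p hp
        refine Subtype.ext (Subtype.ext (Prod.ext rfl (funext fun i => ?_)))
        change pt _ i = p.1.1.2 i
        by_cases h : i.1 ∈ B
        · simp only [pt, dif_pos h, hbase]
          have hb : (p.1.1.2 i).base = p.1.base := p.1.2.2 i
          have hpU : p.1.base ∈ U := hp
          have h1 : (p.1.1.2 i).base ∈ U := by rw [hb]; exact hp
          have h2 : (ray i p.1.base ((hf i).circlePhase (p.1.1.2 i))).base ∈ U := by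
            rw [hray1]; exact hp
          refine (hf i).ext h2 h1 (by rw [hray1, hb]) ?_
          rw [← DivisorBlowUp.extendedPhase_of_mem _ h1, ← DivisorBlowUp.extendedPhase_of_mem _ h2,
            ← (hf i).coe_circlePhase h1, ← (hf i).coe_circlePhase h2, hray2 i _ _ hp (p.2 i h)]
        · simp only [pt, dif_neg h]
          rfl
      right_inv' := by
        rintro q ⟨hq, -⟩
        refine Prod.ext (Subtype.ext (Prod.ext rfl (funext fun i => ?_))) (funext fun i => ?_)
        · change pt q ⟨i, _⟩ = _
          simp only [pt, dif_neg i.2]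
        · change (hf i).circlePhase (pt q ⟨i, _⟩) = _
          simp only [pt, dif_pos i.2.1]
          exact hray2 i _ _ hq (q.1.2.1 i i.2.1)
      open_source := hsrc.preimage hproj
      open_target := hsrc.prod isOpen_univ
      continuousOn_toFun := by
        refine hproj.continuousOn.prodMk (continuousOn_pi.2 fun i => ?_)
        have h1 : Continuous fun p : Piece N D A B => p.1.1.2 ⟨i, i.2.2⟩ := by
          have := hiv.continuous
          fun_prop
        refine (hf i).continuousOn_circlePhase.comp h1.continuousOn fun p hp => ?_
        rw [Set.mem_preimage, p.1.2.2]
        exact hp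
      continuousOn_invFun := by
        rw [hiv.continuousOn_iff]
        have hb : Continuous fun q : StratumBlowUp N D B × ((B \ A : Set I) → Circle) =>
            q.1.base := StratumBlowUp.continuous_base.comp continuous_fst
        refine hb.continuousOn.prodMk (continuousOn_pi.2 fun i => ?_)
        by_cases h : i.1 ∈ B
        · rintro q ⟨hq, -⟩
          refine ContinuousAt.continuousWithinAt ?_
          have hpU : (pt q i).base ∈ U := by rw [hpt]; exact hq
          refine (hf i).tendsto_nhds hpU ?_ ?_
          · simp only [hpt]
            exact hb.tendsto q
          · have hph : ∀ z, z.1.base ∈ U → (pt z i).extendedPhase (hf i).toIsLocalEquation =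
                z.2 ⟨i, Set.mem_sdiff_of_mem h i.2⟩ := by
              intro z hz
              rw [← (hf i).coe_circlePhase (by rw [hpt]; exact hz)]
              simp only [pt, dif_pos h]
              rw [hray2 i _ _ hz (z.1.2.1 i h)]
            rw [← DivisorBlowUp.extendedPhase_of_mem, hph q hq]
            have h3 : Continuous fun z : StratumBlowUp N D B × ((B \ A : Set I) → Circle) =>
                ((z.2 ⟨i, Set.mem_sdiff_of_mem h i.2⟩ : Circle) : ℂ) := by fun_prop
            refine (h3.tendsto q).congr' ?_
            filter_upwards [(hUo.preimage hb).mem_nhds hq] with z hz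
            exact (hph z hz).symm
        · have h1 : Continuous fun q : StratumBlowUp N D B × ((B \ A : Set I) → Circle) =>
              q.1.1.2 ⟨i, h⟩ := by
            have : Continuous fun q : StratumBlowUp N D B => q.1 := continuous_subtype_val
            fun_prop
          refine h1.continuousOn.congr fun q _ => ?_
          change pt q i = _
          simp only [pt, dif_neg h] }
  exact ⟨⟨e, src, hsrc, rfl, rfl, fun _ _ => rfl⟩, hxU⟩

end TorusBundles

/-! ### Positive combinations of indicator functions of chains of subsets -/

section ChainWeights

variable {α : Type*}

open Classical in
/-- The value at `a` of the combination of the indicator functions of the `S l` with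
coefficients `w l`. -/
def chainWeight {n : ℕ} (S : Fin n → Set α) (w : Fin n → ℝ) (a : α) : ℝ :=
  ∑ l, if a ∈ S l then w l else 0

variable {n : ℕ} {S : Fin (n + 1) → Set α} {w : Fin (n + 1) → ℝ}

theorem chainWeight_of_mem_iff {a : α} {j : Fin (n + 1)} (h : ∀ l, a ∈ S l ↔ j ≤ l) :
    chainWeight S w a = ∑ l, if j ≤ l then w l else 0 := by
  simp only [chainWeight, h]

theorem chainWeight_nonneg (hw : ∀ l, 0 ≤ w l) (a : α) : 0 ≤ chainWeight S w a :=
  Finset.sum_nonneg fun l _ => by split_ifs <;> simp [hw]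

theorem chainWeight_le (hw : ∀ l, 0 ≤ w l) (a : α) : chainWeight S w a ≤ ∑ l, w l :=
  Finset.sum_le_sum fun l _ => by split_ifs <;> simp [hw]

/-- The chain grows strictly, so some element enters it exactly at step j. -/
theorem exists_mem_iff_le (hS : StrictMono S) (h0 : (S 0).Nonempty) (j : Fin (n + 1)) :
    ∃ a, ∀ l, a ∈ S l ↔ j ≤ l := by
  induction j using Fin.cases with
  | zero =>
    obtain ⟨a, ha⟩ := h0
    exact ⟨a, fun l => ⟨fun _ => Fin.zero_le l, fun _ => hS.monotone (Fin.zero_le l) ha⟩⟩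
  | succ i =>
    obtain ⟨a, ha, ha'⟩ := Set.exists_of_ssubset (hS (Fin.castSucc_lt_succ (i := i)))
    refine ⟨a, fun l => ⟨fun hl => ?_, fun hl => hS.monotone hl ha⟩⟩
    rw [← Fin.castSucc_lt_iff_succ_le]
    by_contra hle
    exact ha' (hS.monotone (not_lt.1 hle) hl)

theorem exists_mem_iff_le_of_mem (hS : StrictMono S) {a : α} {l : Fin (n + 1)} (hl : a ∈ S l) :
    ∃ j, ∀ l, a ∈ S l ↔ j ≤ l := by
  classical
  have hne : (Finset.univ.filter fun l => a ∈ S l).Nonempty := ⟨l, by simpa using hl⟩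
  refine ⟨Finset.min' _ hne, fun l => ⟨fun h => Finset.min'_le _ _ (by simpa using h), fun h => ?_⟩⟩
  have := Finset.min'_mem _ hne
  exact hS.monotone h (by simpa using this)

theorem strictAnti_tail (hw : ∀ l, 0 < w l) :
    StrictAnti fun j : Fin (n + 1) => ∑ l, if j ≤ l then w l else 0 := by
  intro i j hij
  refine Finset.sum_lt_sum (fun l _ => ?_) ⟨i, Finset.mem_univ _, ?_⟩
  · by_cases h : j ≤ l
    · rw [if_pos h, if_pos (hij.le.trans h)]
    · rw [if_neg h]
      split_ifs
      · exact (hw l).le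
      · exact le_rfl
  · rw [if_neg (not_le.2 hij), if_pos le_rfl]
    exact hw i

theorem tail_pos (hw : ∀ l, 0 < w l) (j : Fin (n + 1)) :
    0 < ∑ l, if j ≤ l then w l else 0 := by
  refine Finset.sum_pos' (fun l _ => ?_) ⟨j, Finset.mem_univ _, ?_⟩
  · split_ifs
    · exact (hw l).le
    · exact le_rfl
  · rw [if_pos le_rfl]
    exact hw j

theorem range_tail (hS : StrictMono S) (h0 : (S 0).Nonempty) (hw : ∀ l, 0 < w l) :
    Set.range (fun j : Fin (n + 1) => ∑ l, if j ≤ l then w l else 0) =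
      {r | ∃ a, chainWeight S w a = r ∧ 0 < r} := by
  ext r
  constructor
  · rintro ⟨j, rfl⟩
    obtain ⟨a, ha⟩ := exists_mem_iff_le hS h0 j
    exact ⟨a, chainWeight_of_mem_iff ha, tail_pos hw j⟩
  · rintro ⟨a, rfl, hr⟩
    obtain ⟨l, -, hl⟩ := Finset.exists_ne_zero_of_sum_ne_zero hr.ne'
    have hl' : a ∈ S l := by
      by_contra h
      simp [h] at hl
    obtain ⟨j, hj⟩ := exists_mem_iff_le_of_mem hS hl'
    exact ⟨j, (chainWeight_of_mem_iff hj).symm⟩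

theorem mem_iff_tail_le (hS : StrictMono S) (hw : ∀ l, 0 < w l) (a : α) (j : Fin (n + 1)) :
    a ∈ S j ↔ (∑ l, if j ≤ l then w l else 0) ≤ chainWeight S w a := by
  constructor
  · intro ha
    refine Finset.sum_le_sum fun l _ => ?_
    by_cases h : j ≤ l
    · rw [if_pos h, if_pos (hS.monotone h ha)]
    · rw [if_neg h]
      split_ifs
      · exact (hw l).le
      · exact le_rfl
  · contrapose!
    intro ha
    refine Finset.sum_lt_sum (fun l _ => ?_) ⟨j, Finset.mem_univ _, ?_⟩
    · by_cases h : a ∈ S l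
      · rw [if_pos h, if_pos]
        by_contra hle
        exact ha (hS.monotone (not_le.1 hle).le h)
      · rw [if_neg h]
        split_ifs
        · exact (hw l).le
        · exact le_rfl
    · rw [if_neg ha, if_pos le_rfl]
      exact hw j

theorem eq_of_tail_eq {w' : Fin (n + 1) → ℝ} (h : ∀ j : Fin (n + 1),
    (∑ l, if j ≤ l then w l else 0) = ∑ l, if j ≤ l then w' l else 0) : w = w' := by
  have split : ∀ (v : Fin (n + 1) → ℝ) (j : Fin (n + 1)),
      (∑ l, if j ≤ l then v l else 0) = v j + ∑ l, if j < l then v l else 0 := by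
    intro v j
    have : ∀ l, (if j ≤ l then v l else 0) =
        (if l = j then v l else 0) + if j < l then v l else 0 := by
      intro l
      rcases lt_trichotomy j l with h | rfl | h
      · simp [h, h.le, h.ne']
      · simp
      · simp [h.not_ge, h.not_gt, h.ne]
    simp only [this, Finset.sum_add_distrib]
    simp
  funext j
  have hj := h j
  rw [split, split] at hj
  induction j using Fin.lastCases with
  | last =>
    have : ∀ l : Fin (n + 1), ¬ Fin.last n < l := fun l => not_lt.2 (Fin.le_last l)
    simpa [this] using hj
  | cast i =>
    have e := h i.succ
    simp only [Fin.castSucc_lt_iff_succ_le] at hj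
    linarith

/-- The positive values of the function are the tail sums of the coefficients, which are strictly
decreasing. Their number gives n, their successive differences give the coefficients, and the sets
are the superlevel sets. A first set that is empty would leave no trace, hence the nonemptiness. -/
theorem chain_unique {m : ℕ} {S' : Fin (m + 1) → Set α} {w' : Fin (m + 1) → ℝ}
    (hS : StrictMono S) (h0 : (S 0).Nonempty) (hw : ∀ l, 0 < w l)
    (hS' : StrictMono S') (h0' : (S' 0).Nonempty) (hw' : ∀ l, 0 < w' l)
    (h : ∀ a, chainWeight S w a = chainWeight S' w' a) :
    (⟨n, S, w⟩ : Σ n : ℕ, (Fin (n + 1) → Set α) × (Fin (n + 1) → ℝ)) = ⟨m, S', w'⟩ := by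
  have hr : Set.range (fun j : Fin (n + 1) => ∑ l, if j ≤ l then w l else 0) =
      Set.range (fun j : Fin (m + 1) => ∑ l, if j ≤ l then w' l else 0) := by
    rw [range_tail hS h0 hw, range_tail hS' h0' hw']
    simp only [h]
  obtain rfl : n = m := by
    have e := congrArg Set.ncard hr
    rw [Set.ncard_range_of_injective (strictAnti_tail hw).injective,
      Set.ncard_range_of_injective (strictAnti_tail hw').injective] at e
    simpa using e
  have ht : (fun j : Fin (n + 1) => -∑ l, if j ≤ l then w l else 0) =
      fun j : Fin (n + 1) => -∑ l, if j ≤ l then w' l else 0 := by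
    -- Strictly increasing maps with equal ranges coincide; the tails decrease, hence the signs.
    refine (StrictMono.range_inj (fun i j hij => neg_lt_neg (strictAnti_tail hw hij))
      (fun i j hij => neg_lt_neg (strictAnti_tail hw' hij))).1 ?_
    have e := congrArg (fun s : Set ℝ => (fun r => -r) '' s) hr
    simp only [← Set.range_comp] at e
    exact e
  have ht' : ∀ j : Fin (n + 1), (∑ l, if j ≤ l then w l else 0) = ∑ l, if j ≤ l then w' l else 0 :=
    fun j => neg_injective (congrFun ht j)
  obtain rfl := eq_of_tail_eq ht'
  obtain rfl : S = S' := by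
    funext j
    ext a
    rw [mem_iff_tail_le hS hw, mem_iff_tail_le hS' hw', h]
  rfl

/-- The smallest positive value is subtracted on the support, which shrinks the support strictly.
The old support then becomes the last and largest set of the chain, with that value as its
coefficient. -/
theorem exists_chain [Finite α] (s : α → ℝ) (hs : ∀ a, 0 ≤ s a) (hne : ∃ a, 0 < s a) :
    ∃ (n : ℕ) (S : Fin (n + 1) → Set α) (w : Fin (n + 1) → ℝ), StrictMono S ∧ (S 0).Nonempty ∧
      (∀ l, 0 < w l) ∧ ∀ a, chainWeight S w a = s a := by
  classical
  obtain ⟨d, hd⟩ : ∃ d, {a | 0 < s a}.ncard = d := ⟨_, rfl⟩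
  induction d using Nat.strong_induction_on generalizing s with
  | _ d ih =>
  obtain ⟨a₀, ha₀, hmin⟩ := Set.exists_min_image {a | 0 < s a} s (Set.toFinite _) hne
  have ha₀' : 0 < s a₀ := ha₀
  let s' : α → ℝ := fun a => if 0 < s a then s a - s a₀ else 0
  have hs' : ∀ a, 0 ≤ s' a := by
    intro a
    simp only [s']
    split_ifs with h
    · exact sub_nonneg.2 (hmin a h)
    · exact le_rfl
  have hs'a : ∀ a, s a = s' a + if 0 < s a then s a₀ else 0 := by
    intro a
    simp only [s']
    split_ifs with h
    · ring
    · linarith [hs a, not_lt.1 h]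
  have hsub : {a | 0 < s' a} ⊂ {a | 0 < s a} := by
    refine ⟨fun a ha => ?_, fun hle => ?_⟩
    · by_contra h
      have h' : ¬ 0 < s a := h
      have ha' : 0 < s' a := ha
      simp [s', h'] at ha'
    · have : 0 < s' a₀ := hle ha₀
      simp [s'] at this
  by_cases hne' : ∃ a, 0 < s' a
  · obtain ⟨n, S, w, hS, h0, hw, hsum⟩ := ih _ (hd ▸ Set.ncard_lt_ncard hsub (Set.toFinite _))
      s' hs' hne' rfl
    have hlast : S (Fin.last n) ⊆ {a | 0 < s' a} := by
      intro a ha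
      change 0 < s' a
      rw [← hsum a]
      refine Finset.sum_pos' (fun l _ => ?_) ⟨Fin.last n, Finset.mem_univ _, ?_⟩
      · split_ifs
        · exact (hw l).le
        · exact le_rfl
      · rw [if_pos ha]
        exact hw _
    refine ⟨n + 1, Fin.snoc (α := fun _ => Set α) S {a | 0 < s a},
      Fin.snoc (α := fun _ => ℝ) w (s a₀), ?_, ?_, ?_, ?_⟩
    · rw [Fin.strictMono_iff_lt_succ]
      intro i
      rw [Fin.snoc_castSucc]
      induction i using Fin.lastCases with
      | last =>
        rw [Fin.succ_last, Fin.snoc_last]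
        exact lt_of_le_of_lt hlast hsub
      | cast i =>
        rw [← Fin.castSucc_succ, Fin.snoc_castSucc]
        exact hS (Fin.castSucc_lt_succ)
    · have : (0 : Fin (n + 2)) = Fin.castSucc 0 := rfl
      rwa [this, Fin.snoc_castSucc]
    · intro l
      induction l using Fin.lastCases with
      | last => rwa [Fin.snoc_last]
      | cast i => rw [Fin.snoc_castSucc]; exact hw i
    · intro a
      rw [hs'a a, ← hsum a]
      simp [chainWeight, Fin.sum_univ_castSucc]
  · push Not at hne'
    refine ⟨0, fun _ => {a | 0 < s a}, fun _ => s a₀, ?_, hne, fun _ => ha₀', fun a => ?_⟩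
    · intro i j hij
      omega
    · rw [hs'a a, le_antisymm (hne' a) (hs' a)]
      simp [chainWeight]

end ChainWeights

/-! ### Properness of the blow-downs -/

section Proper

theorem isProperMap_sigma {ι : Type*} [Finite ι] {A : ι → Type*} [∀ i, TopologicalSpace (A i)]
    {Y : Type*} [TopologicalSpace Y] {f : (Σ i, A i) → Y}
    (h : ∀ i, IsProperMap fun a => f ⟨i, a⟩) : IsProperMap f := by
  rw [isProperMap_iff_isClosedMap_and_compact_fibers]
  refine ⟨continuous_sigma fun i => (h i).continuous, fun C hC => ?_, fun y => ?_⟩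
  · have : f '' C = ⋃ i, (fun a => f ⟨i, a⟩) '' (Sigma.mk i ⁻¹' C) := by
      ext y
      simp only [Set.mem_image, Set.mem_iUnion, Set.mem_preimage, Sigma.exists]
    rw [this]
    exact isClosed_iUnion_of_finite fun i =>
      (h i).isClosedMap _ (hC.preimage continuous_sigmaMk)
  · have : f ⁻¹' {y} = ⋃ i, Sigma.mk i '' ((fun a => f ⟨i, a⟩) ⁻¹' {y}) := by
      ext ⟨i, a⟩
      simp only [Set.mem_iUnion, Set.mem_image, Set.mem_preimage]
      constructor
      · exact fun h => ⟨i, a, h, rfl⟩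
      · rintro ⟨j, b, hb, e⟩
        rwa [← e]
    rw [this]
    exact isCompact_iUnion fun i =>
      ((h i).isCompact_preimage isCompact_singleton).image continuous_sigmaMk

/-- A continuous bijection from a quotient is a homeomorphism, if the quotient is covered by a
proper space. -/
theorem isHomeomorph_of_proper_cover {K Q E Y : Type*} [TopologicalSpace K] [TopologicalSpace Q]
    [TopologicalSpace E] [TopologicalSpace Y] [T2Space E] {q : K → Q} {f : Q → E} {p : E → Y}
    (hf : Continuous f) (hfb : Function.Bijective f) (hq : Continuous q)
    (hqs : Function.Surjective q) (hp : Continuous p)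
    (h : IsProperMap fun k => p (f (q k))) : IsHomeomorph f := by
  have h1 : IsProperMap fun k => f (q k) := isProperMap_of_comp_of_t2 (hf.comp hq) hp h
  rw [isHomeomorph_iff_continuous_isClosedMap_bijective]
  refine ⟨hf, fun C hC => ?_, hfb⟩
  have : f '' C = (fun k => f (q k)) '' (q ⁻¹' C) := by
    rw [← Set.image_image f q, Set.image_preimage_eq _ hqs]
  rw [this]
  exact h1.isClosedMap _ (hC.preimage hq)

variable {N : ℕ} {X : Type u} [TopologicalSpace X] [ChartedSpace (Fin N → ℂ) X]
  {I : Type v} {D : I → Set X}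

theorem isProperMap_piece_base [T2Space X] (hcl : ∀ i, IsClosed (D i))
    (hβ : ∀ i, IsProperMap (DivisorBlowUp.base : DivisorBlowUp N (D i) → X)) (A B : Set I) :
    IsProperMap fun p : Piece N D A B => p.1.base := by
  rw [isProperMap_iff_ultrafilter_of_t2]
  refine ⟨StratumBlowUp.continuous_base.comp continuous_subtype_val, fun 𝒰 y hy => ?_⟩
  have h1 : ∀ i : {i // i ∉ A}, ∃ b : DivisorBlowUp N (D i),
      Filter.Tendsto (fun p : Piece N D A B => p.1.1.2 i) 𝒰 (𝓝 b) := by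
    intro i
    have := (isProperMap_iff_ultrafilter_of_t2.1 (hβ i)).2
      (𝒰 := 𝒰.map fun p : Piece N D A B => p.1.1.2 i) (y := y) ?_
    · exact this
    · rw [Ultrafilter.coe_map, Filter.tendsto_map'_iff]
      exact hy.congr fun p => (p.1.2.2 i).symm
  choose b hb using h1
  have hmem : ∀ i, (∀ p : Piece N D A B, p.1.base ∈ D i) → y ∈ D i := fun i hi =>
    (hcl i).mem_of_tendsto hy (Filter.Eventually.of_forall hi)
  refine ⟨⟨⟨(y, b), fun i hi => hmem i fun p => p.1.2.1 i hi, fun i => ?_⟩,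
    fun i hi => hmem i fun p => p.2 i hi⟩, ?_⟩
  · refine tendsto_nhds_unique (((hβ i).continuous.tendsto _).comp (hb i)) ?_
    exact hy.congr fun p => (p.1.2.2 i).symm
  · have hv1 : IsInducing (Subtype.val : StratumBlowUp N D A → _) := ⟨rfl⟩
    have hv2 : IsInducing (Subtype.val : Piece N D A B → _) := ⟨rfl⟩
    refine le_of_le_of_eq ?_ ((hv1.comp hv2).nhds_eq_comap _).symm
    exact Filter.map_le_iff_le_comap.1 (hy.prodMk_nhds (tendsto_pi_nhds.2 hb))

theorem isProperMap_simplices_base [T2Space X] [Finite I] (hcl : ∀ i, IsClosed (D i))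
    (hβ : ∀ i, IsProperMap (DivisorBlowUp.base : DivisorBlowUp N (D i) → X)) (n : ℕ) :
    IsProperMap fun s : Simplices N D n => s.2.1.base :=
  isProperMap_sigma fun _ => isProperMap_piece_base hcl hβ _ _

theorem Chain.length_le [Finite I] {n : ℕ} (c : Chain I n) : n ≤ Nat.card I := by
  have : ∀ l : Fin (n + 1), (l : ℕ) ≤ (c.1 l).ncard := by
    intro l
    induction l using Fin.induction with
    | zero => exact Nat.zero_le _
    | succ i ih =>
      have := Set.ncard_lt_ncard (c.2 (Fin.castSucc_lt_succ (i := i))) (Set.toFinite _)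
      simp only [Fin.val_castSucc, Fin.val_succ] at ih ⊢
      omega
  exact (this (Fin.last n)).trans (Set.ncard_le_card _)

end Proper

/-! ### The map from the geometric realization to the fibre product of cones -/

section Vec

theorem chainWeight_map {α : Type*} {m n : ℕ} (S : Fin n → Set α) (φ : Fin m → Fin n)
    (t : stdSimplex ℝ (Fin m)) (a : α) :
    chainWeight S (stdSimplex.map φ t) a = chainWeight (S ∘ φ) t a := by
  classical
  simp only [chainWeight, stdSimplex.map_coe, FunOnFinite.linearMap_apply_apply, Function.comp_apply]
  rw [← Finset.sum_fiberwise Finset.univ φ]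
  refine Finset.sum_congr rfl fun l _ => ?_
  split_ifs with h
  · exact Finset.sum_congr rfl fun j hj => by rw [if_pos]; rwa [(Finset.mem_filter.1 hj).2]
  · exact (Finset.sum_eq_zero fun j hj => by
      rw [if_neg]; rwa [(Finset.mem_filter.1 hj).2]).symm

variable {N : ℕ} {X : Type u} [TopologicalSpace X] [ChartedSpace (Fin N → ℂ) X]
  {I : Type v} {D : I → Set X} {V : Type*} [AddCommGroup V] [Module ℝ V] [TopologicalSpace V]
  {w : ∀ i, DivisorBlowUp N (D i) → V} {n : ℕ}

open Classical in
/-- The sum over the `i` outside of the first term of the chain of the multiples of the given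
embeddings of the normal rays by `1 - ∑ t l`, where the sum is over the `l` such that `i` is in
the `l`-th term of the chain. -/
def Simplices.vec (w : ∀ i, DivisorBlowUp N (D i) → V) (s : Simplices N D n) (t : Fin (n + 1) → ℝ) :
    I → V := fun i =>
  if h : i ∈ s.1.1 0 then 0 else (1 - chainWeight s.1.1 t i) • w i (s.2.1.1.2 ⟨i, h⟩)

theorem Simplices.vec_of_mem {s : Simplices N D n} {t : Fin (n + 1) → ℝ} {i : I}
    (h : i ∈ s.1.1 0) : s.vec w t i = 0 := dif_pos h

theorem Simplices.vec_of_notMem {s : Simplices N D n} {t : Fin (n + 1) → ℝ} {i : I}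
    (h : i ∉ s.1.1 0) :
    s.vec w t i = (1 - chainWeight s.1.1 t i) • w i (s.2.1.1.2 ⟨i, h⟩) := dif_neg h

theorem chainWeight_eq_one (s : Chain I n) (t : stdSimplex ℝ (Fin (n + 1))) {i : I}
    (hi : i ∈ s.1 0) : chainWeight s.1 t i = 1 := by
  rw [← stdSimplex.sum_eq_one t]
  exact Finset.sum_congr rfl fun l _ => if_pos (s.2.monotone (Fin.zero_le l) hi)

theorem chainWeight_lt_one (s : Chain I n) (t : stdSimplex ℝ (Fin (n + 1))) (h0 : 0 < t 0) {i : I}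
    (hi : i ∉ s.1 0) : chainWeight s.1 t i < 1 := by
  rw [← stdSimplex.sum_eq_one t]
  refine Finset.sum_lt_sum (fun l _ => ?_) ⟨0, Finset.mem_univ _, by rwa [if_neg hi]⟩
  split_ifs
  · exact le_rfl
  · exact stdSimplex.zero_le t l

/-- The rays that the piece does not record are chosen arbitrarily. Their indices belong to the
first term of the chain and have height 1, so the choice is invisible in the vector. -/
theorem Simplices.exists_rayCube
    (hs : ∀ i, Function.Surjective (DivisorBlowUp.base : DivisorBlowUp N (D i) → X))
    (s : Simplices N D n) (t : stdSimplex ℝ (Fin (n + 1))) :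
    ∃ τ : RayCube D (fun i => (DivisorBlowUp.base : DivisorBlowUp N (D i) → X)),
      τ.1.1 = s.2.1.base ∧ τ.vec w Set.univ = s.vec w t ∧ τ.1.2.2 = chainWeight s.1.1 t ∧
        ∀ i (hi : i ∉ s.1.1 0), τ.1.2.1 i = s.2.1.1.2 ⟨i, hi⟩ := by
  classical
  refine ⟨⟨(s.2.1.base, fun i => if h : i ∈ s.1.1 0 then (hs i s.2.1.base).choose else
    s.2.1.1.2 ⟨i, h⟩, chainWeight s.1.1 t), fun i => ?_, fun i =>
      ⟨⟨chainWeight_nonneg (stdSimplex.zero_le t) i, ?_⟩, fun h => ?_⟩⟩, rfl, ?_, rfl,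
      fun i hi => dif_neg hi⟩
  · dsimp only
    split_ifs with h
    · exact (hs i s.2.1.base).choose_spec
    · exact s.2.1.2.2 ⟨i, h⟩
  · exact (chainWeight_le (stdSimplex.zero_le t) i).trans_eq (stdSimplex.sum_eq_one t)
  · refine s.2.2 i ?_
    by_contra hi
    have h0 : chainWeight s.1.1 t i = 0 := Finset.sum_eq_zero fun l _ => if_neg fun hl => hi ?_
    · exact absurd h0 h.ne'
    exact s.1.2.monotone (Fin.le_last l) hl
  · funext i
    simp only [RayCube.vec, Set.mem_univ, if_true]
    by_cases h : i ∈ s.1.1 0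
    · rw [Simplices.vec_of_mem h, chainWeight_eq_one s.1 t h, sub_self, zero_smul]
    · rw [Simplices.vec_of_notMem h, dif_neg h]

/-- A face map forgets rays only for indices in the first term of the smaller chain. These have
height 1, so their vectors were 0 already. -/
theorem Simplices.vec_map {m : ℕ} (φ : Fin (m + 1) ↪o Fin (n + 1)) (s : Simplices N D n)
    (t : stdSimplex ℝ (Fin (m + 1))) :
    (Simplices.map D φ s).vec w t = s.vec w (stdSimplex.map φ t) := by
  funext i
  have e : chainWeight (Simplices.map D φ s).1.1 t i = chainWeight s.1.1 (stdSimplex.map φ t) i :=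
    (chainWeight_map s.1.1 φ t i).symm
  by_cases h : i ∈ s.1.1 0
  · have h' : i ∈ (Simplices.map D φ s).1.1 0 := s.1.2.monotone (Fin.zero_le _) h
    rw [vec_of_mem h, vec_of_mem h']
  · rw [vec_of_notMem h, ← e]
    by_cases h' : i ∈ (Simplices.map D φ s).1.1 0
    · rw [vec_of_mem h', chainWeight_eq_one (Simplices.map D φ s).1 t h', sub_self, zero_smul]
    · exact vec_of_notMem h'

theorem Simplices.continuous_vec [ContinuousSMul ℝ V] (hw : ∀ i, Continuous (w i)) :
    Continuous fun p : Simplices N D n × stdSimplex ℝ (Fin (n + 1)) => p.1.vec w p.2 := by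
  rw [← Homeomorph.sigmaProdDistrib.symm.comp_continuous_iff']
  refine continuous_sigma fun c => continuous_pi fun i => ?_
  by_cases h : i ∉ c.1 0
  · have e : (fun p : Piece N D (c.1 0) (c.1 (Fin.last n)) × stdSimplex ℝ (Fin (n + 1)) =>
        (1 - chainWeight c.1 p.2 i) • w i (p.1.1.1.2 ⟨i, h⟩)) =
        fun p => Simplices.vec w ⟨c, p.1⟩ p.2 i := by
      funext p
      exact (Simplices.vec_of_notMem (s := ⟨c, p.1⟩) h).symm
    refine Eq.subst (motive := Continuous) e (Continuous.smul ?_ ((hw i).comp ?_))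
    · refine continuous_const.sub (continuous_finsetSum _ fun l _ => ?_)
      split_ifs
      · exact (continuous_apply l).comp (continuous_subtype_val.comp continuous_snd)
      · exact continuous_const
    · have h0 : Continuous fun p : Piece N D (c.1 0) (c.1 (Fin.last n)) => p.1.1 :=
        continuous_subtype_val.comp continuous_subtype_val
      exact (continuous_apply (⟨i, h⟩ : {i // i ∉ c.1 0})).comp
        (continuous_snd.comp (h0.comp continuous_fst))
  · have e : (fun p : Piece N D (c.1 0) (c.1 (Fin.last n)) × stdSimplex ℝ (Fin (n + 1)) =>
        (0 : V)) = fun p => Simplices.vec w ⟨c, p.1⟩ p.2 i := by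
      funext p
      exact (Simplices.vec_of_mem (s := ⟨c, p.1⟩) (not_not.1 h)).symm
    exact Eq.subst (motive := Continuous) e continuous_const

/-- A chain together with the points of the interior of its simplex are determined by the values
of the combination of indicator functions. -/
theorem chain_eq_of_chainWeight_eq {m : ℕ} {c : Chain I n} {c' : Chain I m}
    {t : stdSimplex ℝ (Fin (n + 1))} {t' : stdSimplex ℝ (Fin (m + 1))} (ht : ∀ l, 0 < t l)
    (ht' : ∀ l, 0 < t' l) (h : ∀ i, chainWeight c.1 t i = chainWeight c'.1 t' i) :
    (⟨n, c, t⟩ : Σ n : ℕ, Chain I n × stdSimplex ℝ (Fin (n + 1))) = ⟨m, c', t'⟩ := by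
  -- The first term of a chain may be empty, so a new element `none` is added to every term before
  -- `chain_unique` is applied; its weight is always 1.
  have hmono : ∀ {k : ℕ} (c : Chain I k), StrictMono fun l => insert none (some '' c.1 l) := by
    intro k c i j hij
    obtain ⟨h1, a, h2, h3⟩ := Set.ssubset_iff_exists.1 (c.2 hij)
    refine Set.ssubset_iff_exists.2 ⟨Set.insert_subset_insert (Set.image_mono h1), some a, ?_, ?_⟩
    · exact Set.mem_insert_of_mem _ ⟨a, h2, rfl⟩
    · simpa using h3
  have hs : ∀ {k : ℕ} (c : Chain I k) (t : stdSimplex ℝ (Fin (k + 1))) (i : I),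
      chainWeight (fun l => insert none (some '' c.1 l)) t (some i) = chainWeight c.1 t i := by
    intro k c t i
    refine Finset.sum_congr rfl fun l _ => ?_
    have : some i ∈ insert none (some '' c.1 l) ↔ i ∈ c.1 l := by simp
    by_cases hi : i ∈ c.1 l
    · exact (if_pos (this.2 hi)).trans (if_pos hi).symm
    · exact (if_neg (mt this.1 hi)).trans (if_neg hi).symm
  have hn : ∀ {k : ℕ} (c : Chain I k) (t : stdSimplex ℝ (Fin (k + 1))),
      chainWeight (fun l => insert none (some '' c.1 l)) t none = 1 := by
    intro k c t
    rw [← stdSimplex.sum_eq_one t]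
    simp [chainWeight]
  have key := chain_unique (hmono c) ⟨none, by simp⟩ ht (hmono c') ⟨none, by simp⟩ ht' (by
    rintro (_ | i)
    · rw [hn, hn]
    · rw [hs, hs, h])
  obtain rfl : n = m := congrArg Sigma.fst key
  simp only [Sigma.mk.injEq, heq_eq_eq, true_and, Prod.mk.injEq] at key
  have hc : c = c' := by
    refine Subtype.ext (funext fun l => Set.ext fun i => ?_)
    have := congrArg (fun s => some i ∈ s) (congrFun key.1 l)
    simpa using this
  have htt : t = t' := stdSimplex.ext key.2
  rw [hc, htt]

/-- The heights determine the chain and the barycentric coordinates. Since `t 0` is positive,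
indices outside the first term have height less than 1, so their rays are recovered as well. -/
theorem Simplices.eq_of_vec_eq [ContinuousSMul ℝ V]
    (h : IsRayFamily D (fun i => (DivisorBlowUp.base : DivisorBlowUp N (D i) → X)) w) {m : ℕ}
    {s : Simplices N D n} {s' : Simplices N D m}
    {t : stdSimplex ℝ (Fin (n + 1))} {t' : stdSimplex ℝ (Fin (m + 1))} (ht : ∀ l, 0 < t l)
    (ht' : ∀ l, 0 < t' l) (hx : s.2.1.base = s'.2.1.base) (hv : s.vec w t = s'.vec w t') :
    (⟨n, s, t⟩ : Σ n : ℕ, Simplices N D n × stdSimplex ℝ (Fin (n + 1))) = ⟨m, s', t'⟩ := by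
  obtain ⟨τ, hτ1, hτ2, hτ3, hτ4⟩ := Simplices.exists_rayCube (w := w) h.surjective s t
  obtain ⟨τ', hτ1', hτ2', hτ3', hτ4'⟩ := Simplices.exists_rayCube (w := w) h.surjective s' t'
  have key := fun i => h.eq_of_vec_eq (τ := τ) (τ' := τ') (by rw [hτ1, hx, hτ1'])
    (by rw [hτ2, hv, hτ2']) (Set.mem_univ i)
  have hc := chain_eq_of_chainWeight_eq (c := s.1) (c' := s'.1) ht ht' fun i => by
    rw [← hτ3, ← hτ3', (key i).1]
  obtain rfl : n = m := congrArg Sigma.fst hc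
  simp only [Sigma.mk.injEq, heq_eq_eq, true_and, Prod.mk.injEq] at hc
  obtain ⟨hc, rfl⟩ := hc
  obtain ⟨c, p⟩ := s
  obtain ⟨c', p'⟩ := s'
  obtain rfl : c = c' := hc
  have hp : p = p' := by
    refine Subtype.ext (Subtype.ext (Prod.ext hx (funext fun i => ?_)))
    have h1 := (key i).2.resolve_left (by
      rw [hτ3]
      exact (chainWeight_lt_one c t (ht 0) i.2).ne)
    rw [hτ4 i i.2, hτ4' i i.2] at h1
    exact h1
  rw [hp]

/-- Each point of the fibre product of cones comes from the interior of some simplex. -/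
theorem Simplices.exists_vec_eq [Finite I]
    (y : coneSpace D (fun i => (DivisorBlowUp.base : DivisorBlowUp N (D i) → X)) w Set.univ) :
    ∃ (n : ℕ) (s : Simplices N D n) (t : stdSimplex ℝ (Fin (n + 1))), (∀ l, 0 < t l) ∧
      (s.2.1.base, s.vec w t) = y.1 := by
  obtain ⟨_, τ, rfl⟩ := y
  -- The value 1 at `none` is the maximum. It forces the coefficients to add up to 1 and `none` to
  -- lie in every set, so removing `none` leaves a strict chain whose first term may be empty.
  let f : Option I → ℝ := fun a => a.elim 1 τ.1.2.2
  obtain ⟨n, S, v, hS, hS0, hv, hsum⟩ := exists_chain f (by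
    rintro (_ | i)
    · exact zero_le_one
    · exact (τ.2.2 i).1.1) ⟨none, zero_lt_one⟩
  have hle : ∀ a, f a ≤ 1 := by
    rintro (_ | i)
    · exact le_rfl
    · exact (τ.2.2 i).1.2
  obtain ⟨a₀, ha₀⟩ := hS0
  have hv1 : ∑ l, v l = 1 := by
    refine le_antisymm ?_ ?_
    · refine le_trans (le_of_eq ?_) ((hsum a₀).trans_le (hle a₀))
      exact Finset.sum_congr rfl fun l _ => (if_pos (hS.monotone (Fin.zero_le l) ha₀)).symm
    · exact (hsum none).symm.trans_le (chainWeight_le (fun l => (hv l).le) none)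
  have hnone : ∀ l, none ∈ S l := by
    intro l
    by_contra hl
    have : chainWeight S v none < ∑ l, v l := by
      refine Finset.sum_lt_sum (fun l _ => ?_) ⟨l, Finset.mem_univ _, by
        rw [if_neg hl]; exact hv l⟩
      split_ifs
      · exact le_rfl
      · exact (hv l).le
    rw [hsum, hv1] at this
    exact lt_irrefl _ this
  let c : Chain I n := ⟨fun l => some ⁻¹' S l, fun i j hij => by
    obtain ⟨h1, a, h2, h3⟩ := Set.ssubset_iff_exists.1 (hS hij)
    refine Set.ssubset_iff_exists.2 ⟨Set.preimage_mono h1, ?_⟩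
    cases a with
    | none => exact absurd (hnone i) h3
    | some a => exact ⟨a, h2, h3⟩⟩
  let t : stdSimplex ℝ (Fin (n + 1)) := ⟨v, fun l => (hv l).le, hv1⟩
  have hw : ∀ i, chainWeight c.1 t i = τ.1.2.2 i := fun i => hsum (some i)
  have hD : ∀ l, ∀ i ∈ c.1 l, τ.1.1 ∈ D i := by
    intro l i hi
    refine (τ.2.2 i).2 ?_
    rw [← hw]
    refine Finset.sum_pos' (fun l _ => ?_) ⟨l, Finset.mem_univ _, ?_⟩
    · split_ifs
      · exact (hv l).le
      · exact le_rfl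
    · rw [if_pos hi]
      exact hv l
  refine ⟨n, ⟨c, ⟨⟨(τ.1.1, fun i => τ.1.2.1 i), hD 0, fun i => τ.2.1 i⟩, hD _⟩⟩, t, hv,
    Prod.ext rfl (funext fun i => ?_)⟩
  simp only [RayCube.vec, Set.mem_univ, if_true]
  rw [← hw]
  by_cases h : i ∈ c.1 0
  · rw [chainWeight_eq_one c t h, sub_self, zero_smul]
    exact Simplices.vec_of_mem h
  · exact Simplices.vec_of_notMem (s := ⟨c, _⟩) h

end Vec

/-! ### The geometric realization -/

section Realization

variable {N : ℕ} {X : Type u} [TopologicalSpace X] [ChartedSpace (Fin N → ℂ) X]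
  {I : Type v} {D : I → Set X} {V : Type*} [AddCommGroup V] [Module ℝ V] [TopologicalSpace V]
  {w : ∀ i, DivisorBlowUp N (D i) → V} [ContinuousSMul ℝ V]

/-- The point of the fibre product of cones given by a point of a simplex. -/
def Simplices.toConeSpace
    (h : IsRayFamily D (fun i => (DivisorBlowUp.base : DivisorBlowUp N (D i) → X)) w) {n : ℕ}
    (p : Simplices N D n × stdSimplex ℝ (Fin (n + 1))) :
    coneSpace D (fun i => (DivisorBlowUp.base : DivisorBlowUp N (D i) → X)) w Set.univ :=
  ⟨(p.1.2.1.base, p.1.vec w p.2), by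
    obtain ⟨τ, h1, h2, -⟩ := Simplices.exists_rayCube (w := w) h.surjective p.1 p.2
    exact ⟨τ, Prod.ext h1 h2⟩⟩

variable (h : IsRayFamily D (fun i => (DivisorBlowUp.base : DivisorBlowUp N (D i) → X)) w)

theorem Simplices.continuous_toConeSpace (n : ℕ) :
    Continuous (Simplices.toConeSpace h (n := n)) := by
  refine Continuous.subtype_mk (Continuous.prodMk ?_ (Simplices.continuous_vec h.continuous)) _
  exact ((semiSimplicialSpaceAugmentation D).app (.op (.mk n))).continuous.comp continuous_fst

theorem Simplices.toConeSpace_map {m n : ℕ} (φ : Fin (m + 1) ↪o Fin (n + 1))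
    (s : Simplices N D n) (t : stdSimplex ℝ (Fin (m + 1))) :
    Simplices.toConeSpace h (Simplices.map D φ s, t) =
      Simplices.toConeSpace h (s, stdSimplex.map φ t) :=
  Subtype.ext (Prod.ext rfl (Simplices.vec_map φ s t))

/-- The map from the geometric realization to the fibre product of cones. -/
def realizationToConeSpace (p : Realization (semiSimplicialSpace N D)) :
    coneSpace D (fun i => (DivisorBlowUp.base : DivisorBlowUp N (D i) → X)) w Set.univ :=
  Quot.lift (fun p : Σ n : ℕ, (semiSimplicialSpace N D).obj (.op (.mk n)) ×
      stdSimplex ℝ (Fin (n + 1)) => Simplices.toConeSpace h p.2) (by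
    rintro _ _ ⟨n, l, x, t⟩
    exact (Simplices.toConeSpace_map h (Fin.succAboveOrderEmb l) x t).symm) p

theorem exists_eq_map_succAbove {n : ℕ} {t : stdSimplex ℝ (Fin (n + 2))} {l : Fin (n + 2)}
    (hl : t l = 0) : ∃ t', t = stdSimplex.map l.succAbove t' := by
  refine ⟨⟨fun j => t (l.succAbove j), fun j => stdSimplex.zero_le t _, ?_⟩,
    stdSimplex.ext (funext fun j => ?_)⟩
  · rw [← stdSimplex.sum_eq_one t, Fin.sum_univ_succAbove _ l, hl, zero_add]
  · rw [stdSimplex.map_coe, FunOnFinite.linearMap_apply_apply]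
    induction j using l.succAboveCases with
    | x =>
      rw [Finset.sum_eq_zero, hl]
      intro i hi
      exact absurd (Finset.mem_filter.1 hi).2 (Fin.succAbove_ne l i)
    | p j =>
      rw [Finset.sum_eq_single_of_mem j (by simp)]
      · rfl
      · intro i hi hij
        exact absurd (Fin.succAbove_right_injective (Finset.mem_filter.1 hi).2) hij

theorem Realization.exists_interior {F : SemiSimplexCategoryᵒᵖ ⥤ TopCat.{u}}
    (p : Σ n : ℕ, F.obj (.op (.mk n)) × stdSimplex ℝ (Fin (n + 1))) :
    ∃ q : Σ n : ℕ, F.obj (.op (.mk n)) × stdSimplex ℝ (Fin (n + 1)),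
      (Quot.mk (RealizationRel F) p = Quot.mk _ q) ∧ ∀ l, 0 < q.2.2 l := by
  obtain ⟨n, x, t⟩ := p
  induction n with
  | zero =>
    refine ⟨_, rfl, fun l => ?_⟩
    have : t l = 1 := stdSimplex.eq_one_of_unique (X := Fin 1) t l
    change 0 < t l
    rw [this]
    exact one_pos
  | succ n ih =>
    by_cases hpos : ∀ l, 0 < t l
    · exact ⟨_, rfl, hpos⟩
    · push Not at hpos
      obtain ⟨l, hl⟩ := hpos
      obtain ⟨t', rfl⟩ := exists_eq_map_succAbove (le_antisymm hl (stdSimplex.zero_le t l))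
      obtain ⟨q, hq, hq'⟩ := ih (F.map (coface n l).op x) t'
      exact ⟨q, (Quot.sound (RealizationRel.face n l x t')).trans hq, hq'⟩

theorem isProperMap_simplicesProd_base [T2Space X] [Finite I]
    (h : IsRayFamily D (fun i => (DivisorBlowUp.base : DivisorBlowUp N (D i) → X)) w) (n m : ℕ) :
    IsProperMap fun p : Simplices N D n × stdSimplex ℝ (Fin (m + 1)) => p.1.2.1.base :=
  (isProperMap_simplices_base h.isClosed h.isProperMap n).comp isProperMap_fst_of_compactSpace

/-- Representatives with positive coordinates make the map bijective. Closedness holds because the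
realization is covered by finitely many spaces that are proper over X: a strict chain in I has
length at most the cardinality of I. -/
theorem isHomeomorph_realizationToConeSpace [T2Space X] [T2Space V] [Finite I] :
    IsHomeomorph (realizationToConeSpace h) := by
  let q : (Σ n : Fin (Nat.card I + 1), Simplices N D n × stdSimplex ℝ (Fin (n + 1))) →
      Realization (semiSimplicialSpace N D) := fun k => Quot.mk _ ⟨k.1, k.2⟩
  refine isHomeomorph_of_proper_cover (q := q) (p := fun y => y.1.1) ?_ ⟨?_, ?_⟩ ?_ ?_
    (by fun_prop) (isProperMap_sigma fun n => isProperMap_simplicesProd_base h n n)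
  · exact continuous_coinduced_dom.2 (continuous_sigma fun n =>
      Simplices.continuous_toConeSpace h n)
  · rintro ⟨a⟩ ⟨b⟩ hab
    obtain ⟨⟨n, s, t⟩, ha, ht⟩ := Realization.exists_interior a
    obtain ⟨⟨m, s', t'⟩, hb, ht'⟩ := Realization.exists_interior b
    rw [ha, hb] at hab ⊢
    have h1 := congrArg Subtype.val hab
    have h2 := Simplices.eq_of_vec_eq h (s := s) (s' := s') ht ht' (congrArg Prod.fst h1)
      (congrArg Prod.snd h1)
    exact congrArg (Quot.mk _) h2
  · intro y
    obtain ⟨n, s, t, -, e⟩ := Simplices.exists_vec_eq y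
    exact ⟨Quot.mk _ ⟨n, s, t⟩, Subtype.ext e⟩
  · exact continuous_sigma fun n => continuous_coinduced_rng.comp
      (continuous_sigmaMk (σ := fun n : ℕ => (semiSimplicialSpace N D).obj (.op (.mk n)) ×
        stdSimplex ℝ (Fin (n + 1))))
  · rintro ⟨⟨n, s, t⟩⟩
    exact ⟨⟨⟨n, Nat.lt_succ_of_le s.1.length_le⟩, s, t⟩, rfl⟩

theorem isHomotopyEquivalence_realization [T2Space X] [T2Space V] [Finite I]
    (h : IsRayFamily D (fun i => (DivisorBlowUp.base : DivisorBlowUp N (D i) → X)) w)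
    (hb : IsHomotopyEquivalence (coneSpace.base (D := D)
      (β := fun i => (DivisorBlowUp.base : DivisorBlowUp N (D i) → X)) (w := w) Set.univ)) :
    IsHomotopyEquivalence
      (Realization.desc (semiSimplicialSpaceAugmentation (N := N) D)) := by
  have hh := isHomeomorph_realizationToConeSpace h
  have e : Realization.desc (semiSimplicialSpaceAugmentation (N := N) D) =
      (coneSpace.base (D := D) (β := fun i => (DivisorBlowUp.base : DivisorBlowUp N (D i) → X))
        (w := w) Set.univ).comp ⟨_, hh.continuous⟩ := by
    ext ⟨p⟩
    rfl
  rw [e]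
  exact hb.comp (IsHomotopyEquivalence.of_isHomeomorph ⟨_, hh.continuous⟩ hh)

end Realization

/-! ### Strings of injections and flags of subsets -/

section Strings

/-- The order embedding given by an arrow of the opposite of the semi-simplex category. -/
def arrowEmb {c d : SemiSimplexCategoryᵒᵖ} (f : c ⟶ d) :
    Fin (d.unop.len + 1) ↪o Fin (c.unop.len + 1) :=
  SemiSimplexCategory.homEquiv f.unop

theorem arrowEmb_comp {c d e : SemiSimplexCategoryᵒᵖ} (f : c ⟶ d) (g : d ⟶ e) :
    (arrowEmb (f ≫ g) : _ → _) = arrowEmb f ∘ arrowEmb g := rfl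

theorem arrowEmb_injective {c d : SemiSimplexCategoryᵒᵖ} {f g : c ⟶ d}
    (h : arrowEmb f = arrowEmb g) : f = g :=
  Quiver.Hom.unop_inj (SemiSimplexCategory.homEquiv.injective h)

/-- An increasing injection is determined by its image. This is what makes strings of arrows and
flags of faces the same thing. -/
theorem arrow_eq_of_range_eq {c d : SemiSimplexCategoryᵒᵖ} {f g : c ⟶ d}
    (h : Set.range (arrowEmb f) = Set.range (arrowEmb g)) : f = g :=
  arrowEmb_injective (DFunLike.coe_injective
    (((arrowEmb f).strictMono.range_inj (arrowEmb g).strictMono).1 h))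

theorem range_arrowEmb_eqToHom {c d : SemiSimplexCategoryᵒᵖ} (h : c = d) :
    Set.range (arrowEmb (eqToHom h)) = Set.univ := by
  subst h
  exact Set.range_id

instance epi_arrow {c d : SemiSimplexCategoryᵒᵖ} (f : c ⟶ d) : Epi f := by
  rw [← f.op_unop]
  infer_instance

/-- Equality of points of the simplicial replacement of a diagram. -/
theorem hocolimPoint_ext {F : SemiSimplexCategoryᵒᵖ ⥤ TopCat.{v}} {n : ℕ}
    {σ τ : ComposableArrows SemiSimplexCategoryᵒᵖ n} (f : ∀ j, σ.obj j = τ.obj j)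
    (r : σ.obj 0 ⟶ τ.obj 0)
    (hr : ∀ j, σ.map (homOfLE (Fin.zero_le j)) ≫ eqToHom (f j) =
      r ≫ τ.map (homOfLE (Fin.zero_le j)))
    (x : F.obj (σ.obj 0)) (t : stdSimplex ℝ (Fin (n + 1))) :
    (⟨n, σ, x, t⟩ : Σ (n : ℕ) (σ : ComposableArrows SemiSimplexCategoryᵒᵖ n),
      F.obj (σ.obj 0) × stdSimplex ℝ (Fin (n + 1))) = ⟨n, τ, F.map r x, t⟩ := by
  have e : σ = τ := by
    refine CategoryTheory.Functor.ext f fun i j u => ?_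
    have hj : σ.map (homOfLE (Fin.zero_le j)) =
        r ≫ τ.map (homOfLE (Fin.zero_le j)) ≫ eqToHom (f j).symm := by
      rw [← Category.assoc, ← hr j]
      simp
    have hu : homOfLE (Fin.zero_le i) ≫ u = homOfLE (Fin.zero_le j) := Subsingleton.elim _ _
    rw [← cancel_epi (σ.map (homOfLE (Fin.zero_le i))), reassoc_of% hr i, ← Functor.map_comp,
      ← Functor.map_comp_assoc, hu, hj]
  subst e
  have : r = 𝟙 _ := by
    have h0 : σ.map (homOfLE (Fin.zero_le 0)) = 𝟙 _ := σ.map_id 0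
    have := hr 0
    rw [h0] at this
    simpa using this.symm
  rw [this, F.map_id]
  rfl

/-- The combination with coefficients `t` of the barycenters of the faces given by the `g j`. -/
def coneBarycenter {n : ℕ} {c : SemiSimplexCategoryᵒᵖ} {d : Fin (n + 1) → SemiSimplexCategoryᵒᵖ}
    (g : ∀ j, c ⟶ d j) (t : stdSimplex ℝ (Fin (n + 1))) :
    stdSimplex ℝ (Fin (c.unop.len + 1)) :=
  ⟨∑ j, t j • (stdSimplex.map (arrowEmb (g j)) stdSimplex.barycenter).1,
    (convex_stdSimplex ℝ _).sum_mem (fun j _ => stdSimplex.zero_le t j) (stdSimplex.sum_eq_one t)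
      fun j _ => (stdSimplex.map (arrowEmb (g j)) stdSimplex.barycenter).2⟩

theorem map_coneBarycenter {n : ℕ} {c' c : SemiSimplexCategoryᵒᵖ}
    {d : Fin (n + 1) → SemiSimplexCategoryᵒᵖ} (e : c' ⟶ c) (g : ∀ j, c ⟶ d j)
    (t : stdSimplex ℝ (Fin (n + 1))) :
    stdSimplex.map (arrowEmb e) (coneBarycenter g t) = coneBarycenter (fun j => e ≫ g j) t := by
  refine Subtype.ext ?_
  calc FunOnFinite.linearMap ℝ ℝ (arrowEmb e)
        (∑ j, t j • (stdSimplex.map (arrowEmb (g j)) stdSimplex.barycenter).1)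
      = ∑ j, t j • FunOnFinite.linearMap ℝ ℝ (arrowEmb e)
        (stdSimplex.map (arrowEmb (g j)) stdSimplex.barycenter).1 := by
        simp only [map_sum, map_smul]
    _ = _ := Finset.sum_congr rfl fun j _ => congrArg (t j • ·) (congrArg Subtype.val
        (stdSimplex.map_comp_apply (arrowEmb (g j)) (arrowEmb e) stdSimplex.barycenter))

theorem coneBarycenter_map {m n : ℕ} {c : SemiSimplexCategoryᵒᵖ}
    {d : Fin (n + 1) → SemiSimplexCategoryᵒᵖ} (θ : Fin (m + 1) → Fin (n + 1)) (g : ∀ j, c ⟶ d j)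
    (t : stdSimplex ℝ (Fin (m + 1))) :
    coneBarycenter g (stdSimplex.map θ t) = coneBarycenter (fun j => g (θ j)) t := by
  refine Subtype.ext ?_
  let v := fun l => (stdSimplex.map (arrowEmb (g l))
    (stdSimplex.barycenter : stdSimplex ℝ (Fin ((d l).unop.len + 1)))).1
  change ∑ l, stdSimplex.map θ t l • v l = ∑ j, t j • v (θ j)
  simp only [stdSimplex.map_coe, FunOnFinite.linearMap_apply_apply, Finset.sum_smul]
  rw [← Finset.sum_fiberwise Finset.univ θ]
  refine Finset.sum_congr rfl fun l _ => Finset.sum_congr rfl fun j hj => ?_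
  rw [(Finset.mem_filter.1 hj).2]

/-- The barycenter of a face is its indicator function divided by the number of its vertices. -/
theorem coneBarycenter_apply {n : ℕ} {c : SemiSimplexCategoryᵒᵖ}
    {d : Fin (n + 1) → SemiSimplexCategoryᵒᵖ} (g : ∀ j, c ⟶ d j)
    (t : stdSimplex ℝ (Fin (n + 1))) (k : Fin (c.unop.len + 1)) :
    coneBarycenter g t k = chainWeight (fun j => Set.range (arrowEmb (g j)))
      (fun j => t j / ((d j).unop.len + 1)) k := by
  classical
  change (∑ j, t j • (stdSimplex.map (arrowEmb (g j)) stdSimplex.barycenter).1) k = _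
  rw [Finset.sum_apply]
  refine Finset.sum_congr rfl fun j _ => ?_
  change t j * FunOnFinite.linearMap ℝ ℝ (arrowEmb (g j)) _ k = _
  rw [FunOnFinite.linearMap_apply_apply]
  split_ifs with h
  · obtain ⟨i, rfl⟩ := h
    rw [Finset.sum_eq_single_of_mem i (by simp)]
    · have := stdSimplex.barycenter_apply (𝕜 := ℝ) i
      simp only [Fintype.card_fin, Nat.cast_add, Nat.cast_one] at this
      exact congrArg (t j * ·) this
    · intro i' hi' hne
      exact absurd ((arrowEmb (g j)).injective (Finset.mem_filter.1 hi').2) hne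
  · rw [Finset.sum_eq_zero, mul_zero]
    intro i hi
    exact absurd ⟨i, (Finset.mem_filter.1 hi).2⟩ h

/-- The nonempty subsets of `{0, …, m}`, ordered by reverse inclusion. -/
abbrev Face (m : ℕ) : Type := {S : Finset (Fin (m + 1)) // S.Nonempty}ᵒᵈ

variable {m : ℕ}

/-- The elements of a nonempty subset. -/
def Face.set (S : Face m) : Finset (Fin (m + 1)) := (OrderDual.ofDual S).1

theorem Face.card_eq (S : Face m) : S.set.card = S.set.card - 1 + 1 :=
  (Nat.succ_pred_eq_of_pos (Finset.card_pos.2 (OrderDual.ofDual S).2)).symm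

/-- The object of the semi-simplex category isomorphic to a nonempty subset. -/
def Face.obj (S : Face m) : SemiSimplexCategoryᵒᵖ := .op (.mk (S.set.card - 1))

/-- The arrow given by the inclusion of a nonempty subset in `{0, …, m}`. -/
def Face.arrow (S : Face m) : Opposite.op (SemiSimplexCategory.mk m) ⟶ S.obj :=
  (SemiSimplexCategory.homEquiv.symm (S.set.orderEmbOfFin S.card_eq)).op

theorem Face.range_arrow (S : Face m) : Set.range (arrowEmb S.arrow) = (S.set : Set _) :=
  Finset.range_orderEmbOfFin _ _

/-- The arrow given by an inclusion of nonempty subsets. -/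
def Face.map {S T : Face m} (f : S ≤ T) : S.obj ⟶ T.obj :=
  (SemiSimplexCategory.homEquiv.symm
    (((T.set.orderIsoOfFin T.card_eq).toOrderEmbedding.trans
      (Subtype.orderEmbedding (p := (· ∈ T.set)) (q := (· ∈ S.set)) fun _ h => f h)).trans
      (S.set.orderIsoOfFin S.card_eq).symm.toOrderEmbedding)).op

theorem Face.arrow_map {S T : Face m} (f : S ≤ T) : S.arrow ≫ Face.map f = T.arrow := by
  refine arrowEmb_injective (RelEmbedding.ext fun i => ?_)
  change (S.set.orderEmbOfFin S.card_eq) ((S.set.orderIsoOfFin S.card_eq).symm _) = _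
  rw [← Finset.coe_orderIsoOfFin_apply, OrderIso.apply_symm_apply]
  rfl

/-- The functor from nonempty subsets of `{0, …, m}` to the semi-simplex category. -/
def faceFunctor (m : ℕ) : Face m ⥤ SemiSimplexCategoryᵒᵖ where
  obj S := S.obj
  map f := Face.map (leOfHom f)
  map_id S := by
    rw [← cancel_epi S.arrow, Face.arrow_map, Category.comp_id]
  map_comp {S T U} f g := by
    rw [← cancel_epi S.arrow, Face.arrow_map, ← Category.assoc, Face.arrow_map, Face.arrow_map]

/-- The string of arrows given by a flag of subsets. -/
def flagString {n : ℕ} (a : Fin (n + 1) →o Face m) : ComposableArrows SemiSimplexCategoryᵒᵖ n :=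
  a.monotone.functor ⋙ faceFunctor m

/-- The images of the objects of a string in its first object. -/
def stringFlag {n : ℕ} (σ : ComposableArrows SemiSimplexCategoryᵒᵖ n) :
    Fin (n + 1) →o Face (σ.obj 0).unop.len where
  toFun j := OrderDual.toDual ⟨Finset.univ.map
    (arrowEmb (σ.map (homOfLE (Fin.zero_le j)))).toEmbedding, by simp⟩
  monotone' i j hij := by
    have : σ.map (homOfLE (Fin.zero_le j)) =
        σ.map (homOfLE (Fin.zero_le i)) ≫ σ.map (homOfLE hij) := by
      rw [← Functor.map_comp]
      rfl
    intro k hk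
    obtain ⟨l, -, rfl⟩ := Finset.mem_map.1 hk
    change arrowEmb (σ.map (homOfLE (Fin.zero_le j))) l ∈
      Finset.univ.map (arrowEmb (σ.map (homOfLE (Fin.zero_le i)))).toEmbedding
    rw [this, arrowEmb_comp]
    exact Finset.mem_map_of_mem _ (Finset.mem_univ _)

theorem stringFlag_set {n : ℕ} (σ : ComposableArrows SemiSimplexCategoryᵒᵖ n) (j : Fin (n + 1)) :
    (stringFlag σ j).set = Finset.univ.map
      (arrowEmb (σ.map (homOfLE (Fin.zero_le j)))).toEmbedding := rfl

theorem stringFlag_obj {n : ℕ} (σ : ComposableArrows SemiSimplexCategoryᵒᵖ n) (j : Fin (n + 1)) :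
    σ.obj j = (stringFlag σ j).obj := by
  rw [Face.obj, stringFlag_set, Finset.card_map, Finset.card_univ, Fintype.card_fin]
  rfl

theorem stringFlag_arrow {n : ℕ} (σ : ComposableArrows SemiSimplexCategoryᵒᵖ n)
    (j : Fin (n + 1)) :
    σ.map (homOfLE (Fin.zero_le j)) ≫ eqToHom (stringFlag_obj σ j) = (stringFlag σ j).arrow := by
  refine arrow_eq_of_range_eq ?_
  rw [Face.range_arrow, arrowEmb_comp, Set.range_comp, range_arrowEmb_eqToHom, stringFlag_set]
  simp

theorem stringFlag_zero {n : ℕ} (σ : ComposableArrows SemiSimplexCategoryᵒᵖ n) :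
    (stringFlag σ 0).set = Finset.univ := by
  rw [stringFlag_set]
  ext k
  have : σ.map (homOfLE (Fin.zero_le 0)) = 𝟙 _ := σ.map_id 0
  rw [this]
  simp only [Finset.mem_map, Finset.mem_univ, true_and, iff_true]
  exact ⟨k, rfl⟩

variable {F : SemiSimplexCategoryᵒᵖ ⥤ TopCat.{v}}

/-- The point of the homotopy colimit given by a point of the value of the diagram at `{0, …, m}`,
a flag of subsets, and a point of a simplex. -/
def flagPoint {n : ℕ} (a : Fin (n + 1) →o Face m) (x : F.obj (.op (.mk m)))
    (t : stdSimplex ℝ (Fin (n + 1))) : Hocolim F :=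
  Quot.mk _ ⟨n, flagString a, F.map (a 0).arrow x, t⟩

theorem flagPoint_map {n k : ℕ} (a : Fin (n + 1) →o Face m) (x : F.obj (.op (.mk m)))
    (θ : Fin (k + 1) →o Fin (n + 1)) (t : stdSimplex ℝ (Fin (k + 1))) :
    flagPoint a x (stdSimplex.map θ t) = flagPoint (a.comp θ) x t := by
  refine (Quot.sound (HocolimRel.op θ _ _ _)).trans ?_
  have : F.map ((flagString a).map (homOfLE (Fin.zero_le (θ 0)))) (F.map (a 0).arrow x) =
      F.map (a (θ 0)).arrow x := by
    rw [← Face.arrow_map (a.monotone (Fin.zero_le (θ 0))), F.map_comp]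
    rfl
  rw [this]
  rfl

/-- Objects are determined by their lengths and arrows by their images, so a string coincides with
the one built from the images of its objects in the first one. -/
theorem mk_eq_flagPoint {n : ℕ} (σ : ComposableArrows SemiSimplexCategoryᵒᵖ n)
    (x : F.obj (σ.obj 0)) (t : stdSimplex ℝ (Fin (n + 1))) :
    (Quot.mk _ ⟨n, σ, x, t⟩ : Hocolim F) = flagPoint (stringFlag σ) x t := by
  refine congrArg (Quot.mk _) (hocolimPoint_ext (τ := flagString (stringFlag σ))
    (stringFlag_obj σ) _ (fun j => ?_) x t)
  exact (stringFlag_arrow σ j).trans (Face.arrow_map ((stringFlag σ).monotone (Fin.zero_le j))).symm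

theorem Hocolim.exists_pos (n : ℕ) (σ : ComposableArrows SemiSimplexCategoryᵒᵖ n)
    (x : F.obj (σ.obj 0)) (t : stdSimplex ℝ (Fin (n + 1))) :
    ∃ (n' : ℕ) (σ' : ComposableArrows SemiSimplexCategoryᵒᵖ n') (x' : F.obj (σ'.obj 0))
      (t' : stdSimplex ℝ (Fin (n' + 1))), (∀ l, 0 < t' l) ∧
      (Quot.mk _ ⟨n, σ, x, t⟩ : Hocolim F) = Quot.mk _ ⟨n', σ', x', t'⟩ := by
  induction n with
  | zero =>
    refine ⟨0, σ, x, t, fun l => ?_, rfl⟩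
    have : t l = 1 := stdSimplex.eq_one_of_unique (X := Fin 1) t l
    rw [this]
    exact one_pos
  | succ n ih =>
    by_cases hpos : ∀ l, 0 < t l
    · exact ⟨_, σ, x, t, hpos, rfl⟩
    · push Not at hpos
      obtain ⟨l, hl⟩ := hpos
      obtain ⟨t', rfl⟩ := exists_eq_map_succAbove (le_antisymm hl (stdSimplex.zero_le t l))
      obtain ⟨n', σ', x', t'', h1, h2⟩ := ih _ _ t'
      exact ⟨n', σ', x', t'', h1,
        (Quot.sound (HocolimRel.op (l.succAboveOrderEmb).toOrderHom σ x t')).trans h2⟩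

theorem stdSimplex_map_pos {k n : ℕ} {θ : Fin (k + 1) → Fin (n + 1)} (hθ : Function.Surjective θ)
    {t : stdSimplex ℝ (Fin (k + 1))} (ht : ∀ l, 0 < t l) (l : Fin (n + 1)) :
    0 < stdSimplex.map θ t l := by
  rw [stdSimplex.map_coe, FunOnFinite.linearMap_apply_apply]
  obtain ⟨j, hj⟩ := hθ l
  exact Finset.sum_pos (fun i _ => ht i) ⟨j, by simpa using hj⟩

/-- Two equal consecutive terms are merged and their coefficients added, by the relation for a
nondecreasing surjection. The coefficients stay positive. -/
theorem flagPoint_exists_strictMono {n : ℕ} (a : Fin (n + 1) →o Face m) (x : F.obj (.op (.mk m)))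
    (t : stdSimplex ℝ (Fin (n + 1))) (ht : ∀ l, 0 < t l) :
    ∃ (k : ℕ) (b : Fin (k + 1) →o Face m) (s : stdSimplex ℝ (Fin (k + 1))), StrictMono b ∧
      b 0 = a 0 ∧ (∀ l, 0 < s l) ∧ flagPoint a x t = flagPoint b x s := by
  induction n with
  | zero => exact ⟨0, a, t, fun i j h => by omega, rfl, ht, rfl⟩
  | succ n ih =>
    by_cases hs : StrictMono a
    · exact ⟨_, a, t, hs, rfl, ht, rfl⟩
    · rw [Fin.strictMono_iff_lt_succ] at hs
      push Not at hs
      obtain ⟨i, hi⟩ := hs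
      have hi : a i.castSucc = a i.succ :=
        (a.monotone (Fin.castSucc_lt_succ (i := i)).le).eq_of_not_lt hi
      let θ : Fin (n + 2) →o Fin (n + 1) := ⟨i.predAbove, Fin.predAbove_right_monotone i⟩
      let δ : Fin (n + 1) →o Fin (n + 2) := (i.castSucc.succAboveOrderEmb).toOrderHom
      have e : (a.comp δ).comp θ = a := by
        refine OrderHom.ext _ _ (funext fun j => ?_)
        change a (i.castSucc.succAbove (i.predAbove j)) = a j
        by_cases hj : j = i.castSucc
        · rw [hj, Fin.predAbove_castSucc_self, Fin.succAbove_castSucc_self, hi]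
        · rw [Fin.succAbove_predAbove hj]
      have hθ : Function.Surjective θ := Fin.predAbove_surjective i
      obtain ⟨k, b, s, h1, h2, h3, h4⟩ := ih (a.comp δ) (stdSimplex.map θ t)
        (stdSimplex_map_pos hθ ht)
      refine ⟨k, b, s, h1, ?_, h3, ?_⟩
      · have h0 : θ 0 = 0 := by
          obtain ⟨j, hj⟩ := hθ 0
          exact le_antisymm (hj ▸ θ.monotone (Fin.zero_le j)) (Fin.zero_le _)
        rw [h2, ← h0]
        exact DFunLike.congr_fun e 0
      · rw [← h4, flagPoint_map, e]

/-- Normal form for points of the homotopy colimit: a strict flag that starts with the whole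
simplex, with positive coefficients. -/
theorem Hocolim.exists_flagPoint (p : Hocolim F) : ∃ (m n : ℕ) (a : Fin (n + 1) →o Face m)
    (x : F.obj (.op (.mk m))) (t : stdSimplex ℝ (Fin (n + 1))), StrictMono a ∧
      (a 0).set = Finset.univ ∧ (∀ l, 0 < t l) ∧ p = flagPoint a x t := by
  obtain ⟨n, σ, x, t⟩ := p
  obtain ⟨n', σ', x', t', ht', e⟩ := Hocolim.exists_pos n σ x t
  obtain ⟨k, b, s, h1, h2, h3, h4⟩ := flagPoint_exists_strictMono (stringFlag σ') x' t' ht'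
  exact ⟨_, k, b, x', s, h1, by rw [h2, stringFlag_zero], h3,
    e.trans ((mk_eq_flagPoint σ' x' t').trans h4)⟩

end Strings

/-! ### The homotopy colimit -/

/-! ### Flags of faces and the barycentric subdivision of a simplex -/

section Flags

variable {m n : ℕ}

theorem Face.len_add_one (S : Face m) : (S.obj.unop.len : ℝ) + 1 = S.set.card := by
  rw [S.card_eq]
  push_cast
  rfl

theorem Face.card_pos (S : Face m) : 0 < (S.set.card : ℝ) := by
  rw [← S.len_add_one]
  positivity

theorem continuous_coneBarycenter {c : SemiSimplexCategoryᵒᵖ}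
    {d : Fin (n + 1) → SemiSimplexCategoryᵒᵖ} (g : ∀ j, c ⟶ d j) :
    Continuous (coneBarycenter g) := by
  have ht : ∀ j, Continuous fun t : stdSimplex ℝ (Fin (n + 1)) => t j := fun j =>
    (continuous_apply j).comp continuous_subtype_val
  exact Continuous.subtype_mk
    (continuous_finsetSum _ fun j _ => (ht j).smul continuous_const) _

/-- The combination with coefficients `t` of the barycenters of the terms of a flag. -/
def flagBarycenter (a : Fin (n + 1) → Face m) (t : stdSimplex ℝ (Fin (n + 1))) :
    stdSimplex ℝ (Fin (m + 1)) :=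
  coneBarycenter (fun j => (a j).arrow) t

theorem flagBarycenter_apply (a : Fin (n + 1) → Face m) (t : stdSimplex ℝ (Fin (n + 1)))
    (k : Fin (m + 1)) : flagBarycenter a t k =
      chainWeight (fun j => ((a j).set : Set (Fin (m + 1)))) (fun j => t j / (a j).set.card) k := by
  refine (coneBarycenter_apply (fun j => (a j).arrow) t k).trans ?_
  simp only [Face.range_arrow, Face.len_add_one]

theorem flagBarycenter_pos {a : Fin (n + 1) → Face m} (ha : (a 0).set = Finset.univ)
    {t : stdSimplex ℝ (Fin (n + 1))} (ht : ∀ l, 0 < t l) (k : Fin (m + 1)) :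
    0 < flagBarycenter a t k := by
  rw [flagBarycenter_apply]
  have hw : ∀ j, 0 < t j / (a j).set.card := fun j => div_pos (ht j) (a j).card_pos
  refine Finset.sum_pos' (fun l _ => ?_) ⟨0, Finset.mem_univ _, ?_⟩
  · split_ifs
    · exact (hw l).le
    · exact le_rfl
  · rw [if_pos (by simp [ha])]
    exact hw 0

theorem chainWeight_rev {α : Type*} (S : Fin n → Set α) (w : Fin n → ℝ) (a : α) :
    chainWeight (fun l => S l.rev) (fun l => w l.rev) a = chainWeight S w a := by
  classical
  exact Equiv.sum_comp Fin.revPerm fun l => if a ∈ S l then w l else 0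

theorem Face.strictMono_rev {a : Fin (n + 1) →o Face m} (ha : StrictMono a) :
    StrictMono fun l : Fin (n + 1) => ((a l.rev).set : Set (Fin (m + 1))) := fun i j hij =>
  Finset.coe_ssubset.2 (show (a i.rev).set < (a j.rev).set from ha (Fin.rev_lt_rev.2 hij))

/-- This is `chain_unique` for the flag read backwards, as its terms decrease, with coefficients
divided by the numbers of vertices. -/
theorem flag_eq_of_flagBarycenter_eq {n' : ℕ} {a : Fin (n + 1) →o Face m}
    {a' : Fin (n' + 1) →o Face m} {t : stdSimplex ℝ (Fin (n + 1))}
    {t' : stdSimplex ℝ (Fin (n' + 1))} (ha : StrictMono a) (ha' : StrictMono a')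
    (ht : ∀ l, 0 < t l) (ht' : ∀ l, 0 < t' l) (h : flagBarycenter a t = flagBarycenter a' t') :
    (⟨n, a, t⟩ : Σ n : ℕ, (Fin (n + 1) →o Face m) × stdSimplex ℝ (Fin (n + 1))) =
      ⟨n', a', t'⟩ := by
  have key := chain_unique (Face.strictMono_rev ha)
    (w := fun l => t l.rev / (a l.rev).set.card)
    (Finset.coe_nonempty.2 (OrderDual.ofDual (a (Fin.rev 0))).2)
    (fun l => div_pos (ht _) (Face.card_pos _)) (Face.strictMono_rev ha')
    (w' := fun l => t' l.rev / (a' l.rev).set.card)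
    (Finset.coe_nonempty.2 (OrderDual.ofDual (a' (Fin.rev 0))).2)
    (fun l => div_pos (ht' _) (Face.card_pos _)) fun k => by
      rw [chainWeight_rev (fun l => ((a l).set : Set (Fin (m + 1))))
        (fun l => t l / (a l).set.card), chainWeight_rev
        (fun l => ((a' l).set : Set (Fin (m + 1)))) (fun l => t' l / (a' l).set.card),
        ← flagBarycenter_apply, ← flagBarycenter_apply, h]
  obtain rfl : n = n' := congrArg Sigma.fst key
  simp only [Sigma.mk.injEq, heq_eq_eq, true_and, Prod.mk.injEq] at key
  have hat : a = a' := by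
    refine OrderHom.ext _ _ (funext fun l => ?_)
    have := Finset.coe_injective (congrFun key.1 l.rev)
    rw [Fin.rev_rev] at this
    exact OrderDual.ofDual_inj.1 (Subtype.ext this)
  subst hat
  have htt : t = t' := by
    refine stdSimplex.ext (funext fun l => ?_)
    have := congrFun key.2 l.rev
    rw [Fin.rev_rev] at this
    exact (div_left_inj' (Face.card_pos (a l)).ne').1 this
  rw [htt]

theorem exists_flagBarycenter_eq (b : stdSimplex ℝ (Fin (m + 1))) :
    ∃ (n : ℕ) (a : Fin (n + 1) →o Face m) (t : stdSimplex ℝ (Fin (n + 1))),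
      flagBarycenter a t = b := by
  classical
  obtain ⟨n, S, w, hS, hS0, hw, hsum⟩ := exists_chain (fun k => b k) (stdSimplex.zero_le b) (by
    by_contra hb
    push Not at hb
    have := stdSimplex.sum_eq_one b
    rw [Finset.sum_eq_zero fun i _ => le_antisymm (hb i) (stdSimplex.zero_le b i)] at this
    exact zero_ne_one this)
  let a : Fin (n + 1) →o Face m := ⟨fun l => OrderDual.toDual ⟨(S l.rev).toFinset,
    Set.toFinset_nonempty.2 (hS0.mono (hS.monotone (Fin.zero_le _)))⟩, fun i j hij => by
      change (S j.rev).toFinset ⊆ (S i.rev).toFinset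
      exact Set.toFinset_subset_toFinset.2 (hS.monotone (Fin.rev_le_rev.2 hij))⟩
  have ha : ∀ l, (a l).set = (S l.rev).toFinset := fun _ => rfl
  -- Counting the vertices of each set identifies this sum with the total mass of b.
  have hs1 : ∑ l : Fin (n + 1), w l.rev * ((a l).set.card : ℝ) = 1 := by
    rw [← stdSimplex.sum_eq_one b]
    simp only [← hsum, chainWeight]
    rw [Finset.sum_comm, ← Equiv.sum_comp Fin.revPerm]
    refine Finset.sum_congr rfl fun l _ => ?_
    rw [← Finset.sum_filter, Finset.sum_const, nsmul_eq_mul, mul_comm, ha, Fin.revPerm_apply]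
    rw [Fin.rev_rev]
    congr 1
    rw [Nat.cast_inj]
    congr 1
    ext k
    simp
  refine ⟨n, a, ⟨fun l => w l.rev * (a l).set.card,
    fun l => mul_nonneg (hw _).le (Face.card_pos _).le, hs1⟩, stdSimplex.ext (funext fun k => ?_)⟩
  rw [flagBarycenter_apply, ← hsum k, ← chainWeight_rev S w]
  have e1 : (fun l => ((a l).set : Set (Fin (m + 1)))) = fun l => S l.rev := by
    funext l
    rw [ha, Set.coe_toFinset]
  rw [e1]
  congr 1
  funext l
  exact mul_div_cancel_right₀ _ (Face.card_pos (a l)).ne'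

theorem Face.length_le {a : Fin (n + 1) →o Face m} (ha : StrictMono a) : n ≤ m := by
  have key : ∀ j : Fin (n + 1), (j : ℕ) + (a j).set.card ≤ m + 1 := by
    intro j
    induction j using Fin.induction with
    | zero => simpa using (Finset.card_le_univ (a 0).set)
    | succ i ih =>
      have : (a i.succ).set < (a i.castSucc).set := ha (Fin.castSucc_lt_succ (i := i))
      have := Finset.card_lt_card this
      simp only [Fin.val_castSucc, Fin.val_succ] at ih ⊢
      omega
  have h1 := key (Fin.last n)
  have h2 : 0 < (a (Fin.last n)).set.card := Finset.card_pos.2 (OrderDual.ofDual (a (Fin.last n))).2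
  rw [Fin.val_last] at h1
  omega

instance finite_orderHom_face (m n : ℕ) : Finite (Fin (n + 1) →o Face m) :=
  have : Finite (Face m) := inferInstanceAs (Finite {S : Finset (Fin (m + 1)) // S.Nonempty})
  DFunLike.finite _

end Flags

/-! ### Comparison of the homotopy colimit with the fibre product of cones -/

section HomotopyColimit

variable {N : ℕ} {X : Type u} [TopologicalSpace X] [ChartedSpace (Fin N → ℂ) X]
  {I : Type v} {D : I → Set X} {V : Type*} [AddCommGroup V] [Module ℝ V] [TopologicalSpace V]
  {w : ∀ i, DivisorBlowUp N (D i) → V} [ContinuousSMul ℝ V]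
  (h : IsRayFamily D (fun i => (DivisorBlowUp.base : DivisorBlowUp N (D i) → X)) w)

/-- The map from the homotopy colimit to the fibre product of cones. -/
def hocolimToConeSpace (p : Hocolim (semiSimplicialSpace N D)) :
    coneSpace D (fun i => (DivisorBlowUp.base : DivisorBlowUp N (D i) → X)) w Set.univ :=
  Quot.lift (fun p : Σ (n : ℕ) (σ : ComposableArrows SemiSimplexCategoryᵒᵖ n),
      (semiSimplicialSpace N D).obj (σ.obj 0) × stdSimplex ℝ (Fin (n + 1)) =>
    Simplices.toConeSpace h (n := (p.2.1.obj 0).unop.len)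
      (p.2.2.1, coneBarycenter (fun j => p.2.1.map (homOfLE (Fin.zero_le j))) p.2.2.2)) (by
    rintro _ _ ⟨θ, σ, x, t⟩
    have e : (fun j => σ.map (homOfLE (Fin.zero_le (θ j)))) = fun j =>
        σ.map (homOfLE (Fin.zero_le (θ 0))) ≫
          (σ.whiskerLeft θ.monotone.functor).map (homOfLE (Fin.zero_le j)) := by
      funext j
      exact σ.map_comp (homOfLE (Fin.zero_le (θ 0))) (homOfLE (θ.monotone (Fin.zero_le j)))
    have e2 := Simplices.toConeSpace_map h (arrowEmb (σ.map (homOfLE (Fin.zero_le (θ 0))))) x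
      (coneBarycenter (fun j =>
        (σ.whiskerLeft θ.monotone.functor).map (homOfLE (Fin.zero_le j))) t)
    refine Eq.trans ?_ e2.symm
    refine congrArg (fun b => Simplices.toConeSpace h (x, b)) ?_
    exact (coneBarycenter_map θ _ t).trans
      ((congrArg (fun g => coneBarycenter g t) e).trans (map_coneBarycenter _ _ t).symm)) p

theorem hocolimToConeSpace_flagPoint {m n : ℕ} (a : Fin (n + 1) →o Face m)
    (x : Simplices N D m) (t : stdSimplex ℝ (Fin (n + 1))) :
    hocolimToConeSpace h (flagPoint (F := semiSimplicialSpace N D) a x t) =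
      Simplices.toConeSpace h (x, flagBarycenter a t) := by
  have e2 := Simplices.toConeSpace_map h (arrowEmb (a 0).arrow) x
    (coneBarycenter (fun j => (flagString a).map (homOfLE (Fin.zero_le j))) t)
  refine e2.trans (congrArg (fun b => Simplices.toConeSpace h (x, b)) ?_)
  refine (map_coneBarycenter (a 0).arrow
    (fun j => (flagString a).map (homOfLE (Fin.zero_le j))) t).trans ?_
  refine congrArg (fun g => coneBarycenter g t) (funext fun j => ?_)
  exact Face.arrow_map (a.monotone (Fin.zero_le j))

theorem continuous_hocolimToConeSpace : Continuous (hocolimToConeSpace h) := by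
  refine continuous_coinduced_dom.2 (continuous_sigma fun n => continuous_sigma fun σ => ?_)
  have hg := continuous_coneBarycenter fun j => σ.map (homOfLE (Fin.zero_le j))
  have hc : Continuous fun z : Simplices N D (σ.obj 0).unop.len × stdSimplex ℝ (Fin (n + 1)) =>
      (z.1, coneBarycenter (fun j => σ.map (homOfLE (Fin.zero_le j))) z.2) :=
    continuous_fst.prodMk (hg.comp continuous_snd)
  exact (Simplices.continuous_toConeSpace h (σ.obj 0).unop.len).comp hc

/-- For points in normal form the combination of barycenters is interior to the simplex, so the
simplex, its point and the combination are recovered first, and then the flag and its coefficients.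
-/
theorem injective_hocolimToConeSpace : Function.Injective (hocolimToConeSpace h) := by
  intro p p' hpp
  obtain ⟨m, n, a, x, t, ha, ha0, ht, rfl⟩ := Hocolim.exists_flagPoint p
  obtain ⟨m', n', a', x', t', ha', ha0', ht', rfl⟩ := Hocolim.exists_flagPoint p'
  replace hpp := (hocolimToConeSpace_flagPoint h a x t).symm.trans
    (hpp.trans (hocolimToConeSpace_flagPoint h a' x' t'))
  have h1 := congrArg Subtype.val hpp
  have h2 := Simplices.eq_of_vec_eq h (flagBarycenter_pos ha0 ht) (flagBarycenter_pos ha0' ht')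
    (congrArg Prod.fst h1) (congrArg Prod.snd h1)
  obtain rfl : m = m' := congrArg Sigma.fst h2
  obtain ⟨hx, hb⟩ := Prod.mk.inj (eq_of_heq (Sigma.mk.inj h2).2)
  obtain rfl : x = x' := hx
  have h3 := flag_eq_of_flagBarycenter_eq ha ha' ht ht' hb
  exact congrArg (fun q : Σ n : ℕ, (Fin (n + 1) →o Face m) × stdSimplex ℝ (Fin (n + 1)) =>
    flagPoint (F := semiSimplicialSpace N D) q.2.1 x q.2.2) h3

/-- The simplicial replacement involves infinitely many strings, but normal forms use only the
finitely many flags in simplices of dimension at most the cardinality of I. These provide the proper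
cover. -/
theorem isHomeomorph_hocolimToConeSpace [T2Space X] [T2Space V] [Finite I] :
    IsHomeomorph (hocolimToConeSpace h) := by
  let ι := Σ (m : Fin (Nat.card I + 1)) (n : Fin (Nat.card I + 1)), Fin (n + 1 : ℕ) →o Face m
  let q : (Σ k : ι, Simplices N D k.1 × stdSimplex ℝ (Fin (k.2.1 + 1 : ℕ))) →
      Hocolim (semiSimplicialSpace N D) := fun k => flagPoint k.1.2.2 k.2.1 k.2.2
  refine isHomeomorph_of_proper_cover (q := q) (p := fun y => y.1.1)
    (continuous_hocolimToConeSpace h) ⟨injective_hocolimToConeSpace h, ?_⟩ ?_ ?_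
    (by fun_prop) (isProperMap_sigma fun k => ?_)
  · intro y
    obtain ⟨m, s, b, -, e⟩ := Simplices.exists_vec_eq y
    obtain ⟨n, a, t, rfl⟩ := exists_flagBarycenter_eq b
    exact ⟨flagPoint a s t, (hocolimToConeSpace_flagPoint h a s t).trans (Subtype.ext e)⟩
  · refine continuous_sigma fun k => ?_
    have c1 : Continuous fun z : Simplices N D k.1 × stdSimplex ℝ (Fin (k.2.1 + 1 : ℕ)) =>
        ((semiSimplicialSpace N D).map (k.2.2 0).arrow z.1, z.2) :=
      (((semiSimplicialSpace N D).map (k.2.2 0).arrow).hom.continuous.comp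
        continuous_fst).prodMk continuous_snd
    exact continuous_coinduced_rng.comp ((continuous_sigmaMk (σ := fun n : ℕ =>
      Σ (σ : ComposableArrows SemiSimplexCategoryᵒᵖ n), (semiSimplicialSpace N D).obj (σ.obj 0) ×
        stdSimplex ℝ (Fin (n + 1)))).comp ((continuous_sigmaMk
        (σ := fun σ : ComposableArrows SemiSimplexCategoryᵒᵖ k.2.1 =>
          (semiSimplicialSpace N D).obj (σ.obj 0) × stdSimplex ℝ (Fin (k.2.1 + 1 : ℕ)))
        (i := flagString k.2.2)).comp c1))
  · intro p
    obtain ⟨m, n, a, x, t, ha, -, -, rfl⟩ := Hocolim.exists_flagPoint p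
    have hm : m ≤ Nat.card I := (show Simplices N D m from x).1.length_le
    exact ⟨⟨⟨⟨m, Nat.lt_succ_of_le hm⟩, ⟨n, Nat.lt_succ_of_le ((Face.length_le ha).trans hm)⟩, a⟩,
      x, t⟩, rfl⟩
  · have e : (fun z : Simplices N D k.1 × stdSimplex ℝ (Fin (k.2.1 + 1 : ℕ)) =>
        (hocolimToConeSpace h (q ⟨k, z⟩)).1.1) = fun z => z.1.2.1.base := by
      funext z
      exact congrArg (fun y => y.1.1) (hocolimToConeSpace_flagPoint h k.2.2 z.1 z.2)
    rw [e]
    exact isProperMap_simplicesProd_base h k.1 k.2.1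

theorem isHomotopyEquivalence_hocolim [T2Space X] [T2Space V] [Finite I]
    (h : IsRayFamily D (fun i => (DivisorBlowUp.base : DivisorBlowUp N (D i) → X)) w)
    (hb : IsHomotopyEquivalence (coneSpace.base (D := D)
      (β := fun i => (DivisorBlowUp.base : DivisorBlowUp N (D i) → X)) (w := w) Set.univ)) :
    IsHomotopyEquivalence
      (Hocolim.desc (semiSimplicialSpaceAugmentation (N := N) D)) := by
  have hh := isHomeomorph_hocolimToConeSpace h
  have e : Hocolim.desc (semiSimplicialSpaceAugmentation (N := N) D) =
      (coneSpace.base (D := D) (β := fun i => (DivisorBlowUp.base : DivisorBlowUp N (D i) → X))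
        (w := w) Set.univ).comp ⟨_, hh.continuous⟩ := by
    ext ⟨p⟩
    rfl
  rw [e]
  exact hb.comp (IsHomotopyEquivalence.of_isHomeomorph ⟨_, hh.continuous⟩ hh)

end HomotopyColimit

end SNC

end

theorem mainTheorem4 {N : ℕ} {X : Type u} [TopologicalSpace X] [T2Space X]
    [SecondCountableTopology X] [ChartedSpace (Fin N → ℂ) X]
    [IsManifold 𝓘(ℂ, Fin N → ℂ) ω X] {I : Type v} [Finite I] (D : I → Set X)
    (hD : SNC.IsSNC N D) :
    SNC.IsHomotopyEquivalence
        (SNC.Realization.desc (SNC.semiSimplicialSpaceAugmentation (N := N) D)) ∧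
      SNC.IsHomotopyEquivalence
        (SNC.Hocolim.desc (SNC.semiSimplicialSpaceAugmentation (N := N) D)) ∧
      ∀ (k : ℕ) (J : Fin (k + 1) → Set I) (hJ : StrictMono J),
        SNC.IsTorusBundle (J (Fin.last k) \ J 0 : Set I)
          (SNC.Piece.toBlowUp (N := N) (D := D)
            (hJ.monotone (Fin.zero_le (Fin.last k))) subset_rfl) := by
  -- Local compactness, with the Hausdorff and second countability hypotheses, yields the normality
  -- and paracompactness used for the cutoffs and partitions of unity.
  have : LocallyCompactSpace X := ChartedSpace.locallyCompactSpace (Fin N → ℂ) X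
  obtain ⟨w, hw⟩ := hD.exists_isRayFamily
  have hb := hw.isHomotopyEquivalence_base hD.exists_isLocalShrinking Set.univ
  exact ⟨SNC.isHomotopyEquivalence_realization hw hb, SNC.isHomotopyEquivalence_hocolim hw hb,
    fun k J hJ => hD.isTorusBundle _⟩
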